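/- Fixed-width arithmetics. A fixed-width arithmetic $F$ represents numbers with a fixed number $b$ of bits. It is either fixed-point (the $2^b$ numbers $k/2^f$ with $-2^{b-1}\le k<2^{b-1}$, $0\le f<b$, with overflow handled either by saturation or by wrap-around) or floating-point (a sign bit, at least one exponent bit, and mantissa bits; subnormal numbers, no infinities; overflow handled by saturation). Results are rounded down, up, towards zero, or to the nearest value. The value of each arithmetic operation, and of $\exp$, is the exact value represented in $F$; a quotient with divisor $0$ is $0$, and sums are computed from left to right. Encoders. A transformer encoder $T$ over $F$ and a finite alphabet $\Sigma$ consists of a positional embedding $\mathit{emb}$, finitely many layers, each with finitely many attention heads and a combination function, and an output function. On a non-empty word $w=a_1\dots a_n$ it computes $x^0_m=\mathit{emb}(a_m,m)$. Layer $i$ maps $x^{i-1}_1\dots x^{i-1}_n$ to $x^i_1\dots x^i_n$ with $x^i_m=\mathit{comb}_i(x^{i-1}_m,y_{m,1},\dots,y_{m,h_i})$, where $y_{m,j}=\sum_{l=1}^n \mathit{norm}_{i,j}(l,s_1,\dots,s_n)\,(W_{i,j}x^{i-1}_l)$, $s_l=\mathit{score}_{i,j}(x^{i-1}_m,x^{i-1}_l)$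 and $\mathit{norm}_{i,j}$ is softmax or hardmax. $T(w)$ is the output function applied to the last vector after the last layer. All parameters are numbers of $F$ and all values and computations, including positions, are represented and carried out in $F$. The embedding (an arbitrary function of the symbol and the representation of the position in $F$), scoring, combination and output functions are arbitrary functions over $F$, presented by straight-line programs over $F$ (constants, $+,-,\cdot,/$ and case distinctions $u\le v$), and $T$ is presented as a bit string, with $|\Sigma|$, the dimensions and the bit width of $F$ counted in unary. Let $\mathcal{T}^{\mathrm{fix}}$ be the class of all these encoders, and $\mathcal{T}^{\mathrm{fix}}_{\mathrm{sat}}$ the subclass of those whose arithmetic handles overflow by saturation. For a class $\mathcal{T}$, the problem $\mathrm{trSAT}[\mathcal{T}]$ is: given $T\in\mathcal{T}$ over $\Sigma$, is there a word $w\in\Sigma^+$ with $T(w)=1$? **Theorem.** For both $\mathcal{T}=\mathcal{T}^{\mathrm{fix}}$ and $\mathcal{T}=\mathcal{T}^{\mathrm{fix}}_{\mathrm{sat}}$, the problem $\mathrm{trSAT}[\mathcal{T}]$ is decidable, and it is NEXPTIME-hard under polynomial-time many-one reductions, where NEXPTIME is the class of languages decided by nondeterministic Turing machines in time $2^{p(n)}$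 for a polynomial $p$. -/

import Mathlib

/-! ## Complexity classes over the alphabet `Bool` -/

namespace Complexity

/-- A nondeterministic Turing machine with one tape that is infinite to the right.
`delta q g` is the finite set of possible actions (new state, written symbol, head move) when the
machine is in state `q` and reads `g`; the machine halts when this set is empty. -/
structure NTM where
  State : Type
  Sym : Type
  finite_state : Finite State
  finite_sym : Finite Sym
  start : State
  accept : State
  blank : Sym
  bit : Bool → Sym
  bit_injective : Function.Injective bit
  bit_ne_blank : ∀ b, bit b ≠ blank
  delta : State → Sym → Set (State × Sym × Turing.Dir)

namespace NTM

/-- A configuration: current state, head position and tape content. -/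
structure Config (M : NTM) where
  state : M.State
  head : ℕ
  tape : ℕ → M.Sym

/-- Moving the head; a left move on the leftmost cell leaves the head where it is. -/
def moveHead : Turing.Dir → ℕ → ℕ
  | Turing.Dir.left, n => n - 1
  | Turing.Dir.right, n => n + 1

/-- The initial configuration on input `x`: the input on the leftmost cells, blanks elsewhere. -/
def init (M : NTM) (x : List Bool) : M.Config where
  state := M.start
  head := 0
  tape := fun n => (x[n]?).elim M.blank M.bit

/-- One step of the machine. -/
def Step (M : NTM) (c c' : M.Config) : Prop :=
  ∃ a ∈ M.delta c.state (c.tape c.head),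
    c'.state = a.1 ∧ c'.tape = Function.update c.tape c.head a.2.1 ∧
      c'.head = moveHead a.2.2 c.head

/-- `M.Reach x n c`: some computation path on input `x` is in configuration `c` after exactly
`n` steps. -/
def Reach (M : NTM) (x : List Bool) : ℕ → M.Config → Prop
  | 0, c => c = M.init x
  | n + 1, c => ∃ c', M.Reach x n c' ∧ M.Step c' c

/-- `M` decides `L` in time `t`: on every input of length `n` every computation path halts within
`t n` steps, and an input is in `L` iff some path reaches the accepting state. -/
def DecidesInTime (M : NTM) (L : Language Bool) (t : ℕ → ℕ) : Prop :=
  ∀ x : List Bool,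
    (∀ n c, M.Reach x n c → n ≤ t x.length) ∧
      (x ∈ L ↔ ∃ n c, M.Reach x n c ∧ c.state = M.accept)

end NTM

/-- `NEXPTIME`: languages decided by a nondeterministic Turing machine in time `2 ^ p(n)` for some
polynomial `p`. -/
def NEXPTIME : Set (Language Bool) :=
  {L | ∃ (M : NTM) (p : Polynomial ℕ), M.DecidesInTime L (fun n => 2 ^ p.eval n)}

/-- `f` is computable in polynomial time (by a deterministic machine with finitely many stacks). -/
def PolyTime (f : List Bool → List Bool) : Prop :=
  Nonempty (Turing.TM2ComputableInPolyTime (id : List Bool → List Bool) id f)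

/-- Polynomial-time many-one reducibility. -/
def PolyReducible (A B : Language Bool) : Prop :=
  ∃ f : List Bool → List Bool, PolyTime f ∧ ∀ x, x ∈ A ↔ f x ∈ B

/-- Hardness for `NEXPTIME` under polynomial-time many-one reductions. -/
def NEXPTIMEHard (B : Language Bool) : Prop :=
  ∀ A ∈ NEXPTIME, PolyReducible A B

/-- Algorithmic decidability of a language. -/
def Decidable (B : Language Bool) : Prop :=
  ComputablePred (fun s : List Bool => s ∈ B)

end Complexity

namespace Transformer

/-! ## Fixed-width arithmetics -/

/-- Rounding: towards `-∞`, towards `+∞`, towards `0` (cutting off), or to the nearest value. -/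
inductive Rounding
  | down
  | up
  | cut
  | nearest

/-- Rounding a real number to an integer. -/
noncomputable def Rounding.toInt : Rounding → ℝ → ℤ
  | down, x => ⌊x⌋
  | up, x => ⌈x⌉
  | cut, x => if 0 ≤ x then ⌊x⌋ else ⌈x⌉
  | nearest, x => round x

/-- Overflow handling. -/
inductive Overflow
  | saturate
  | wrap

/-- A fixed-width arithmetic.
* `fixed i f o r`: two's complement fixed-point numbers with `b = 1 + i + f` bits (a sign bit, `i`
  integer bits, `f` fractional bits), that is, the `2 ^ b` numbers `k / 2 ^ f` with
  `-2 ^ (i + f) ≤ k < 2 ^ (i + f)`; overflow is handled by `o`, rounding by `r`.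
* `float e m r`: floating-point numbers with `b = 1 + (e + 1) + m` bits (a sign bit, `e + 1`
  exponent bits with bias `2 ^ e - 1`, `m` mantissa bits), with subnormal numbers and without
  infinities; overflow saturates, rounding is handled by `r`. -/
inductive Arith
  | fixed (i f : ℕ) (o : Overflow) (r : Rounding)
  | float (e m : ℕ) (r : Rounding)

namespace Arith

/-- Overflow is handled by saturation. -/
def Saturating : Arith → Prop
  | fixed _ _ o _ => o = Overflow.saturate
  | float _ _ _ => True

/-- Overflow handling for integers in two's complement with `n + 1` bits: clamping to
`[-2 ^ n, 2 ^ n - 1]`, or reduction modulo `2 ^ (n + 1)` into this interval. -/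
def overflow (n : ℕ) : Overflow → ℤ → ℤ
  | Overflow.saturate, k => max (-2 ^ n) (min (2 ^ n - 1) k)
  | Overflow.wrap, k => Int.bmod k (2 ^ (n + 1))

/-- The representation of a real number in the arithmetic. In the floating-point case the binade
of `x` (at least the smallest normal one, `2 - 2 ^ e`) determines the spacing `2 ^ (q - m)` of the
representable numbers around `x`, and `(2 ^ (m + 1) - 1) * 2 ^ (2 ^ e - m)` is the largest
representable number. -/
noncomputable def repr : Arith → ℝ → ℚ
  | fixed i f o r, x => (overflow (i + f) o (r.toInt (x * 2 ^ f)) : ℚ) / 2 ^ f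
  | float e m r, x =>
    let q : ℤ := max (2 - 2 ^ e) (Int.log 2 |x|)
    let u : ℚ := 2 ^ (q - (m : ℤ))
    let big : ℚ := (2 ^ (m + 1) - 1) * 2 ^ ((2 : ℤ) ^ e - (m : ℤ))
    max (-big) (min big ((r.toInt (x / (u : ℝ)) : ℚ) * u))

/-- `q` is one of the numbers of the arithmetic. -/
def Representable (F : Arith) (q : ℚ) : Prop :=
  F.repr (q : ℝ) = q

/-- The operations of the arithmetic: the exact result, represented in the arithmetic
(a quotient with divisor `0` is `0`). -/
noncomputable def add (F : Arith) (a b : ℚ) : ℚ := F.repr ((a + b : ℚ) : ℝ)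

noncomputable def sub (F : Arith) (a b : ℚ) : ℚ := F.repr ((a - b : ℚ) : ℝ)

noncomputable def mul (F : Arith) (a b : ℚ) : ℚ := F.repr ((a * b : ℚ) : ℝ)

noncomputable def div (F : Arith) (a b : ℚ) : ℚ := F.repr ((a / b : ℚ) : ℝ)

noncomputable def exp (F : Arith) (a : ℚ) : ℚ := F.repr (Real.exp (a : ℝ))

/-- Sums are computed from left to right. -/
noncomputable def sum (F : Arith) (l : List ℚ) : ℚ := l.foldl F.add 0

/-- Scalar product. -/
noncomputable def dot (F : Arith) (x y : List ℚ) : ℚ := F.sum (List.zipWith F.mul x y)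

end Arith

/-! ## Functions computed in a fixed-width arithmetic

The embedding, scoring, combination and output functions of an encoder are given by straight-line
programs over the arithmetic. By case distinctions with `ite`, every function between finite
powers of the set of representable numbers is computed by such a program; feed-forward networks
with ReLU activations are the special case without `div` in which `ite` is used as `max (x, 0)`. -/

/-- An instruction; `i j k l` are register numbers. `ite i j k l` returns the content of register
`k` if the content of register `i` is at most that of register `j`, and else that of `l`. -/
inductive Gate
  | const (q : ℚ)
  | add (i j : ℕ)
  | sub (i j : ℕ)
  | mul (i j : ℕ)
  | div (i j : ℕ)
  | ite (i j k l : ℕ)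

/-- The value of an instruction when the registers contain `v`. -/
noncomputable def Gate.eval (F : Arith) (v : List ℚ) : Gate → ℚ
  | const q => q
  | add i j => F.add (v.getD i 0) (v.getD j 0)
  | sub i j => F.sub (v.getD i 0) (v.getD j 0)
  | mul i j => F.mul (v.getD i 0) (v.getD j 0)
  | div i j => F.div (v.getD i 0) (v.getD j 0)
  | ite i j k l => if v.getD i 0 ≤ v.getD j 0 then v.getD k 0 else v.getD l 0

/-- Constants are numbers of the arithmetic and only the first `n` registers are read. -/
def Gate.WellFormed (F : Arith) (n : ℕ) : Gate → Prop
  | const q => F.Representable q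
  | add i j => i < n ∧ j < n
  | sub i j => i < n ∧ j < n
  | mul i j => i < n ∧ j < n
  | div i j => i < n ∧ j < n
  | ite i j k l => i < n ∧ j < n ∧ k < n ∧ l < n

/-- A straight-line program: the registers initially contain the input vector, each instruction
appends a register, and the output vector is read off from the registers `outs`. -/
structure Prog where
  gates : List Gate
  outs : List ℕ

noncomputable def Prog.eval (F : Arith) (p : Prog) (x : List ℚ) : List ℚ :=
  let v := p.gates.foldl (fun v g => v ++ [g.eval F v]) x
  p.outs.map (fun i => v.getD i 0)

/-- `p` computes a function from `n`-dimensional to `k`-dimensional vectors over `F`. -/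
def Prog.WellFormed (F : Arith) (n k : ℕ) (p : Prog) : Prop :=
  (∀ (j : ℕ) (g : Gate), p.gates[j]? = some g → g.WellFormed F (n + j)) ∧
    p.outs.length = k ∧ ∀ i ∈ p.outs, i < n + p.gates.length

/-! ## Transformer encoders -/

/-- The normalisation functions. -/
inductive Norm
  | softmax
  | hardmax

/-- Unnormalised weights of the scores `s`. -/
noncomputable def Norm.numerators (F : Arith) (s : List ℚ) : Norm → List ℚ
  | softmax => s.map F.exp
  | hardmax => s.map (fun a => if ∀ b ∈ s, b ≤ a then F.repr 1 else 0)

/-- The list of all values `norm (j, s_1, …, s_n)`. -/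
noncomputable def Norm.eval (F : Arith) (ν : Norm) (s : List ℚ) : List ℚ :=
  let e := ν.numerators F s
  e.map (fun a => F.div a (F.sum e))

/-- An attention head: scoring function, normalisation, and the matrix (list of rows) of the
linear map used in pooling. -/
structure Head where
  score : Prog
  norm : Norm
  mat : List (List ℚ)

/-- `score (x, y)`. -/
noncomputable def Head.scoreOf (F : Arith) (h : Head) (x y : List ℚ) : ℚ :=
  (h.score.eval F (x ++ y)).headD 0

/-- The vector computed by the head from the vector `x` and the sequence `X`: the sum over all
positions `j` of `norm (j, scores) * (W X_j)`. -/
noncomputable def Head.pool (F : Arith) (h : Head) (x : List ℚ) (X : List (List ℚ)) : List ℚ :=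
  let a := h.norm.eval F (X.map (h.scoreOf F x))
  h.mat.map (fun row => F.sum (List.zipWith (fun c y => F.mul c (F.dot row y)) a X))

/-- The head accepts `d`-dimensional vectors, and its parameters are numbers of `F`. -/
def Head.WellFormed (F : Arith) (d : ℕ) (h : Head) : Prop :=
  h.score.WellFormed F (d + d) 1 ∧
    ∀ row ∈ h.mat, row.length = d ∧ ∀ q ∈ row, F.Representable q

/-- An encoder layer: attention heads and a combination function. -/
structure Layer where
  heads : List Head
  comb : Prog

noncomputable def Layer.eval (F : Arith) (l : Layer) (X : List (List ℚ)) : List (List ℚ) :=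
  X.map (fun x => l.comb.eval F (x ++ l.heads.flatMap (fun h => h.pool F x X)))

/-- The layer maps `d`-dimensional to `d'`-dimensional vectors. -/
def Layer.WellFormed (F : Arith) (d d' : ℕ) (l : Layer) : Prop :=
  (∀ h ∈ l.heads, h.WellFormed F d) ∧
    l.comb.WellFormed F (d + (l.heads.map (fun h => h.mat.length)).sum) d'

/-- A transformer encoder working over the fixed-width arithmetic `arith`. The alphabet has one
symbol for each entry of `emb`; the entry of symbol `a` is the program that computes
`emb (a, i)` from the position `i`. -/
structure TE where
  arith : Arith
  emb : List Prog
  layers : List Layer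
  out : Prog

namespace TE

/-- The alphabet. -/
abbrev Alphabet (T : TE) : Type := Fin T.emb.length

/-- The embedding of a symbol at position `i`. As all values are values of the arithmetic, so is
the position: `i` enters in its representation in the arithmetic. -/
noncomputable def embed (T : TE) (a : T.Alphabet) (i : ℕ) : List ℚ :=
  (T.emb.get a).eval T.arith [T.arith.repr (i : ℝ)]

/-- The embedding of a word; positions are counted from `1`. -/
noncomputable def embedWord (T : TE) (w : List T.Alphabet) : List (List ℚ) :=
  w.mapIdx (fun i a => T.embed a (i + 1))

/-- The value `T(w)`: the output function applied to the last vector after all layers. -/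
noncomputable def eval (T : TE) (w : List T.Alphabet) : ℚ :=
  let X := T.layers.foldl (fun X l => l.eval T.arith X) (T.embedWord w)
  (T.out.eval T.arith (X.getLastD [])).headD 0

/-- `T` accepts `w`. -/
def Accepts (T : TE) (w : List T.Alphabet) : Prop :=
  T.eval w = 1

/-- `T` accepts some non-empty word. -/
def Satisfiable (T : TE) : Prop :=
  ∃ w : List T.Alphabet, w ≠ [] ∧ T.Accepts w

/-- A sequence of layers followed by the output function fits together and accepts
`d`-dimensional vectors. -/
def LayersWellFormed (F : Arith) (out : Prog) : ℕ → List Layer → Prop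
  | d, [] => out.WellFormed F d 1
  | d, l :: ls => ∃ d', l.WellFormed F d d' ∧ LayersWellFormed F out d' ls

/-- All dimensions fit together and all parameters are numbers of the arithmetic. -/
def WellFormed (T : TE) : Prop :=
  ∃ d, (∀ p ∈ T.emb, p.WellFormed T.arith 1 d) ∧ LayersWellFormed T.arith T.out d T.layers

end TE

/-- The class of all encoders over fixed-width arithmetics, with arbitrary positional
embeddings. -/
def TFix : Set TE := {T | T.WellFormed}

/-- The encoders in `TFix` whose arithmetic handles overflow by saturation. -/
def TFixSat : Set TE := {T | T.WellFormed ∧ T.arith.Saturating}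

/-! ## Encoding of transformer encoders as bit strings

All encodings are self-delimiting. Parameters are written in binary, widths and register numbers
in unary. -/

def encUnary (n : ℕ) : List Bool := List.replicate n true ++ [false]

def encList {α : Type} (e : α → List Bool) : List α → List Bool
  | [] => [false]
  | a :: l => true :: (e a ++ encList e l)

def encNat (n : ℕ) : List Bool := encList (fun b => [b]) n.bits

def encRat (q : ℚ) : List Bool :=
  decide (q < 0) :: (encNat q.num.natAbs ++ encNat q.den)

def Rounding.encode : Rounding → List Bool
  | down => [false, false]
  | up => [false, true]
  | cut => [true, false]
  | nearest => [true, true]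

def Overflow.encode : Overflow → List Bool
  | saturate => [false]
  | wrap => [true]

def Arith.encode : Arith → List Bool
  | fixed i f o r => false :: (encUnary i ++ (encUnary f ++ (o.encode ++ r.encode)))
  | float e m r => true :: (encUnary e ++ (encUnary m ++ r.encode))

def Gate.encode : Gate → List Bool
  | const q => encUnary 0 ++ encRat q
  | add i j => encUnary 1 ++ (encUnary i ++ encUnary j)
  | sub i j => encUnary 2 ++ (encUnary i ++ encUnary j)
  | mul i j => encUnary 3 ++ (encUnary i ++ encUnary j)
  | div i j => encUnary 4 ++ (encUnary i ++ encUnary j)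
  | ite i j k l =>
    encUnary 5 ++ (encUnary i ++ (encUnary j ++ (encUnary k ++ encUnary l)))

def Prog.encode (p : Prog) : List Bool :=
  encList Gate.encode p.gates ++ encList encUnary p.outs

def Norm.encode : Norm → List Bool
  | softmax => [false]
  | hardmax => [true]

def Head.encode (h : Head) : List Bool :=
  h.score.encode ++ (h.norm.encode ++ encList (encList encRat) h.mat)

def Layer.encode (l : Layer) : List Bool :=
  encList Head.encode l.heads ++ l.comb.encode

def TE.encode (T : TE) : List Bool :=
  T.arith.encode ++ (encList Prog.encode T.emb ++ (encList Layer.encode T.layers ++ T.out.encode))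

/-- The satisfiability problem of a class of encoders: given (the code of) an encoder in the class,
does it accept some non-empty word? -/
def trSAT (C : Set TE) : Language Bool :=
  {s | ∃ T ∈ C, T.encode = s ∧ T.Satisfiable}

/-! ### The encoding is injective -/

/-- Codes can be read off from the front of a string. -/
def SelfDelimiting {α : Type} (e : α → List Bool) : Prop :=
  ∀ a b s t, e a ++ s = e b ++ t → a = b ∧ s = t

theorem sd_unary : SelfDelimiting encUnary := by
  intro a
  induction a with
  | zero =>
    intro b s t h
    cases b with
    | zero => simpa [encUnary] using h
    | succ b => simp [encUnary, List.replicate_succ] at h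
  | succ a ih =>
    intro b s t h
    cases b with
    | zero => simp [encUnary, List.replicate_succ] at h
    | succ b =>
      have h2 : encUnary a ++ s = encUnary b ++ t := by
        simpa [encUnary, List.replicate_succ] using h
      obtain ⟨h3, h4⟩ := ih b s t h2
      exact ⟨by omega, h4⟩

theorem sd_list {α : Type} {e : α → List Bool} (he : SelfDelimiting e) :
    SelfDelimiting (encList e) := by
  intro a
  induction a with
  | nil =>
    intro b s t h
    cases b with
    | nil => simpa [encList] using h
    | cons b l => simp [encList] at h
  | cons x a ih =>
    intro b s t h
    cases b with
    | nil => simp [encList] at h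
    | cons y l =>
      simp only [encList, List.cons_append, List.cons.injEq, true_and, List.append_assoc] at h
      obtain ⟨h1, h2⟩ := he _ _ _ _ h
      obtain ⟨h3, h4⟩ := ih _ _ _ h2
      exact ⟨by rw [h1, h3], h4⟩

theorem sd_bool : SelfDelimiting (fun b : Bool => [b]) := by
  intro a b s t h
  simpa using h

theorem sd_nat : SelfDelimiting encNat := by
  intro a b s t h
  obtain ⟨h1, h2⟩ := sd_list sd_bool _ _ _ _ h
  refine ⟨?_, h2⟩
  have hb : ∀ n : ℕ, n.bits.foldr Nat.bit 0 = n := by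
    intro n
    induction n using Nat.binaryRec' with
    | zero => simp
    | bit b n hn ih => rw [Nat.bits_append_bit _ _ hn]; simp [ih]
  rw [← hb a, ← hb b, h1]

theorem sd_rat : SelfDelimiting encRat := by
  intro a b s t h
  simp only [encRat, List.cons_append, List.cons.injEq, List.append_assoc] at h
  obtain ⟨h0, h⟩ := h
  obtain ⟨h1, k1⟩ := sd_nat _ _ _ _ h
  obtain ⟨h2, k2⟩ := sd_nat _ _ _ _ k1
  refine ⟨?_, k2⟩
  have h3 : a.num < 0 ↔ b.num < 0 := by
    simpa [Rat.num_neg] using h0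
  exact Rat.ext (by omega) h2

theorem sd_rounding : SelfDelimiting Rounding.encode := by
  intro a b s t h
  cases a <;> cases b <;> simp_all [Rounding.encode]

theorem sd_overflow : SelfDelimiting Overflow.encode := by
  intro a b s t h
  cases a <;> cases b <;> simp_all [Overflow.encode]

theorem sd_norm : SelfDelimiting Norm.encode := by
  intro a b s t h
  cases a <;> cases b <;> simp_all [Norm.encode]

theorem sd_arith : SelfDelimiting Arith.encode := by
  intro a b s t h
  cases a <;> cases b <;>
    simp only [Arith.encode, List.cons_append, List.cons.injEq, List.append_assoc, true_and,
      Bool.false_eq_true, Bool.true_eq_false, false_and] at h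
  · obtain ⟨rfl, k1⟩ := sd_unary _ _ _ _ h
    obtain ⟨rfl, k2⟩ := sd_unary _ _ _ _ k1
    obtain ⟨rfl, k3⟩ := sd_overflow _ _ _ _ k2
    obtain ⟨rfl, k4⟩ := sd_rounding _ _ _ _ k3
    exact ⟨rfl, k4⟩
  · obtain ⟨rfl, k5⟩ := sd_unary _ _ _ _ h
    obtain ⟨rfl, k6⟩ := sd_unary _ _ _ _ k5
    obtain ⟨rfl, k7⟩ := sd_rounding _ _ _ _ k6
    exact ⟨rfl, k7⟩

theorem sd_gate : SelfDelimiting Gate.encode := by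
  intro a b s t h
  cases a <;> cases b <;> simp only [Gate.encode, List.append_assoc] at h <;>
    obtain ⟨h0, h⟩ := sd_unary _ _ _ _ h <;>
    first
    | (exfalso; omega)
    | skip
  · obtain ⟨rfl, k1⟩ := sd_rat _ _ _ _ h
    exact ⟨rfl, k1⟩
  iterate 4
    · obtain ⟨rfl, k2⟩ := sd_unary _ _ _ _ h
      obtain ⟨rfl, k3⟩ := sd_unary _ _ _ _ k2
      exact ⟨rfl, k3⟩
  · obtain ⟨rfl, k4⟩ := sd_unary _ _ _ _ h
    obtain ⟨rfl, k5⟩ := sd_unary _ _ _ _ k4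
    obtain ⟨rfl, k6⟩ := sd_unary _ _ _ _ k5
    obtain ⟨rfl, k7⟩ := sd_unary _ _ _ _ k6
    exact ⟨rfl, k7⟩

theorem sd_prog : SelfDelimiting Prog.encode := by
  rintro ⟨a1, a2⟩ ⟨b1, b2⟩ s t h
  simp only [Prog.encode, List.append_assoc] at h
  obtain ⟨rfl, k1⟩ := sd_list sd_gate _ _ _ _ h
  obtain ⟨rfl, k2⟩ := sd_list sd_unary _ _ _ _ k1
  exact ⟨rfl, k2⟩

theorem sd_head : SelfDelimiting Head.encode := by
  rintro ⟨a1, a2, a3⟩ ⟨b1, b2, b3⟩ s t h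
  simp only [Head.encode, List.append_assoc] at h
  obtain ⟨rfl, k1⟩ := sd_prog _ _ _ _ h
  obtain ⟨rfl, k2⟩ := sd_norm _ _ _ _ k1
  obtain ⟨rfl, k3⟩ := sd_list (sd_list sd_rat) _ _ _ _ k2
  exact ⟨rfl, k3⟩

theorem sd_layer : SelfDelimiting Layer.encode := by
  rintro ⟨a1, a2⟩ ⟨b1, b2⟩ s t h
  simp only [Layer.encode, List.append_assoc] at h
  obtain ⟨rfl, k1⟩ := sd_list sd_head _ _ _ _ h
  obtain ⟨rfl, k2⟩ := sd_prog _ _ _ _ k1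
  exact ⟨rfl, k2⟩

theorem TE.encode_injective : Function.Injective TE.encode := by
  rintro ⟨a1, a2, a3, a4⟩ ⟨b1, b2, b3, b4⟩ h
  simp only [TE.encode] at h
  obtain ⟨rfl, k1⟩ := sd_arith _ _ _ _ h
  obtain ⟨rfl, k2⟩ := sd_list sd_prog _ _ _ _ k1
  obtain ⟨rfl, k3⟩ := sd_list sd_layer _ _ _ _ k2
  have h2 : Prog.encode a4 ++ [] = Prog.encode b4 ++ [] := by simpa using k3
  obtain ⟨rfl, -⟩ := sd_prog _ _ _ _ h2
  rfl

end Transformer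

/-!
The satisfiability problem of transformer encoders over fixed-width arithmetics is decidable and
`NEXPTIME`-hard.

**Decidability.** All numbers of an arithmetic are integer multiples of a unit, so that an encoder
is evaluated with integers (`eval_toTE`). The only operation that is not obviously computable is
the exponential function: `exp q` is approximated from both sides by `(1 + q / n) ^ n` and
`(1 - q / n) ^ (-n)`, and since `exp q` is irrational for rational `q ≠ 0` (`irrational_exp`), it
is not a point of discontinuity of the rounding, and a sufficient precision `n` can be found by
search (`expOK_eventually`). Moreover, satisfiable encoders accept a short word
(`exists_short`): the representations of the positions are ultimately constant, or periodic if
overflow wraps around, and sums are computed from left to right. So a prefix of a word influences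
the rest of the computation only through its length (if it is short, and otherwise modulo the
period), the set of vectors that occur in each layer, and the partial sums of each head for each
vector. If two prefixes of a long word agree in these data, then the part between them can be cut
out. The number of possible data is a computable bound on the length of a shortest accepted word,
and a search through the words up to this length decides the problem. The search is primitive
recursive for a fixed precision; `fun_prop` derives this from the shape of the definitions.

**Hardness.** For a nondeterministic machine with running time `2 ^ p(n)`, an encoder checks that a
word is the sequence of records of an accepting computation (`satisfiable_traceTE`). It works
with the integers of `W + 1` bits, with saturation and rounding up. Then hardmax has weights `0` and
`1`, as `1 / m` is rounded up to `1`, and a head computes the sum over the set of positions of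
maximal score. This gives the head position of the machine as a sum over the preceding positions,
access to the preceding record and to the last record in which the current cell was visited, and
finally the number of inconsistent records. The input of the machine is
represented by one layer for each of its bits. As `W` is a multiple of a power of `n + 1` that
exceeds `p(n)`, the code of the encoder consists of fixed strings, a fixed string for each bit of the
input, and the unary code of `W`; an explicit machine computes such maps in polynomial time
(`polyTime_pad`).
-/

/-! ### Primitive recursion by `fun_prop` -/

/-! The lemmas of this part are stated for functions in composed form, `fun a => op (f a) (g a)`,
which is the form that `fun_prop` needs; functions that are passed to list operations are lambdas. -/
attribute [fun_prop] Primrec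
attribute [fun_prop] Primrec.const Primrec.comp

namespace PR

theorem zipWith_eq_map_range {β γ σ : Type*} (g : β → γ → σ) (b : β) (c : γ) (l : List β)
    (m : List γ) :
    List.zipWith g l m =
      (List.range (min l.length m.length)).map (fun i => g (l.getD i b) (m.getD i c)) := by
  apply List.ext_getElem
  · simp
  · intro i h1 h2
    simp only [List.length_zipWith, lt_min_iff] at h1
    simp [List.getD_eq_getElem?_getD, h1.1, h1.2]

section
variable {α β γ σ : Type*} [Primcodable α] [Primcodable β] [Primcodable γ] [Primcodable σ]

@[fun_prop] theorem id' : Primrec (fun a : α => a) := Primrec.id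

@[fun_prop] theorem nadd {f g : α → ℕ} (hf : Primrec f) (hg : Primrec g) :
    Primrec fun a => f a + g a := Primrec.nat_add.comp hf hg

@[fun_prop] theorem nsub {f g : α → ℕ} (hf : Primrec f) (hg : Primrec g) :
    Primrec fun a => f a - g a := Primrec.nat_sub.comp hf hg

@[fun_prop] theorem nmul {f g : α → ℕ} (hf : Primrec f) (hg : Primrec g) :
    Primrec fun a => f a * g a := Primrec.nat_mul.comp hf hg

@[fun_prop] theorem ndiv {f g : α → ℕ} (hf : Primrec f) (hg : Primrec g) :
    Primrec fun a => f a / g a := Primrec.nat_div.comp hf hg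

@[fun_prop] theorem nmod {f g : α → ℕ} (hf : Primrec f) (hg : Primrec g) :
    Primrec fun a => f a % g a := Primrec.nat_mod.comp hf hg

@[fun_prop] theorem npow {f g : α → ℕ} (hf : Primrec f) (hg : Primrec g) :
    Primrec fun a => f a ^ g a :=
  (Primrec₂.unpaired'.1 Nat.Primrec.pow).comp hf hg

@[fun_prop] theorem nmin {f g : α → ℕ} (hf : Primrec f) (hg : Primrec g) :
    Primrec fun a => min (f a) (g a) := Primrec.nat_min.comp hf hg

@[fun_prop] theorem nle {f g : α → ℕ} (hf : Primrec f) (hg : Primrec g) :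
    Primrec fun a => decide (f a ≤ g a) := (Primrec.nat_le.comp hf hg).decide

@[fun_prop] theorem nlt {f g : α → ℕ} (hf : Primrec f) (hg : Primrec g) :
    Primrec fun a => decide (f a < g a) := (Primrec.nat_lt.comp hf hg).decide

@[fun_prop] theorem deq [DecidableEq β] {f g : α → β} (hf : Primrec f) (hg : Primrec g) :
    Primrec fun a => decide (f a = g a) := (Primrec.eq.comp hf hg).decide

@[fun_prop] theorem band {f g : α → Bool} (hf : Primrec f) (hg : Primrec g) :
    Primrec fun a => (f a && g a) := Primrec.and.comp hf hg

@[fun_prop] theorem bor {f g : α → Bool} (hf : Primrec f) (hg : Primrec g) :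
    Primrec fun a => (f a || g a) := Primrec.or.comp hf hg

@[fun_prop] theorem bnot {f : α → Bool} (hf : Primrec f) :
    Primrec fun a => (!f a) := Primrec.not.comp hf

@[fun_prop] theorem bcond {c : α → Bool} {f g : α → β} (hc : Primrec c) (hf : Primrec f)
    (hg : Primrec g) : Primrec fun a => bif c a then f a else g a := Primrec.cond hc hf hg

@[fun_prop] theorem mk {f : α → β} {g : α → γ} (hf : Primrec f) (hg : Primrec g) :
    Primrec fun a => (f a, g a) := Primrec.pair hf hg

@[fun_prop] theorem fst {f : α → β × γ} (hf : Primrec f) : Primrec fun a => (f a).1 :=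
  Primrec.fst.comp hf

@[fun_prop] theorem snd {f : α → β × γ} (hf : Primrec f) : Primrec fun a => (f a).2 :=
  Primrec.snd.comp hf

@[fun_prop] theorem lcons {f : α → β} {g : α → List β} (hf : Primrec f) (hg : Primrec g) :
    Primrec fun a => f a :: g a := Primrec.list_cons.comp hf hg

@[fun_prop] theorem lappend {f g : α → List β} (hf : Primrec f) (hg : Primrec g) :
    Primrec fun a => f a ++ g a := Primrec.list_append.comp hf hg

@[fun_prop] theorem llength {f : α → List β} (hf : Primrec f) :
    Primrec fun a => (f a).length := Primrec.list_length.comp hf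

@[fun_prop] theorem lmap {f : α → List β} {g : α → β → γ} (hf : Primrec f)
    (hg : Primrec fun p : α × β => g p.1 p.2) : Primrec fun a => (f a).map (g a) :=
  Primrec.list_map hf hg

@[fun_prop] theorem lflatMap {f : α → List β} {g : α → β → List γ} (hf : Primrec f)
    (hg : Primrec fun p : α × β => g p.1 p.2) : Primrec fun a => (f a).flatMap (g a) :=
  Primrec.list_flatMap hf hg

@[fun_prop] theorem lfoldl {f : α → List β} {z : α → σ} {g : α → σ → β → σ} (hf : Primrec f)
    (hz : Primrec z) (hg : Primrec fun p : α × (σ × β) => g p.1 p.2.1 p.2.2) :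
    Primrec fun a => (f a).foldl (g a) (z a) :=
  Primrec.list_foldl (h := fun a p => g a p.1 p.2) hf hz hg

@[fun_prop] theorem lrange {f : α → ℕ} (hf : Primrec f) : Primrec fun a => List.range (f a) :=
  Primrec.list_range.comp hf

@[fun_prop] theorem lall {f : α → List β} {g : α → β → Bool} (hf : Primrec f)
    (hg : Primrec fun p : α × β => g p.1 p.2) : Primrec fun a => (f a).all (g a) := by
  have h : (fun a => (f a).all (g a)) =
      fun a => (f a).foldl (fun s b => s && g a b) true := by
    funext a
    have : ∀ (l : List β) (s : Bool), l.foldl (fun s b => s && g a b) s = (s && l.all (g a)) := by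
      intro l
      induction l with
      | nil => simp
      | cons x l ih => intro s; simp [ih, Bool.and_assoc]
    simp [this]
  rw [h]
  fun_prop

@[fun_prop] theorem lany {f : α → List β} {g : α → β → Bool} (hf : Primrec f)
    (hg : Primrec fun p : α × β => g p.1 p.2) : Primrec fun a => (f a).any (g a) := by
  have h : (fun a => (f a).any (g a)) = fun a => !(f a).all (fun b => !g a b) := by
    funext a
    simp [List.not_all_eq_any_not]
  rw [h]
  fun_prop

@[fun_prop] theorem lgetElem? {f : α → List β} {g : α → ℕ} (hf : Primrec f) (hg : Primrec g) :
    Primrec fun a => (f a)[g a]? := Primrec.list_getElem?.comp hf hg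

@[fun_prop] theorem ogetD {f : α → Option β} {g : α → β} (hf : Primrec f) (hg : Primrec g) :
    Primrec fun a => (f a).getD (g a) := Primrec.option_getD.comp hf hg

@[fun_prop] theorem osome {f : α → β} (hf : Primrec f) :
    Primrec fun a => some (f a) := Primrec.option_some.comp hf

@[fun_prop] theorem lgetD {f : α → List β} {g : α → ℕ} {d : α → β} (hf : Primrec f)
    (hg : Primrec g) (hd : Primrec d) : Primrec fun a => (f a).getD (g a) (d a) := by
  simp only [List.getD_eq_getElem?_getD]
  fun_prop

@[fun_prop] theorem lheadD {f : α → List β} {d : α → β} (hf : Primrec f)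
    (hd : Primrec d) : Primrec fun a => (f a).headD (d a) := by
  simp only [List.headD_eq_head?_getD]
  exact ogetD (Primrec.list_head?.comp hf) hd

@[fun_prop] theorem lgetLastD {f : α → List β} {d : α → β} (hf : Primrec f)
    (hd : Primrec d) : Primrec fun a => (f a).getLastD (d a) := by
  have : ∀ a, (f a).getLastD (d a) = (f a).reverse.headD (d a) := by
    intro a
    simp [List.getLastD_eq_getLast?]
  simp only [this]
  exact lheadD (Primrec.list_reverse.comp hf) hd

@[fun_prop] theorem lreplicate {f : α → ℕ} {d : α → β} (hf : Primrec f)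
    (hd : Primrec d) : Primrec fun a => List.replicate (f a) (d a) := by
  have : ∀ a, List.replicate (f a) (d a) = (List.range (f a)).map (fun _ => d a) := by
    intro a
    simp
  simp only [this]
  fun_prop

@[fun_prop] theorem lzipWith [Inhabited β] [Inhabited γ] {f : α → List β} {h : α → List γ}
    {g : α → β → γ → σ} (hf : Primrec f)
    (hh : Primrec h) (hg : Primrec fun p : α × (β × γ) => g p.1 p.2.1 p.2.2) :
    Primrec fun a => List.zipWith (g a) (f a) (h a) := by
  simp only [zipWith_eq_map_range _ default default]
  have : Primrec fun p : α × ℕ =>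
      g p.1 ((f p.1).getD p.2 default) ((h p.1).getD p.2 default) :=
    hg.comp (g := fun p : α × ℕ => (p.1, ((f p.1).getD p.2 default), ((h p.1).getD p.2 default)))
      (by fun_prop)
  fun_prop

@[fun_prop] theorem nlog2 {f : α → ℕ} (hf : Primrec f) : Primrec fun a => Nat.log 2 (f a) := by
  have h : ∀ n, Nat.log 2 n = (List.range n).foldl (fun s i => bif decide (2 ^ (i + 1) ≤ n) then i + 1 else s) 0 := by
    intro n
    have : ∀ k, (List.range k).foldl (fun s i => bif decide (2 ^ (i + 1) ≤ n) then i + 1 else s) 0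
        = min k (Nat.log 2 n) := by
      intro k
      induction k with
      | zero => simp
      | succ k ih =>
        rw [List.range_succ, List.foldl_append, ih]
        simp only [List.foldl_cons, List.foldl_nil]
        rcases Nat.eq_zero_or_pos n with rfl | hn
        · simp
        · by_cases hk : 2 ^ (k + 1) ≤ n
          · have := (Nat.le_log_iff_pow_le (b := 2) (by norm_num) hn.ne').2 hk
            simp [hk]; omega
          · have h2 : ¬ k + 1 ≤ Nat.log 2 n := fun h =>
              hk ((Nat.le_log_iff_pow_le (b := 2) (by norm_num) hn.ne').1 h)
            simp [hk]; omega
    rw [this, min_eq_right (Nat.log_le_self 2 n)]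
  have h2 : Primrec (Nat.log 2) := by
    have : Nat.log 2 = fun n => (List.range n).foldl (fun s i => bif decide (2 ^ (i + 1) ≤ n) then i + 1 else s) 0 :=
      funext h
    rw [this]
    fun_prop
  exact h2.comp hf

/-! Integers are handled through their positive and negative parts. -/

theorem encode_int_ofNat (n : ℕ) : Encodable.encode (n : ℤ) = 2 * n := rfl

theorem encode_int_negSucc (n : ℕ) : Encodable.encode (Int.negSucc n) = 2 * n + 1 := rfl

@[fun_prop] theorem icast {f : α → ℕ} (hf : Primrec f) : Primrec fun a => (f a : ℤ) := by
  rw [← Primrec.encode_iff]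
  simp only [encode_int_ofNat]
  fun_prop

theorem inegSucc {f : α → ℕ} (hf : Primrec f) : Primrec fun a => Int.negSucc (f a) := by
  rw [← Primrec.encode_iff]
  simp only [encode_int_negSucc]
  fun_prop

@[fun_prop] theorem itoNat {f : α → ℤ} (hf : Primrec f) : Primrec fun a => (f a).toNat := by
  have : ∀ z : ℤ, z.toNat = bif decide (Encodable.encode z % 2 = 0) then Encodable.encode z / 2 else 0 := by
    rintro (n | n)
    · rw [Int.ofNat_eq_natCast, encode_int_ofNat]; simp
    · rw [encode_int_negSucc]; simp [Nat.add_mod]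
  simp only [this]
  have := Primrec.encode.comp hf
  fun_prop

theorem inegPart {f : α → ℤ} (hf : Primrec f) : Primrec fun a => (-f a).toNat := by
  have : ∀ z : ℤ, (-z).toNat = bif decide (Encodable.encode z % 2 = 0) then 0 else Encodable.encode z / 2 + 1 := by
    rintro (n | n)
    · rw [Int.ofNat_eq_natCast, encode_int_ofNat]; simp
    · rw [encode_int_negSucc]; simp [Nat.add_mod]; omega
  simp only [this]
  have := Primrec.encode.comp hf
  fun_prop

theorem inatSub {f g : α → ℕ} (hf : Primrec f) (hg : Primrec g) :
    Primrec fun a => (f a : ℤ) - (g a : ℤ) := by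
  have : ∀ m n : ℕ, (m : ℤ) - (n : ℤ) = bif decide (n ≤ m) then ((m - n : ℕ) : ℤ)
      else Int.negSucc (n - m - 1) := by
    intro m n
    by_cases h : n ≤ m
    · simp [h]
    · simp only [h, decide_false, cond_false, Int.negSucc_eq]; omega
  simp only [this]
  have := inegSucc (f := fun a => g a - f a - 1) (by fun_prop)
  fun_prop

@[fun_prop] theorem isub {f g : α → ℤ} (hf : Primrec f) (hg : Primrec g) :
    Primrec fun a => f a - g a := by
  have h1 := inegPart hf
  have h2 := inegPart hg
  refine (inatSub (f := fun a => (f a).toNat + (-g a).toNat)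
    (g := fun a => (-f a).toNat + (g a).toNat) (by fun_prop) (by fun_prop)).of_eq ?_
  intro a
  omega

@[fun_prop] theorem ineg {f : α → ℤ} (hf : Primrec f) : Primrec fun a => - f a := by
  simpa using isub (Primrec.const 0) hf

@[fun_prop] theorem iadd {f g : α → ℤ} (hf : Primrec f) (hg : Primrec g) :
    Primrec fun a => f a + g a := by
  simpa using isub hf (ineg hg)

@[fun_prop] theorem imul {f g : α → ℤ} (hf : Primrec f) (hg : Primrec g) :
    Primrec fun a => f a * g a := by
  have : ∀ x y : ℤ, x * y = ((x.toNat * y.toNat + (-x).toNat * (-y).toNat : ℕ) : ℤ) -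
      ((x.toNat * (-y).toNat + (-x).toNat * y.toNat : ℕ) : ℤ) := by
    intro x y
    have hx : x = (x.toNat : ℤ) - ((-x).toNat : ℤ) := by omega
    have hy : y = (y.toNat : ℤ) - ((-y).toNat : ℤ) := by omega
    conv_lhs => rw [hx, hy]
    push_cast
    ring
  simp only [this]
  have h1 := inegPart hf
  have h2 := inegPart hg
  exact inatSub (by fun_prop) (by fun_prop)

@[fun_prop] theorem ile {f g : α → ℤ} (hf : Primrec f) (hg : Primrec g) :
    Primrec fun a => decide (f a ≤ g a) := by
  have : ∀ x y : ℤ, decide (x ≤ y) = decide ((x - y).toNat = 0) := by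
    intro x y
    congr 1
    apply propext
    omega
  simp only [this]
  fun_prop

@[fun_prop] theorem imin {f g : α → ℤ} (hf : Primrec f) (hg : Primrec g) :
    Primrec fun a => min (f a) (g a) := by
  have : ∀ x y : ℤ, min x y = bif decide (x ≤ y) then x else y := by
    intro x y
    by_cases h : x ≤ y <;> simp [h]; omega
  simp only [this]
  fun_prop

@[fun_prop] theorem imax {f g : α → ℤ} (hf : Primrec f) (hg : Primrec g) :
    Primrec fun a => max (f a) (g a) := by
  have : ∀ x y : ℤ, max x y = bif decide (x ≤ y) then y else x := by
    intro x y
    by_cases h : x ≤ y <;> simp [h]; omega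
  simp only [this]
  fun_prop

@[fun_prop] theorem inatAbs {f : α → ℤ} (hf : Primrec f) : Primrec fun a => (f a).natAbs := by
  have : ∀ x : ℤ, x.natAbs = x.toNat + (-x).toNat := by intro x; omega
  simp only [this]
  have h1 := inegPart hf
  fun_prop

@[fun_prop] theorem idiv {f : α → ℤ} {g : α → ℕ} (hf : Primrec f) (hg : Primrec g) :
    Primrec fun a => f a / (g a : ℤ) := by
  have : ∀ (x : ℤ) (d : ℕ), x / (d : ℤ) = bif decide (0 ≤ x) then ((x.toNat / d : ℕ) : ℤ)
      else bif decide (d = 0) then 0 else - ((((-x).toNat - 1) / d + 1 : ℕ) : ℤ) := by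
    intro x d
    rcases x with n | n
    · simp
    · rcases d with _ | d
      · simp
      · have : ¬ (0 ≤ Int.negSucc n) := by simp
        simp only [this, decide_false, cond_false]
        rw [show (-Int.negSucc n).toNat - 1 = n by simp]
        rw [Int.negSucc_ediv _ (show (0 : ℤ) < ((d + 1 : ℕ) : ℤ) by omega)]
        simp only [Nat.add_eq_zero_iff, one_ne_zero, and_false, decide_false, cond_false]
        push_cast
        rfl
  simp only [this]
  have h1 := inegPart hf
  fun_prop

@[fun_prop] theorem ipow {f : α → ℤ} {g : α → ℕ} (hf : Primrec f) (hg : Primrec g) :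
    Primrec fun a => f a ^ g a := by
  have : ∀ (x : ℤ) (n : ℕ), x ^ n = (List.range n).foldl (fun s _ => s * x) 1 := by
    intro x n
    induction n with
    | zero => simp
    | succ n ih => rw [List.range_succ, List.foldl_append, ← ih, pow_succ]; simp
  simp only [this]
  fun_prop

end

end PR

open Transformer

namespace TransformerSat

/-! ### Rounding with integers -/

theorem floor_div_eq (x : ℤ) (d : ℕ) : ⌊(x : ℝ) / (d : ℝ)⌋ = x / (d : ℤ) := by
  rw [Int.floor_div_natCast, Int.floor_intCast]

theorem ceil_div_eq (x : ℤ) (d : ℕ) : ⌈(x : ℝ) / (d : ℝ)⌉ = -((-x) / (d : ℤ)) := by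
  rw [← neg_neg ⌈(x : ℝ) / (d : ℝ)⌉, ← Int.floor_neg, ← neg_div]
  have := floor_div_eq (-x) d
  push_cast at this
  rw [this]

/-- A rounding mode as a pair of bits, as in `Rounding.encode`. -/
def toRounding (r : Bool × Bool) : Rounding :=
  bif r.1 then (bif r.2 then .nearest else .cut) else (bif r.2 then .up else .down)

/-- The rounding of the fraction `x / d`. -/
def roundZ (r : Bool × Bool) (x : ℤ) (d : ℕ) : ℤ :=
  bif r.1 then
    (bif r.2 then (2 * x + d) / ((2 * d : ℕ) : ℤ)
     else bif decide (0 ≤ x) then x / (d : ℤ) else -((-x) / (d : ℤ)))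
  else (bif r.2 then -((-x) / (d : ℤ)) else x / (d : ℤ))

theorem toInt_div (r : Bool × Bool) (x : ℤ) {d : ℕ} (hd : 0 < d) :
    (toRounding r).toInt ((x : ℝ) / (d : ℝ)) = roundZ r x d := by
  have hd' : (0 : ℝ) < d := by exact_mod_cast hd
  obtain ⟨_ | _, _ | _⟩ := r
  · simp [toRounding, roundZ, Rounding.toInt, floor_div_eq]
  · simp [toRounding, roundZ, Rounding.toInt, ceil_div_eq]
  · have : (0 : ℝ) ≤ (x : ℝ) / d ↔ 0 ≤ x := by
      rw [le_div_iff₀ hd']; simp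
    by_cases h : 0 ≤ x <;>
      simp [toRounding, roundZ, Rounding.toInt, floor_div_eq, ceil_div_eq, this, h]
  · simp only [toRounding, roundZ, Rounding.toInt, cond_true]
    rw [round_eq, ← floor_div_eq]
    congr 1
    push_cast
    field_simp

theorem toInt_mono (r : Rounding) : Monotone r.toInt := by
  intro x y h
  cases r
  · exact Int.floor_mono h
  · exact Int.ceil_mono h
  · simp only [Rounding.toInt]
    split_ifs with h1 h2 h2
    · exact Int.floor_mono h
    · exact absurd (h1.trans h) h2
    · have h3 : ⌈x⌉ ≤ 0 := Int.ceil_le.2 (by push_cast; linarith)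
      exact h3.trans (Int.floor_nonneg.2 h2)
    · exact Int.ceil_mono h
  · simp only [Rounding.toInt, round_eq]
    exact Int.floor_mono (by linarith)

/-- Codes of arithmetics: kind (`true` for floating point), two widths, overflow (`true` for
wrap-around) and rounding. -/
abbrev ArithC := Bool × ℕ × ℕ × Bool × Bool × Bool

/-- The arithmetic with a given code. -/
def toArith (c : ArithC) : Arith :=
  bif c.1 then .float c.2.1 c.2.2.1 (toRounding c.2.2.2.2)
  else .fixed c.2.1 c.2.2.1 (bif c.2.2.2.1 then .wrap else .saturate) (toRounding c.2.2.2.2)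

/-- All numbers of the arithmetic are integer multiples of `unitNum c / unitDen c`. -/
def unitNum (c : ArithC) : ℕ := bif c.1 then 4 else 1

/-- The denominator of the unit, which is the spacing of the fixed-point numbers, or of the
subnormal floating-point numbers. -/
def unitDen (c : ArithC) : ℕ := bif c.1 then 2 ^ (2 ^ c.2.1 + c.2.2.1) else 2 ^ c.2.2.1

theorem unitNum_pos (c : ArithC) : 0 < unitNum c := by
  unfold unitNum; cases c.1 <;> simp

theorem unitDen_pos (c : ArithC) : 0 < unitDen c := by
  unfold unitDen; cases c.1 <;> simp

/-- The number represented by the integer `k`: that multiple of the unit. -/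
def val (c : ArithC) (k : ℤ) : ℚ := (k * unitNum c : ℚ) / unitDen c

/-- The binade of a real number, counted from the smallest normal one; `0` for fixed point. -/
noncomputable def binadeR (c : ArithC) (x : ℝ) : ℕ :=
  bif c.1 then Nat.log 2 ⌊|x| * 2 ^ (2 ^ c.2.1) / 4⌋₊ else 0

/-- The binade of `x / d`. -/
def binadeZ (c : ArithC) (x : ℤ) (d : ℕ) : ℕ :=
  bif c.1 then Nat.log 2 (x.natAbs * 2 ^ (2 ^ c.2.1) / (4 * d)) else 0

/-- The rounded multiple of the spacing in the binade of `x`. -/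
noncomputable def sigR (c : ArithC) (x : ℝ) : ℤ :=
  (toRounding c.2.2.2.2).toInt (x * (unitDen c / (unitNum c * 2 ^ binadeR c x)))

def sigZ (c : ArithC) (x : ℤ) (d : ℕ) : ℤ :=
  roundZ c.2.2.2.2 (x * unitDen c) (d * (unitNum c * 2 ^ binadeZ c x d))

/-- The largest absolute value of a number of the arithmetic, in multiples of the unit. -/
def maxZ (c : ArithC) : ℕ :=
  bif c.1 then (2 ^ (c.2.2.1 + 1) - 1) * 2 ^ (2 ^ (c.2.1 + 1) - 2) else 2 ^ (c.2.1 + c.2.2.1)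

theorem maxZ_pos (c : ArithC) : 0 < maxZ c := by
  unfold maxZ
  cases c.1
  · simp
  · have : 1 < 2 ^ (c.2.2.1 + 1) := Nat.one_lt_two_pow (by omega)
    simp

/-- Balanced remainder modulo `2 * M`. -/
def wrapZ (M : ℕ) (k : ℤ) : ℤ :=
  (k - k / ((2 * M : ℕ) : ℤ) * ((2 * M : ℕ) : ℤ)) -
    bif decide ((M : ℤ) ≤ k - k / ((2 * M : ℕ) : ℤ) * ((2 * M : ℕ) : ℤ)) then
      ((2 * M : ℕ) : ℤ) else 0

theorem wrapZ_eq (M : ℕ) (k : ℤ) : wrapZ M k = Int.bmod k (2 * M) := by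
  have h3 : k - k / ((2 * M : ℕ) : ℤ) * ((2 * M : ℕ) : ℤ) = k % ((2 * M : ℕ) : ℤ) := by
    rw [Int.emod_def]; ring
  have h4 : (((2 * M : ℕ) : ℤ) + 1) / 2 = (M : ℤ) := by omega
  unfold wrapZ Int.bmod
  simp only [h3, h4]
  by_cases h : (M : ℤ) ≤ k % ((2 * M : ℕ) : ℤ)
  · simp only [h, decide_true, cond_true, not_lt.2 h, if_false]
  · simp only [h, decide_false, cond_false, not_le.1 h, if_true, sub_zero]

/-- Overflow handling, given the binade and the rounded multiple of its spacing. -/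
def finish (c : ArithC) (q : ℕ) (k : ℤ) : ℤ :=
  bif c.1 then max (-(maxZ c : ℤ)) (min (maxZ c : ℤ) (k * ((2 ^ q : ℕ) : ℤ)))
  else bif c.2.2.2.1 then wrapZ (maxZ c) k
  else max (-(maxZ c : ℤ)) (min ((maxZ c : ℤ) - 1) k)

/-- The representation of a real number as a multiple of the unit. -/
noncomputable def reprR (c : ArithC) (x : ℝ) : ℤ := finish c (binadeR c x) (sigR c x)

/-- The representation of `x / d` as a multiple of the unit. -/
def reprZ (c : ArithC) (x : ℤ) (d : ℕ) : ℤ := finish c (binadeZ c x d) (sigZ c x d)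

theorem binadeR_div (c : ArithC) (x : ℤ) {d : ℕ} (hd : 0 < d) :
    binadeR c ((x : ℝ) / d) = binadeZ c x d := by
  unfold binadeR binadeZ
  cases c.1
  · rfl
  · simp only [cond_true]
    congr 1
    rw [← Nat.floor_div_eq_div (K := ℝ)]
    congr 1
    push_cast
    rw [abs_div, Nat.abs_cast, Nat.cast_natAbs]
    push_cast
    field_simp

theorem reprR_div (c : ArithC) (x : ℤ) {d : ℕ} (hd : 0 < d) :
    reprR c ((x : ℝ) / d) = reprZ c x d := by
  unfold reprR reprZ sigR sigZ
  rw [binadeR_div c x hd, ← toInt_div]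
  · congr 2
    push_cast
    have := unitNum_pos c
    field_simp
  · have := unitNum_pos c
    positivity

theorem finish_zero (c : ArithC) (q : ℕ) : finish c q 0 = 0 := by
  have := maxZ_pos c
  unfold finish
  cases c.1
  · cases c.2.2.2.1
    · simp only [cond_false]; omega
    · simp only [cond_false, cond_true, wrapZ_eq, Int.zero_bmod]
  · simp only [cond_true, zero_mul]; omega

theorem max_log_eq (e : ℕ) {x : ℝ} (hx : 0 < x) :
    max (2 - 2 ^ e) (Int.log 2 x) = (Nat.log 2 ⌊x * 2 ^ (2 ^ e) / 4⌋₊ : ℤ) + 2 - 2 ^ e := by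
  have hy : x * 2 ^ (2 ^ e) / 4 = x * (2 : ℝ) ^ ((2 : ℤ) ^ e - 2) := by
    rw [zpow_sub₀ (by norm_num)]
    have : ((2 : ℝ) ^ ((2 : ℤ) ^ e)) = 2 ^ (2 ^ e) := by
      rw [← zpow_natCast]; push_cast; rfl
    rw [this]
    norm_num
    ring
  have hlog : Int.log 2 (x * (2 : ℝ) ^ ((2 : ℤ) ^ e - 2)) = Int.log 2 x + (2 ^ e - 2) := by
    have hpos : 0 < x * (2 : ℝ) ^ ((2 : ℤ) ^ e - 2) := by positivity
    have key : ∀ z : ℤ, z ≤ Int.log 2 (x * (2 : ℝ) ^ ((2 : ℤ) ^ e - 2)) ↔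
        z ≤ Int.log 2 x + (2 ^ e - 2) := by
      intro z
      rw [← Int.zpow_le_iff_le_log (by norm_num) hpos, ← sub_le_iff_le_add,
        ← Int.zpow_le_iff_le_log (by norm_num) hx, zpow_sub₀ (by norm_num) z,
        div_le_iff₀ (by positivity)]
      simp
    exact le_antisymm ((key _).1 le_rfl) ((key _).2 le_rfl)
  rw [hy]
  set y := x * (2 : ℝ) ^ ((2 : ℤ) ^ e - 2) with hydef
  have hypos : 0 < y := by positivity
  rcases le_or_gt 1 y with h | h
  · have h1 := Int.log_of_one_le_right 2 h
    rw [h1] at hlog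
    omega
  · have h1 : ⌊y⌋₊ = 0 := Nat.floor_eq_zero.2 h
    have h2 : Int.log 2 y < 0 := by
      rw [← Int.lt_zpow_iff_log_lt (by norm_num) hypos]; simpa using h
    rw [h1, Nat.log_zero_right]
    push_cast
    omega

theorem repr_eq (c : ArithC) (x : ℝ) : (toArith c).repr x = val c (reprR c x) := by
  obtain ⟨b, e, m, o, r⟩ := c
  cases b
  · have hs : x * ((unitDen (false, e, m, o, r) : ℝ) /
        (unitNum (false, e, m, o, r) * 2 ^ binadeR (false, e, m, o, r) x)) = x * 2 ^ m := by
      simp [unitDen, unitNum, binadeR]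
    unfold reprR sigR
    rw [hs]
    simp only [toArith, Arith.repr, val, finish, unitNum, unitDen, maxZ, cond_false]
    set k := (toRounding r).toInt (x * 2 ^ m)
    cases o
    · simp [Arith.overflow]
    · simp [Arith.overflow, wrapZ_eq, pow_succ, mul_comm]
  · rcases eq_or_ne x 0 with rfl | hx
    · have h0 : ∀ r : Rounding, r.toInt 0 = 0 := by intro r; cases r <;> simp [Rounding.toInt]
      have : reprR (true, e, m, o, r) 0 = 0 := by
        unfold reprR sigR
        rw [zero_mul, h0, finish_zero]
      rw [this]
      simp only [toArith, Arith.repr, cond_true, zero_div, h0, val]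
      have : (0 : ℚ) ≤ (2 ^ (m + 1) - 1) * 2 ^ ((2 : ℤ) ^ e - (m : ℤ)) := by
        have : (1 : ℚ) ≤ 2 ^ (m + 1) := one_le_pow₀ (by norm_num)
        have : (0 : ℚ) ≤ 2 ^ (m + 1) - 1 := by linarith
        positivity
      simp [this]
    · have hx' : 0 < |x| := abs_pos.2 hx
      have hq := max_log_eq e hx'
      set B := Nat.log 2 ⌊|x| * 2 ^ (2 ^ e) / 4⌋₊ with hB
      have hbin : binadeR (true, e, m, o, r) x = B := by simp [binadeR, hB]
      have he : (2 : ℝ) ^ ((2 : ℤ) ^ e) = 2 ^ (2 ^ e) := by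
        rw [← zpow_natCast]; push_cast; rfl
      have heQ : (2 : ℚ) ^ ((2 : ℤ) ^ e) = 2 ^ (2 ^ e) := by
        rw [← zpow_natCast]; push_cast; rfl
      have hu : (2 : ℚ) ^ ((B : ℤ) + 2 - 2 ^ e - (m : ℤ)) = 2 ^ B * 4 / 2 ^ (2 ^ e + m) := by
        rw [zpow_sub₀ (by norm_num), zpow_sub₀ (by norm_num), zpow_add₀ (by norm_num), heQ,
          zpow_natCast, zpow_natCast, pow_add]
        norm_num
        field_simp
      have hbig : ((2 : ℚ) ^ (m + 1) - 1) * 2 ^ ((2 : ℤ) ^ e - (m : ℤ)) =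
          ((maxZ (true, e, m, o, r) : ℤ) : ℚ) * (4 / 2 ^ (2 ^ e + m)) := by
        have h1 : 1 ≤ 2 ^ (m + 1) := Nat.one_le_two_pow
        have h2 : 2 ≤ 2 ^ (e + 1) := by
          have : 1 ≤ 2 ^ e := Nat.one_le_two_pow
          rw [pow_succ]; omega
        have h3 : (2 : ℚ) ^ (2 ^ (e + 1) - 2) * 4 = 2 ^ (2 ^ e) * 2 ^ (2 ^ e) := by
          rw [← pow_add, show (4 : ℚ) = 2 ^ 2 by norm_num, ← pow_add]
          congr 1
          rw [Nat.sub_add_cancel h2]; ring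
        simp only [maxZ, cond_true]
        push_cast [Nat.cast_sub h1]
        have h4 : ∀ a b c : ℚ, a * b * (4 / c) = a * (b * 4) / c := by intros; ring
        rw [zpow_sub₀ (by norm_num), heQ, zpow_natCast, h4, h3, pow_add _ (2 ^ e)]
        field_simp
      simp only [toArith, Arith.repr, cond_true]
      rw [hq, hbig, hu]
      have hs : x / (((2 : ℚ) ^ B * 4 / 2 ^ (2 ^ e + m) : ℚ) : ℝ) =
          x * ((unitDen (true, e, m, o, r) : ℝ) / (unitNum (true, e, m, o, r) *
            2 ^ binadeR (true, e, m, o, r) x)) := by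
        rw [hbin]
        simp only [unitDen, unitNum, cond_true]
        push_cast
        field_simp
      rw [hs]
      simp only [reprR, val, finish, cond_true, hbin, unitNum, unitDen]
      change _ ⊔ _ ⊓ ((sigR (true, e, m, o, r) x : ℤ) : ℚ) * _ = _
      have hc : (0 : ℚ) ≤ 4 / 2 ^ (2 ^ e + m) := by positivity
      push_cast
      rw [mul_div_assoc (max _ _), max_mul_of_nonneg _ _ hc, min_mul_of_nonneg _ _ hc]
      congr 2
      · ring
      · ring

theorem repr_div (c : ArithC) (x : ℤ) {d : ℕ} (hd : 0 < d) :
    (toArith c).repr (((x / d : ℚ) : ℚ) : ℝ) = val c (reprZ c x d) := by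
  rw [repr_eq, ← reprR_div c x hd]
  push_cast
  rfl

theorem val_le (c : ArithC) {j k : ℤ} : val c j ≤ val c k ↔ j ≤ k := by
  have h1 : (0 : ℚ) < unitNum c := by exact_mod_cast unitNum_pos c
  have h2 : (0 : ℚ) < unitDen c := by exact_mod_cast unitDen_pos c
  unfold val
  rw [div_le_div_iff_of_pos_right h2, mul_le_mul_iff_left₀ h1]
  exact_mod_cast Iff.rfl

theorem val_inj (c : ArithC) {j k : ℤ} : val c j = val c k ↔ j = k := by
  simp only [le_antisymm_iff, val_le]

@[simp] theorem val_zero (c : ArithC) : val c 0 = 0 := by simp [val]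

theorem abs_finish_le (c : ArithC) (q : ℕ) (k : ℤ) : |finish c q k| ≤ maxZ c := by
  rw [abs_le]
  unfold finish
  have hpos := maxZ_pos c
  cases c.1
  · cases c.2.2.2.1
    · simp only [cond_false]; omega
    · simp only [cond_false, cond_true, wrapZ_eq]
      have h4 := Int.le_bmod (x := k) (m := 2 * maxZ c) (by omega)
      have h5 := Int.bmod_lt (x := k) (m := 2 * maxZ c) (by omega)
      omega
  · simp only [cond_true]; omega

/-! ### The exponential function at rational arguments -/

open Polynomial in
/-- The values of the exponential function at nonzero rational numbers are irrational: by the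
analytic part of the Lindemann-Weierstrass theorem, applied to the linear polynomial with root
`r`, a multiple of `exp r` by an integer prime to `p` differs from `p` times a rational number
with denominator `d ^ p` by less than `c ^ p / (p - 1)!`, where `d` is the denominator of `r`. -/
theorem irrational_exp {r : ℚ} (hr : r ≠ 0) : Irrational (Real.exp r) := by
  rintro ⟨s, hs⟩
  set f : ℤ[X] := C (r.den : ℤ) * X - C r.num with hf
  have hd : (r.den : ℤ) ≠ 0 := by exact_mod_cast r.den_ne_zero
  have hs0 : s ≠ 0 := by
    rintro rfl
    have := Real.exp_pos (r : ℝ)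
    rw [← hs] at this
    simp at this
  have hf0 : f.eval 0 ≠ 0 := by simpa [hf] using hr
  have hdeg : f.natDegree = 1 := by
    rw [hf, sub_eq_add_neg, ← C_neg]
    exact natDegree_linear hd
  have hfne : f ≠ 0 := by
    intro h; rw [h] at hf0; simp at hf0
  have hroot : ((r : ℝ) : ℂ) ∈ f.aroots ℂ := by
    rw [mem_aroots]
    refine ⟨hfne, ?_⟩
    have : (r.den : ℂ) * (r : ℂ) = r.num := by exact_mod_cast Rat.den_mul_eq_num r
    simp [hf, this]
  obtain ⟨c, hc⟩ := LindemannWeierstrass.exp_polynomial_approx f hf0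
  -- the difference is a rational number with denominator `s.den * r.den ^ p`
  have hlim : Filter.Tendsto (fun p : ℕ => (s.den * |c| * r.den) * ((r.den * |c|) ^ (p - 1) / (Nat.factorial (p - 1) : ℝ)))
      Filter.atTop (nhds 0) := by
    have h := (FloorSemiring.tendsto_pow_div_factorial_atTop (r.den * |c|)).comp (Filter.tendsto_sub_atTop_nat 1)
    simpa using h.const_mul (s.den * |c| * r.den : ℝ)
  have hev := (hlim.eventually (gt_mem_nhds (show (0 : ℝ) < 1 by norm_num)))
  obtain ⟨N, hN⟩ := Filter.eventually_atTop.1 hev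
  obtain ⟨p, hpN, hp⟩ := Nat.exists_infinite_primes
    (N + (eval 0 f).natAbs + s.num.natAbs + r.den + 1)
  obtain ⟨n, hn, g, hg, hbound⟩ := hc p (by omega) hp
  have hb := hbound hroot
  have hgint : ∃ z : ℤ, (r.den : ℝ) ^ p * aeval (r : ℝ) g = z := by
    refine ⟨g.sum fun i a => a * (r.num ^ i * r.den ^ (p - i)), ?_⟩
    rw [aeval_eq_sum_range, Polynomial.sum_over_range _ (by simp), Finset.mul_sum]
    push_cast
    refine Finset.sum_congr rfl fun i hi => ?_
    have hip : i ≤ p := by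
      have := Finset.mem_range.1 hi
      rw [hdeg] at hg; omega
    have h1 : (r.den : ℝ) ^ p = r.den ^ i * r.den ^ (p - i) := by rw [← pow_add]; congr 1; omega
    have h2 : (r.den : ℝ) * r = r.num := by exact_mod_cast Rat.den_mul_eq_num r
    rw [h1, zsmul_eq_mul, ← h2, mul_pow]
    ring
  obtain ⟨z, hz⟩ := hgint
  have hreal : |(n : ℝ) * s - p * aeval (r : ℝ) g| ≤ c ^ p / (Nat.factorial (p - 1)) := by
    have h1 : n • Complex.exp ((r : ℝ) : ℂ) - p • aeval ((r : ℝ) : ℂ) g =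
        (((n : ℝ) * s - p * aeval (r : ℝ) g : ℝ) : ℂ) := by
      rw [hs, ← Complex.ofReal_exp]
      have : aeval ((r : ℝ) : ℂ) g = ((aeval (r : ℝ) g : ℝ) : ℂ) :=
        aeval_algebraMap_apply ℂ (r : ℝ) g
      rw [this]
      push_cast
      simp
    rw [h1, Complex.norm_real] at hb
    exact hb
  have hsden : (s.den : ℝ) * s = s.num := by exact_mod_cast Rat.den_mul_eq_num s
  have hint : ((n * s.num * r.den ^ p - p * s.den * z : ℤ) : ℝ) =
      (s.den * r.den ^ p) * ((n : ℝ) * s - p * aeval (r : ℝ) g) := by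
    push_cast
    rw [← hz, ← hsden]
    ring
  have hp1 : p = (p - 1) + 1 := by have := hp.pos; omega
  have hlt : |((n * s.num * r.den ^ p - p * s.den * z : ℤ) : ℝ)| < 1 := by
    rw [hint, abs_mul, abs_of_nonneg (by positivity : (0 : ℝ) ≤ s.den * r.den ^ p)]
    refine lt_of_le_of_lt ?_ (hN p (by omega))
    calc (s.den * r.den ^ p : ℝ) * |(n : ℝ) * s - p * aeval (r : ℝ) g|
        ≤ (s.den * r.den ^ p) * (|c| ^ p / (Nat.factorial (p - 1))) := by
          refine mul_le_mul_of_nonneg_left (hreal.trans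
            (div_le_div_of_nonneg_right ?_ (by positivity))) (by positivity)
          rw [← abs_pow]; exact le_abs_self _
      _ = _ := by
          conv_lhs => rw [hp1]
          simp only [Nat.add_sub_cancel]
          rw [pow_succ, pow_succ, mul_pow]
          ring
  have hzero : n * s.num * r.den ^ p - p * s.den * z = 0 := by
    rw [← Int.abs_lt_one_iff]
    exact_mod_cast hlt
  have hdvd : (p : ℤ) ∣ n * s.num * r.den ^ p := ⟨s.den * z, by linarith⟩
  have hpp := Nat.prime_iff_prime_int.1 hp
  rcases hpp.dvd_or_dvd hdvd with h | h
  · rcases hpp.dvd_or_dvd h with h | h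
    · exact hn h
    · have := Nat.le_of_dvd (Int.natAbs_pos.2 (Rat.num_ne_zero.2 hs0)) (Int.natCast_dvd.1 h)
      omega
  · have h2 : p ∣ r.den := by exact_mod_cast hpp.dvd_of_dvd_pow h
    have := Nat.le_of_dvd r.den_pos h2
    omega

/-- Lower bound `(1 + a / n) ^ n` for `exp a`, where `a = x / d`, as a fraction. -/
def expLow (x : ℤ) (d n : ℕ) : ℤ × ℕ := ((n * d + x) ^ n, (n * d) ^ n)

/-- Upper bound `(1 - a / n) ^ (-n)` for `exp a`, where `a = x / d`, as a fraction. -/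
def expHigh (x : ℤ) (d n : ℕ) : ℤ × ℕ := ((n * d : ℤ) ^ n, (n * d - x).toNat ^ n)

theorem expLow_eq (x : ℤ) {d n : ℕ} (hd : 0 < d) (hn : 0 < n) :
    ((expLow x d n).1 : ℝ) / (expLow x d n).2 = (1 + (x / d : ℝ) / n) ^ n := by
  simp only [expLow]
  push_cast
  rw [← div_pow]
  congr 1
  field_simp

theorem expHigh_eq (x : ℤ) {d n : ℕ} (hd : 0 < d) (hn : 0 < n) (h : x < n * d) :
    ((expHigh x d n).1 : ℝ) / (expHigh x d n).2 = ((1 + (-(x / d : ℝ)) / n) ^ n)⁻¹ := by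
  have h1 : (((n * d - x).toNat : ℕ) : ℝ) = n * d - x := by
    have : (((n * d - x).toNat : ℕ) : ℤ) = n * d - x := Int.toNat_of_nonneg (by linarith)
    exact_mod_cast congrArg (Int.cast (R := ℝ)) this
  have h2 : (0 : ℝ) < n * d - x := by
    have : (x : ℝ) < n * d := by exact_mod_cast h
    linarith
  simp only [expHigh]
  push_cast
  rw [h1, ← div_pow, ← inv_pow]
  congr 1
  have hd' : (d : ℝ) ≠ 0 := by positivity
  have hn' : (n : ℝ) ≠ 0 := by positivity
  have h3 : 1 + -((x : ℝ) / d) / n = (n * d - x) / (n * d) := by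
    field_simp
    ring
  rw [h3, inv_div]

theorem one_add_div_pow_le_exp {a : ℝ} {n : ℕ} (hn : 0 < n) (h : -a ≤ n) :
    (1 + a / n) ^ n ≤ Real.exp a := by
  have hn' : (0 : ℝ) < n := by exact_mod_cast hn
  have h1 : 0 ≤ 1 + a / n := by
    have : -1 ≤ a / n := by rw [le_div_iff₀ hn']; linarith
    linarith
  calc (1 + a / n) ^ n ≤ (Real.exp (a / n)) ^ n := by
        refine pow_le_pow_left₀ h1 ?_ n
        linarith [Real.add_one_le_exp (a / n)]
    _ = Real.exp a := by rw [← Real.exp_nat_mul]; congr 1; field_simp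

theorem expLow_pos (x : ℤ) {d n : ℕ} (hd : 0 < d) (hn : 0 < n) (h : -x < n * d) :
    (0 : ℝ) < ((expLow x d n).1 : ℝ) / (expLow x d n).2 := by
  have : (0 : ℤ) < n * d + x := by linarith
  simp only [expLow]
  have h1 : (0 : ℤ) < (n * d + x) ^ n := by positivity
  have h2 : 0 < (n * d) ^ n := by positivity
  have h3 : (0 : ℝ) < (((n * d + x) ^ n : ℤ) : ℝ) := by exact_mod_cast h1
  have h4 : (0 : ℝ) < (((n * d) ^ n : ℕ) : ℝ) := by exact_mod_cast h2
  exact div_pos h3 h4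

theorem expLow_le (x : ℤ) {d n : ℕ} (hd : 0 < d) (hn : 0 < n) (h : -x < n * d) :
    ((expLow x d n).1 : ℝ) / (expLow x d n).2 ≤ Real.exp (x / d : ℝ) := by
  rw [expLow_eq x hd hn]
  apply one_add_div_pow_le_exp hn
  have hd' : (0 : ℝ) < d := by exact_mod_cast hd
  rw [← neg_div, div_le_iff₀ hd']
  exact_mod_cast h.le

theorem le_expHigh (x : ℤ) {d n : ℕ} (hd : 0 < d) (hn : 0 < n) (h : x < n * d) :
    Real.exp (x / d : ℝ) ≤ ((expHigh x d n).1 : ℝ) / (expHigh x d n).2 := by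
  have hd' : (0 : ℝ) < d := by exact_mod_cast hd
  have hn' : (0 : ℝ) < n := by exact_mod_cast hn
  have hlt : (x / d : ℝ) < n := by
    rw [div_lt_iff₀ hd']; exact_mod_cast h
  rw [expHigh_eq x hd hn h, ← neg_neg (x / d : ℝ), Real.exp_neg, neg_neg]
  apply inv_anti₀
  · have : 0 < 1 + -(x / d : ℝ) / n := by
      rw [neg_div]
      have : (x / d : ℝ) / n < 1 := by rw [div_lt_one hn']; exact hlt
      linarith
    positivity
  · exact one_add_div_pow_le_exp hn (by linarith)

/-- `reprR` is constant between two positive numbers with the same binade and the same rounded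
multiple of the spacing. -/
theorem reprR_squeeze (c : ArithC) {x y z : ℝ} (hx : 0 < x) (hxy : x ≤ y) (hyz : y ≤ z)
    (hb : binadeR c x = binadeR c z) (hs : sigR c x = sigR c z) : reprR c y = reprR c x := by
  have hmono : ∀ {a b : ℝ}, 0 < a → a ≤ b → binadeR c a ≤ binadeR c b := by
    intro a b ha hab
    unfold binadeR
    cases c.1
    · simp
    · simp only [cond_true]
      apply Nat.log_mono_right
      apply Nat.floor_le_floor
      rw [abs_of_pos ha, abs_of_pos (ha.trans_le hab)]
      gcongr
  have h1 := hmono hx hxy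
  have h2 := hmono (hx.trans_le hxy) hyz
  have hyb : binadeR c y = binadeR c x := by omega
  have hsy : sigR c y = sigR c x := by
    have hpos : (0 : ℝ) ≤ unitDen c / (unitNum c * 2 ^ binadeR c x) := by positivity
    have h3 : sigR c x ≤ sigR c y := by
      unfold sigR; rw [hyb]
      exact toInt_mono _ (mul_le_mul_of_nonneg_right hxy hpos)
    have h4 : sigR c y ≤ sigR c z := by
      unfold sigR; rw [hyb, ← hb]
      exact toInt_mono _ (mul_le_mul_of_nonneg_right hyz hpos)
    omega
  unfold reprR
  rw [hyb, hsy]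

section
open Filter Topology

theorem floor_eventually_eq {x : ℝ} (hx : ∀ z : ℤ, x ≠ z) : ∀ᶠ y in 𝓝 x, ⌊y⌋ = ⌊x⌋ := by
  have h1 : (⌊x⌋ : ℝ) < x := lt_of_le_of_ne (Int.floor_le x) (hx _).symm
  filter_upwards [Ioo_mem_nhds h1 (Int.lt_floor_add_one x)] with y hy
  exact Int.floor_eq_iff.2 ⟨hy.1.le, hy.2⟩

theorem ceil_eventually_eq {x : ℝ} (hx : ∀ z : ℤ, x ≠ z) : ∀ᶠ y in 𝓝 x, ⌈y⌉ = ⌈x⌉ := by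
  have h1 : x < ⌈x⌉ := lt_of_le_of_ne (Int.le_ceil x) (hx _)
  have h2 : (⌈x⌉ : ℝ) - 1 < x := by linarith [Int.ceil_lt_add_one x]
  filter_upwards [Ioo_mem_nhds h2 h1] with y hy
  exact Int.ceil_eq_iff.2 ⟨hy.1, hy.2.le⟩

theorem toInt_eventually_eq (r : Rounding) {x : ℝ} (hx : Irrational x) :
    ∀ᶠ y in 𝓝 x, r.toInt y = r.toInt x := by
  cases r
  · exact floor_eventually_eq hx.ne_int
  · exact ceil_eventually_eq hx.ne_int
  · simp only [Rounding.toInt]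
    rcases lt_or_gt_of_ne hx.ne_zero with h | h
    · filter_upwards [ceil_eventually_eq hx.ne_int, gt_mem_nhds h] with y h1 h2
      rw [if_neg (not_le.2 h2), if_neg (not_le.2 h), h1]
    · filter_upwards [floor_eventually_eq hx.ne_int, lt_mem_nhds h] with y h1 h2
      rw [if_pos h2.le, if_pos h.le, h1]
  · simp only [Rounding.toInt, round_eq]
    have h : Irrational (x + 1 / 2) := by
      have := hx.add_ratCast (1 / 2)
      simpa using this
    have hc : Tendsto (fun y : ℝ => y + 1 / 2) (𝓝 x) (𝓝 (x + 1 / 2)) :=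
      (continuous_id.add continuous_const).tendsto x
    exact hc.eventually (floor_eventually_eq h.ne_int)

theorem sig_eventually_eq (c : ArithC) {x : ℝ} (hx : Irrational x) :
    ∀ᶠ y in 𝓝 x, binadeR c y = binadeR c x ∧ sigR c y = sigR c x := by
  have hb : ∀ᶠ y in 𝓝 x, binadeR c y = binadeR c x := by
    unfold binadeR
    cases c.1
    · simp
    · simp only [cond_true]
      have h1 : Irrational (|x| * 2 ^ (2 ^ c.2.1) / 4) := by
        have h2 : Irrational |x| := by
          rcases abs_choice x with h | h <;> rw [h]
          · exact hx
          · exact hx.neg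
        have h3 : (2 ^ (2 ^ c.2.1) / 4 : ℚ) ≠ 0 := by positivity
        have := h2.mul_ratCast h3
        push_cast at this
        rwa [← mul_div_assoc] at this
      have hc : Tendsto (fun y : ℝ => |y| * 2 ^ (2 ^ c.2.1) / 4) (𝓝 x)
          (𝓝 (|x| * 2 ^ (2 ^ c.2.1) / 4)) :=
        ((continuous_abs.mul continuous_const).div_const _).tendsto x
      filter_upwards [hc.eventually (floor_eventually_eq h1.ne_int)] with y hy
      rw [← Int.floor_toNat, ← Int.floor_toNat, hy]
  set s : ℝ := unitDen c / (unitNum c * 2 ^ binadeR c x) with hs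
  have h1 : Irrational (x * s) := by
    have h3 : (unitDen c / (unitNum c * 2 ^ binadeR c x) : ℚ) ≠ 0 := by
      have h1 : (0 : ℚ) < unitNum c := by exact_mod_cast unitNum_pos c
      have h2 : (0 : ℚ) < unitDen c := by exact_mod_cast unitDen_pos c
      positivity
    have := hx.mul_ratCast h3
    push_cast at this
    exact this
  have hc : Tendsto (fun y : ℝ => y * s) (𝓝 x) (𝓝 (x * s)) :=
    (continuous_id.mul continuous_const).tendsto x
  filter_upwards [hb, hc.eventually (toInt_eventually_eq (toRounding c.2.2.2.2) h1)] with y h2 h3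
  refine ⟨h2, ?_⟩
  unfold sigR
  rw [h2]
  exact h3

/-- The precision `n` decides the rounding of `exp a` for the number `a` represented by `k`. -/
def expOK (c : ArithC) (n : ℕ) (k : ℤ) : Bool :=
  decide ((k * unitNum c).natAbs < n * unitDen c) &&
  (decide (binadeZ c (expLow (k * unitNum c) (unitDen c) n).1 (expLow (k * unitNum c) (unitDen c) n).2 =
    binadeZ c (expHigh (k * unitNum c) (unitDen c) n).1 (expHigh (k * unitNum c) (unitDen c) n).2) &&
  decide (sigZ c (expLow (k * unitNum c) (unitDen c) n).1 (expLow (k * unitNum c) (unitDen c) n).2 =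
    sigZ c (expHigh (k * unitNum c) (unitDen c) n).1 (expHigh (k * unitNum c) (unitDen c) n).2))

/-- The exponential function of the arithmetic, computed with precision `n`. -/
def expZ (c : ArithC) (n : ℕ) (k : ℤ) : ℤ :=
  reprZ c (expLow (k * unitNum c) (unitDen c) n).1 (expLow (k * unitNum c) (unitDen c) n).2

theorem sigR_div (c : ArithC) (x : ℤ) {d : ℕ} (hd : 0 < d) :
    sigR c ((x : ℝ) / d) = sigZ c x d := by
  unfold sigR sigZ
  rw [binadeR_div c x hd, ← toInt_div]
  · congr 1
    push_cast
    have := unitNum_pos c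
    field_simp
  · have := unitNum_pos c
    positivity

theorem val_cast (c : ArithC) (k : ℤ) :
    ((val c k : ℚ) : ℝ) = ((k * unitNum c : ℤ) : ℝ) / (unitDen c : ℕ) := by
  simp [val]

theorem natAbs_lt_imp {x : ℤ} {m : ℕ} (h : x.natAbs < m) : x < m ∧ -x < m := by omega

theorem expZ_eq {c : ArithC} {n : ℕ} {k : ℤ} (h : expOK c n k = true) :
    (toArith c).exp (val c k) = val c (expZ c n k) := by
  simp only [expOK, Bool.and_eq_true, decide_eq_true_eq] at h
  obtain ⟨h0, hb, hs⟩ := h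
  have hd := unitDen_pos c
  have hn : 0 < n := by
    rcases Nat.eq_zero_or_pos n with rfl | h
    · simp at h0
    · exact h
  obtain ⟨h1, h2⟩ := natAbs_lt_imp h0
  push_cast at h1 h2
  have hld : 0 < (expLow (k * unitNum c) (unitDen c) n).2 := by
    simp only [expLow]; positivity
  have hhd : 0 < (expHigh (k * unitNum c) (unitDen c) n).2 := by
    simp only [expHigh]
    have : 0 < (n * unitDen c - k * unitNum c : ℤ).toNat := by
      rw [Int.lt_toNat]; push_cast; linarith
    positivity
  rw [Arith.exp, repr_eq, val_cast, expZ, ← reprR_div c _ hld]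
  congr 1
  apply reprR_squeeze c (expLow_pos _ hd hn h2) (expLow_le _ hd hn h2) (le_expHigh _ hd hn h1)
  · rw [binadeR_div c _ hld, binadeR_div c _ hhd, hb]
  · rw [sigR_div c _ hld, sigR_div c _ hhd, hs]

/-- Some precision suffices: `exp a` is `1` or irrational, and no irrational number is a point of
discontinuity of the rounding. -/
theorem expOK_eventually (c : ArithC) (k : ℤ) : ∀ᶠ n in atTop, expOK c n k = true := by
  have hd := unitDen_pos c
  set x : ℤ := k * unitNum c with hx
  have hlarge : ∀ᶠ n : ℕ in atTop, x.natAbs < n * unitDen c ∧ 0 < n := by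
    filter_upwards [eventually_ge_atTop (x.natAbs + 1)] with n hn
    constructor
    · nlinarith
    · omega
  rcases eq_or_ne k 0 with hk | hk
  · filter_upwards [hlarge] with n hn
    have hx0 : x = 0 := by rw [hx, hk, zero_mul]
    have h1 : ((n : ℤ) * (unitDen c : ℤ)).toNat = n * unitDen c := by
      rw [← Nat.cast_mul, Int.toNat_natCast]
    simp only [expOK, ← hx]
    simp only [hx0, expLow, expHigh, add_zero, sub_zero, h1]
    simpa using ⟨hn.2, hd⟩
  · have hval : val c k ≠ 0 := by
      rw [← val_zero c, Ne, val_inj]; exact hk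
    have hirr := irrational_exp hval
    rw [val_cast, ← hx] at hirr
    have hev := sig_eventually_eq c hirr
    have hlow := (Real.tendsto_one_add_div_pow_exp ((x : ℝ) / (unitDen c : ℕ))).eventually hev
    have hinv := (Real.tendsto_one_add_div_pow_exp (-((x : ℝ) / (unitDen c : ℕ)))).inv₀
      (Real.exp_pos _).ne'
    rw [Real.exp_neg, inv_inv] at hinv
    have hhigh := hinv.eventually hev
    filter_upwards [hlarge, hlow, hhigh] with n hn hl hh
    obtain ⟨h1, h2⟩ := natAbs_lt_imp hn.1
    push_cast at h1 h2
    have hld : 0 < (expLow x (unitDen c) n).2 := by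
      have := hn.2
      simp only [expLow]; positivity
    have hhd : 0 < (expHigh x (unitDen c) n).2 := by
      simp only [expHigh]
      have : 0 < (n * unitDen c - x : ℤ).toNat := by
        rw [Int.lt_toNat]; push_cast; linarith
      positivity
    rw [← expLow_eq x hd hn.2, binadeR_div c _ hld, sigR_div c _ hld] at hl
    rw [← expHigh_eq x hd hn.2 h1, binadeR_div c _ hhd, sigR_div c _ hhd] at hh
    simp only [expOK, Bool.and_eq_true, decide_eq_true_eq, ← hx]
    exact ⟨hn.1, hl.1.trans hh.1.symm, hl.2.trans hh.2.symm⟩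

end

/-! ### Evaluation of encoders with integers -/

/-- Codes of fractions. -/
abbrev RatC := ℤ × ℕ

/-- Codes of instructions: kind, constant, register numbers. -/
abbrev GateC := ℕ × RatC × ℕ × ℕ × ℕ × ℕ

/-- Codes of programs: instructions and output registers. -/
abbrev ProgC := List GateC × List ℕ

/-- Codes of heads: score, whether the normalisation is hardmax, and rows of the matrix. -/
abbrev HeadC := ProgC × Bool × List (List RatC)

/-- Codes of layers: heads and combination function. -/
abbrev LayerC := List HeadC × ProgC

/-- Codes of encoders. -/
abbrev TEC := ArithC × List ProgC × List LayerC × ProgC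

instance : Primcodable GateC := inferInstance

instance : Primcodable HeadC := inferInstance

instance : Primcodable LayerC := inferInstance

instance : Primcodable TEC := inferInstance

def toRat (q : RatC) : ℚ := (q.1 : ℚ) / (q.2 : ℚ)

def toGate (g : GateC) : Gate :=
  match g.1 with
  | 0 => .const (toRat g.2.1)
  | 1 => .add g.2.2.1 g.2.2.2.1
  | 2 => .sub g.2.2.1 g.2.2.2.1
  | 3 => .mul g.2.2.1 g.2.2.2.1
  | 4 => .div g.2.2.1 g.2.2.2.1
  | _ => .ite g.2.2.1 g.2.2.2.1 g.2.2.2.2.1 g.2.2.2.2.2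

def toProg (p : ProgC) : Prog := ⟨p.1.map toGate, p.2⟩

def toHead (h : HeadC) : Head :=
  ⟨toProg h.1, bif h.2.1 then .hardmax else .softmax, h.2.2.map (fun r => r.map toRat)⟩

def toLayer (l : LayerC) : Layer := ⟨l.1.map toHead, toProg l.2⟩

/-- The encoder with a given code. -/
def toTE (t : TEC) : TE :=
  ⟨toArith t.1, t.2.1.map toProg, t.2.2.1.map toLayer, toProg t.2.2.2⟩

/-! The operations of the arithmetic on the integers that represent its numbers. -/

/-- The sum of the numbers represented by `a` and `b`, as a multiple of the unit. The operations
below are those of the arithmetic and of encoders, transferred to multiples of the unit. -/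
def addZ (c : ArithC) (a b : ℤ) : ℤ := reprZ c ((a + b) * unitNum c) (unitDen c)

def subZ (c : ArithC) (a b : ℤ) : ℤ := reprZ c ((a - b) * unitNum c) (unitDen c)

def mulZ (c : ArithC) (a b : ℤ) : ℤ :=
  reprZ c (a * b * (unitNum c * unitNum c)) (unitDen c * unitDen c)

def divZ (c : ArithC) (a b : ℤ) : ℤ :=
  bif decide (b = 0) then reprZ c 0 1 else reprZ c (a * b) (b.natAbs * b.natAbs)

def sumZ (c : ArithC) (l : List ℤ) : ℤ := l.foldl (fun a b => addZ c a b) 0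

def dotZ (c : ArithC) (x y : List ℤ) : ℤ := sumZ c (List.zipWith (fun a b => mulZ c a b) x y)

def gateZ (c : ArithC) (v : List ℤ) (g : GateC) : ℤ :=
  bif decide (g.1 = 0) then reprZ c g.2.1.1 g.2.1.2
  else bif decide (g.1 = 1) then addZ c (v.getD g.2.2.1 0) (v.getD g.2.2.2.1 0)
  else bif decide (g.1 = 2) then subZ c (v.getD g.2.2.1 0) (v.getD g.2.2.2.1 0)
  else bif decide (g.1 = 3) then mulZ c (v.getD g.2.2.1 0) (v.getD g.2.2.2.1 0)
  else bif decide (g.1 = 4) then divZ c (v.getD g.2.2.1 0) (v.getD g.2.2.2.1 0)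
  else bif decide (v.getD g.2.2.1 0 ≤ v.getD g.2.2.2.1 0) then v.getD g.2.2.2.2.1 0
  else v.getD g.2.2.2.2.2 0

def progZ (c : ArithC) (p : ProgC) (x : List ℤ) : List ℤ :=
  p.2.map (fun i => (p.1.foldl (fun v g => v ++ [gateZ c v g]) x).getD i 0)

/-- Numerators of the weights; `n` is the precision used for the exponential function. -/
def numeratorsZ (c : ArithC) (n : ℕ) (ν : Bool) (s : List ℤ) : List ℤ :=
  bif ν then s.map (fun a => bif s.all (fun b => decide (b ≤ a)) then reprZ c 1 1 else 0)
  else s.map (fun a => expZ c n a)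

def scoreZ (c : ArithC) (h : HeadC) (x y : List ℤ) : ℤ := (progZ c h.1 (x ++ y)).headD 0

/-- The numerators of the weights used by the head `h` at the vector `x`. -/
def headNumZ (c : ArithC) (n : ℕ) (h : HeadC) (x : List ℤ) (X : List (List ℤ)) : List ℤ :=
  numeratorsZ c n h.2.1 (X.map (fun y => scoreZ c h x y))

/-- The term of the vector `y` with numerator `a` in the pooling, if the numerators sum up
to `s`. -/
def termZ (c : ArithC) (row : List RatC) (s a : ℤ) (y : List ℤ) : ℤ :=
  mulZ c (divZ c a s) (dotZ c (row.map (fun q => reprZ c q.1 q.2)) y)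

def poolZ (c : ArithC) (n : ℕ) (h : HeadC) (x : List ℤ) (X : List (List ℤ)) : List ℤ :=
  h.2.2.map (fun row => sumZ c (List.zipWith
    (fun a y => termZ c row (sumZ c (headNumZ c n h x X)) a y) (headNumZ c n h x X) X))

def layerZ (c : ArithC) (n : ℕ) (l : LayerC) (X : List (List ℤ)) : List (List ℤ) :=
  X.map (fun x => progZ c l.2 (x ++ l.1.flatMap (fun h => poolZ c n h x X)))

def embedZ (c : ArithC) (emb : List ProgC) (a i : ℕ) : List ℤ :=
  progZ c (emb.getD a ([], [])) [reprZ c (i : ℤ) 1]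

def embedWordZ (c : ArithC) (emb : List ProgC) (w : List ℕ) : List (List ℤ) :=
  (List.range w.length).map (fun i => embedZ c emb (w.getD i 0) (i + 1))

def layersZ (c : ArithC) (n : ℕ) (ls : List LayerC) (X : List (List ℤ)) : List (List ℤ) :=
  ls.foldl (fun X l => layerZ c n l X) X

/-- The value computed by the encoder with code `t` on the word `w`. -/
def evalZ (n : ℕ) (t : TEC) (w : List ℕ) : ℤ :=
  (progZ t.1 t.2.2.2 ((layersZ t.1 n t.2.2.1 (embedWordZ t.1 t.2.1 w)).getLastD [])).headD 0

section
variable {α : Type*} [Primcodable α]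

theorem _root_.PR.lsum {f : α → List ℕ} (hf : Primrec f) : Primrec fun a => (f a).sum := by
  simp only [List.sum_eq_foldl]
  fun_prop

attribute [fun_prop] PR.lsum

@[fun_prop] theorem prim_roundZ {r : α → Bool × Bool} {x : α → ℤ} {d : α → ℕ} (hr : Primrec r)
    (hx : Primrec x) (hd : Primrec d) : Primrec fun a => roundZ (r a) (x a) (d a) := by
  unfold roundZ
  fun_prop

@[fun_prop] theorem prim_unitNum {c : α → ArithC} (hc : Primrec c) :
    Primrec fun a => unitNum (c a) := by
  unfold unitNum
  fun_prop

@[fun_prop] theorem prim_unitDen {c : α → ArithC} (hc : Primrec c) :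
    Primrec fun a => unitDen (c a) := by
  unfold unitDen
  fun_prop

@[fun_prop] theorem prim_binadeZ {c : α → ArithC} {x : α → ℤ} {d : α → ℕ} (hc : Primrec c)
    (hx : Primrec x) (hd : Primrec d) : Primrec fun a => binadeZ (c a) (x a) (d a) := by
  unfold binadeZ
  fun_prop

@[fun_prop] theorem prim_sigZ {c : α → ArithC} {x : α → ℤ} {d : α → ℕ} (hc : Primrec c)
    (hx : Primrec x) (hd : Primrec d) : Primrec fun a => sigZ (c a) (x a) (d a) := by
  unfold sigZ
  fun_prop

@[fun_prop] theorem prim_maxZ {c : α → ArithC} (hc : Primrec c) :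
    Primrec fun a => maxZ (c a) := by
  unfold maxZ
  fun_prop

@[fun_prop] theorem prim_wrapZ {m : α → ℕ} {k : α → ℤ} (hm : Primrec m) (hk : Primrec k) :
    Primrec fun a => wrapZ (m a) (k a) := by
  unfold wrapZ
  fun_prop

@[fun_prop] theorem prim_finish {c : α → ArithC} {k : α → ℤ} {q : α → ℕ} (hc : Primrec c)
    (hq : Primrec q) (hk : Primrec k) : Primrec fun a => finish (c a) (q a) (k a) := by
  unfold finish
  fun_prop

@[fun_prop] theorem prim_reprZ {c : α → ArithC} {x : α → ℤ} {d : α → ℕ} (hc : Primrec c)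
    (hx : Primrec x) (hd : Primrec d) : Primrec fun a => reprZ (c a) (x a) (d a) := by
  unfold reprZ
  fun_prop

@[fun_prop] theorem prim_expOK {c : α → ArithC} {n : α → ℕ} {k : α → ℤ} (hc : Primrec c)
    (hn : Primrec n) (hk : Primrec k) : Primrec fun a => expOK (c a) (n a) (k a) := by
  unfold expOK
  fun_prop

@[fun_prop] theorem prim_expZ {c : α → ArithC} {n : α → ℕ} {k : α → ℤ} (hc : Primrec c)
    (hn : Primrec n) (hk : Primrec k) : Primrec fun a => expZ (c a) (n a) (k a) := by
  unfold expZ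
  fun_prop

@[fun_prop] theorem prim_addZ {c : α → ArithC} {x y : α → ℤ} (hc : Primrec c)
    (hx : Primrec x) (hy : Primrec y) : Primrec fun a => addZ (c a) (x a) (y a) := by
  unfold addZ
  fun_prop

@[fun_prop] theorem prim_subZ {c : α → ArithC} {x y : α → ℤ} (hc : Primrec c)
    (hx : Primrec x) (hy : Primrec y) : Primrec fun a => subZ (c a) (x a) (y a) := by
  unfold subZ
  fun_prop

@[fun_prop] theorem prim_mulZ {c : α → ArithC} {x y : α → ℤ} (hc : Primrec c)
    (hx : Primrec x) (hy : Primrec y) : Primrec fun a => mulZ (c a) (x a) (y a) := by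
  unfold mulZ
  fun_prop

@[fun_prop] theorem prim_divZ {c : α → ArithC} {x y : α → ℤ} (hc : Primrec c)
    (hx : Primrec x) (hy : Primrec y) : Primrec fun a => divZ (c a) (x a) (y a) := by
  unfold divZ
  fun_prop

@[fun_prop] theorem prim_sumZ {c : α → ArithC} {l : α → List ℤ} (hc : Primrec c)
    (hl : Primrec l) : Primrec fun a => sumZ (c a) (l a) := by
  unfold sumZ
  fun_prop

@[fun_prop] theorem prim_dotZ {c : α → ArithC} {l m : α → List ℤ} (hc : Primrec c)
    (hl : Primrec l) (hm : Primrec m) : Primrec fun a => dotZ (c a) (l a) (m a) := by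
  unfold dotZ
  fun_prop

@[fun_prop] theorem prim_gateZ {c : α → ArithC} {v : α → List ℤ} {g : α → GateC}
    (hc : Primrec c) (hv : Primrec v) (hg : Primrec g) :
    Primrec fun a => gateZ (c a) (v a) (g a) := by
  unfold gateZ
  fun_prop

@[fun_prop] theorem prim_progZ {c : α → ArithC} {p : α → ProgC} {x : α → List ℤ}
    (hc : Primrec c) (hp : Primrec p) (hx : Primrec x) :
    Primrec fun a => progZ (c a) (p a) (x a) := by
  unfold progZ
  fun_prop

@[fun_prop] theorem prim_numeratorsZ {c : α → ArithC} {n : α → ℕ} {ν : α → Bool}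
    {s : α → List ℤ} (hc : Primrec c) (hn : Primrec n) (hν : Primrec ν) (hs : Primrec s) :
    Primrec fun a => numeratorsZ (c a) (n a) (ν a) (s a) := by
  unfold numeratorsZ
  fun_prop

@[fun_prop] theorem prim_scoreZ {c : α → ArithC} {h : α → HeadC} {x y : α → List ℤ}
    (hc : Primrec c) (hh : Primrec h) (hx : Primrec x) (hy : Primrec y) :
    Primrec fun a => scoreZ (c a) (h a) (x a) (y a) := by
  unfold scoreZ
  fun_prop

@[fun_prop] theorem prim_headNumZ {c : α → ArithC} {n : α → ℕ} {h : α → HeadC} {x : α → List ℤ}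
    {X : α → List (List ℤ)} (hc : Primrec c) (hn : Primrec n) (hh : Primrec h) (hx : Primrec x)
    (hX : Primrec X) : Primrec fun a => headNumZ (c a) (n a) (h a) (x a) (X a) := by
  unfold headNumZ
  fun_prop

@[fun_prop] theorem prim_termZ {c : α → ArithC} {row : α → List RatC} {s b : α → ℤ}
    {y : α → List ℤ} (hc : Primrec c) (hr : Primrec row) (hs : Primrec s) (hb : Primrec b)
    (hy : Primrec y) : Primrec fun a => termZ (c a) (row a) (s a) (b a) (y a) := by
  unfold termZ
  fun_prop

@[fun_prop] theorem prim_poolZ {c : α → ArithC} {n : α → ℕ} {h : α → HeadC} {x : α → List ℤ}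
    {X : α → List (List ℤ)} (hc : Primrec c) (hn : Primrec n) (hh : Primrec h) (hx : Primrec x)
    (hX : Primrec X) : Primrec fun a => poolZ (c a) (n a) (h a) (x a) (X a) := by
  unfold poolZ
  fun_prop

@[fun_prop] theorem prim_layerZ {c : α → ArithC} {n : α → ℕ} {l : α → LayerC}
    {X : α → List (List ℤ)} (hc : Primrec c) (hn : Primrec n) (hl : Primrec l)
    (hX : Primrec X) : Primrec fun a => layerZ (c a) (n a) (l a) (X a) := by
  unfold layerZ
  fun_prop

@[fun_prop] theorem prim_embedZ {c : α → ArithC} {emb : α → List ProgC} {s i : α → ℕ}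
    (hc : Primrec c) (he : Primrec emb) (hs : Primrec s) (hi : Primrec i) :
    Primrec fun a => embedZ (c a) (emb a) (s a) (i a) := by
  unfold embedZ
  fun_prop

@[fun_prop] theorem prim_embedWordZ {c : α → ArithC} {emb : α → List ProgC} {w : α → List ℕ}
    (hc : Primrec c) (he : Primrec emb) (hw : Primrec w) :
    Primrec fun a => embedWordZ (c a) (emb a) (w a) := by
  unfold embedWordZ
  fun_prop

@[fun_prop] theorem prim_layersZ {c : α → ArithC} {n : α → ℕ} {l : α → List LayerC}
    {X : α → List (List ℤ)} (hc : Primrec c) (hn : Primrec n) (hl : Primrec l)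
    (hX : Primrec X) : Primrec fun a => layersZ (c a) (n a) (l a) (X a) := by
  unfold layersZ
  fun_prop

@[fun_prop] theorem prim_evalZ {n : α → ℕ} {t : α → TEC} {w : α → List ℕ} (hn : Primrec n)
    (ht : Primrec t) (hw : Primrec w) : Primrec fun a => evalZ (n a) (t a) (w a) := by
  unfold evalZ
  fun_prop

end

/-! ### Correctness of the evaluation with integers -/

theorem add_val (c : ArithC) (a b : ℤ) :
    (toArith c).add (val c a) (val c b) = val c (addZ c a b) := by
  rw [Arith.add, addZ, ← repr_div _ _ (unitDen_pos c)]
  congr 2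
  simp only [val]
  push_cast
  ring

theorem sub_val (c : ArithC) (a b : ℤ) :
    (toArith c).sub (val c a) (val c b) = val c (subZ c a b) := by
  rw [Arith.sub, subZ, ← repr_div _ _ (unitDen_pos c)]
  congr 2
  simp only [val]
  push_cast
  ring

theorem mul_val (c : ArithC) (a b : ℤ) :
    (toArith c).mul (val c a) (val c b) = val c (mulZ c a b) := by
  rw [Arith.mul, mulZ, ← repr_div _ _ (Nat.mul_pos (unitDen_pos c) (unitDen_pos c))]
  congr 2
  simp only [val]
  push_cast
  ring

theorem div_val (c : ArithC) (a b : ℤ) :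
    (toArith c).div (val c a) (val c b) = val c (divZ c a b) := by
  rw [Arith.div, divZ]
  by_cases hb : b = 0
  · simp only [hb, decide_true, cond_true, val_zero, div_zero]
    rw [← repr_div _ _ one_pos]
    simp
  · have h : 0 < b.natAbs := Int.natAbs_pos.2 hb
    simp only [hb, decide_false, cond_false]
    rw [← repr_div _ _ (Nat.mul_pos h h)]
    congr 2
    have h1 : ((b.natAbs * b.natAbs : ℕ) : ℚ) = b * b := by
      have : ((b.natAbs * b.natAbs : ℕ) : ℤ) = b * b := by
        push_cast; exact abs_mul_abs_self b
      rw [← Int.cast_natCast, this, Int.cast_mul]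
    have h2 : (b : ℚ) ≠ 0 := by exact_mod_cast hb
    have h3 : (unitNum c : ℚ) ≠ 0 := by exact_mod_cast (unitNum_pos c).ne'
    have h4 : (unitDen c : ℚ) ≠ 0 := by exact_mod_cast (unitDen_pos c).ne'
    rw [h1]
    simp only [val]
    push_cast
    field_simp

theorem repr_int (c : ArithC) (i : ℤ) : (toArith c).repr (i : ℝ) = val c (reprZ c i 1) := by
  rw [← repr_div _ _ one_pos]
  simp

theorem sum_val (c : ArithC) (l : List ℤ) :
    (toArith c).sum (l.map (val c)) = val c (sumZ c l) := by
  have : ∀ a, (l.map (val c)).foldl (toArith c).add (val c a) =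
      val c (l.foldl (fun a b => addZ c a b) a) := by
    induction l with
    | nil => simp
    | cons x l ih => intro a; simp only [List.map_cons, List.foldl_cons, add_val, ih]
  rw [Arith.sum, sumZ, ← this, val_zero]

theorem dot_val (c : ArithC) (x y : List ℤ) :
    (toArith c).dot (x.map (val c)) (y.map (val c)) = val c (dotZ c x y) := by
  rw [Arith.dot, dotZ, ← sum_val]
  congr 1
  simp only [List.zipWith_map, List.map_zipWith, mul_val]

theorem getD_val (c : ArithC) (v : List ℤ) (i : ℕ) :
    (v.map (val c)).getD i 0 = val c (v.getD i 0) := by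
  rw [← val_zero c, List.getD_map]

theorem headD_val (c : ArithC) (v : List ℤ) :
    (v.map (val c)).headD 0 = val c (v.headD 0) := by
  cases v <;> simp

/-- The fraction is a number of the arithmetic. -/
def RatOK (c : ArithC) (q : RatC) : Prop := val c (reprZ c q.1 q.2) = toRat q

/-- The constants of the program are numbers of the arithmetic. -/
def ProgOK (c : ArithC) (p : ProgC) : Prop := ∀ g ∈ p.1, g.1 = 0 → RatOK c g.2.1

def HeadOK (c : ArithC) (h : HeadC) : Prop :=
  ProgOK c h.1 ∧ ∀ row ∈ h.2.2, ∀ q ∈ row, RatOK c q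

def LayerOK (c : ArithC) (l : LayerC) : Prop := (∀ h ∈ l.1, HeadOK c h) ∧ ProgOK c l.2

def TEOK (t : TEC) : Prop :=
  (∀ p ∈ t.2.1, ProgOK t.1 p) ∧ (∀ l ∈ t.2.2.1, LayerOK t.1 l) ∧ ProgOK t.1 t.2.2.2

theorem gate_eval {c : ArithC} {g : GateC} (h : g.1 = 0 → RatOK c g.2.1) (v : List ℤ) :
    (toGate g).eval (toArith c) (v.map (val c)) = val c (gateZ c v g) := by
  obtain ⟨k, q, i, j, k1, k2⟩ := g
  unfold toGate gateZ
  match k with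
  | 0 => simpa [Gate.eval] using (h rfl).symm
  | 1 => simp [Gate.eval, -List.getD_eq_getElem?_getD, getD_val, add_val]
  | 2 => simp [Gate.eval, -List.getD_eq_getElem?_getD, getD_val, sub_val]
  | 3 => simp [Gate.eval, -List.getD_eq_getElem?_getD, getD_val, mul_val]
  | 4 => simp [Gate.eval, -List.getD_eq_getElem?_getD, getD_val, div_val]
  | k + 5 =>
    simp only [Gate.eval, getD_val, val_le, Nat.add_eq_zero_iff, OfNat.ofNat_ne_zero, and_false,
      decide_false, cond_false, show k + 5 ≠ 1 by omega, show k + 5 ≠ 2 by omega,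
      show k + 5 ≠ 3 by omega, show k + 5 ≠ 4 by omega]
    by_cases hle : v.getD i 0 ≤ v.getD j 0
    · simp only [if_pos hle, decide_eq_true hle, cond_true]
    · simp only [if_neg hle, decide_eq_false hle, cond_false]

theorem prog_eval {c : ArithC} {p : ProgC} (h : ProgOK c p) (x : List ℤ) :
    (toProg p).eval (toArith c) (x.map (val c)) = (progZ c p x).map (val c) := by
  obtain ⟨gs, outs⟩ := p
  have key : ∀ x : List ℤ, (gs.map toGate).foldl (fun v g => v ++ [g.eval (toArith c) v])
      (x.map (val c)) = (gs.foldl (fun v g => v ++ [gateZ c v g]) x).map (val c) := by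
    unfold ProgOK at h
    induction gs with
    | nil => simp
    | cons g gs ih =>
      intro x
      simp only [List.map_cons, List.foldl_cons]
      rw [gate_eval (h g (by simp)), ← List.map_singleton, ← List.map_append, ih]
      intro g' hg'
      exact h g' (by simp only [List.mem_cons]; exact Or.inr hg')
  simp only [Prog.eval, toProg, progZ, List.map_map, key]
  apply List.map_congr_left
  intro i _
  simp only [Function.comp_apply, getD_val]

/-- The integers represent numbers of the arithmetic. -/
def Bdd (c : ArithC) (v : List ℤ) : Prop := ∀ k ∈ v, |k| ≤ maxZ c

theorem abs_reprZ_le (c : ArithC) (x : ℤ) (d : ℕ) : |reprZ c x d| ≤ maxZ c :=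
  abs_finish_le _ _ _

theorem Bdd.getD {c : ArithC} {v : List ℤ} (h : Bdd c v) (i : ℕ) : |v.getD i 0| ≤ maxZ c := by
  rw [List.getD_eq_getElem?_getD]
  rcases hv : v[i]? with _ | k
  · simp
  · exact h k (List.mem_of_getElem? hv)

theorem Bdd.headD {c : ArithC} {v : List ℤ} (h : Bdd c v) : |v.headD 0| ≤ maxZ c := by
  cases v with
  | nil => simp
  | cons a l => exact h a (by simp)

theorem Bdd.append {c : ArithC} {v w : List ℤ} (hv : Bdd c v) (hw : Bdd c w) :
    Bdd c (v ++ w) := by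
  intro k hk
  rcases List.mem_append.1 hk with h | h
  · exact hv k h
  · exact hw k h

theorem abs_divZ_le (c : ArithC) (a b : ℤ) : |divZ c a b| ≤ maxZ c := by
  unfold divZ
  cases decide (b = 0) <;> exact abs_reprZ_le _ _ _

theorem abs_gateZ_le {c : ArithC} {v : List ℤ} (h : Bdd c v) (g : GateC) :
    |gateZ c v g| ≤ maxZ c := by
  have key : ∀ {b : Bool} {x y : ℤ}, |x| ≤ maxZ c → |y| ≤ maxZ c →
      |bif b then x else y| ≤ maxZ c := by
    intro b x y hx hy
    cases b
    · exact hy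
    · exact hx
  exact key (abs_reprZ_le _ _ _) (key (abs_reprZ_le _ _ _) (key (abs_reprZ_le _ _ _)
    (key (abs_reprZ_le _ _ _) (key (abs_divZ_le _ _ _) (key (h.getD _) (h.getD _))))))

theorem progZ_bdd {c : ArithC} {x : List ℤ} (h : Bdd c x) (p : ProgC) : Bdd c (progZ c p x) := by
  have key : ∀ (gs : List GateC) (x : List ℤ), Bdd c x →
      Bdd c (gs.foldl (fun v g => v ++ [gateZ c v g]) x) := by
    intro gs
    induction gs with
    | nil => intro x h; exact h
    | cons g gs ih =>
      intro x h
      rw [List.foldl_cons]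
      apply ih
      apply h.append
      intro k hk
      rw [List.mem_singleton.1 hk]
      exact abs_gateZ_le h g
  intro k hk
  simp only [progZ, List.mem_map] at hk
  obtain ⟨i, -, rfl⟩ := hk
  exact (key _ x h).getD i

theorem abs_sumZ_le (c : ArithC) (l : List ℤ) : |sumZ c l| ≤ maxZ c := by
  rcases List.eq_nil_or_concat l with rfl | ⟨l, a, rfl⟩
  · simp [sumZ]
  · simp only [sumZ, List.concat_eq_append, List.foldl_append, List.foldl_cons, List.foldl_nil]
    exact abs_reprZ_le _ _ _

theorem poolZ_bdd (c : ArithC) (n : ℕ) (h : HeadC) (x : List ℤ) (X : List (List ℤ)) :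
    Bdd c (poolZ c n h x X) := by
  intro k hk
  simp only [poolZ, List.mem_map] at hk
  obtain ⟨row, -, rfl⟩ := hk
  exact abs_sumZ_le _ _

theorem layerZ_bdd (c : ArithC) (n : ℕ) (l : LayerC) {X : List (List ℤ)}
    (h : ∀ x ∈ X, Bdd c x) : ∀ x ∈ layerZ c n l X, Bdd c x := by
  intro y hy
  simp only [layerZ, List.mem_map] at hy
  obtain ⟨x, hx, rfl⟩ := hy
  apply progZ_bdd
  apply (h x hx).append
  intro k hk
  obtain ⟨hd, -, hk⟩ := List.mem_flatMap.1 hk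
  exact poolZ_bdd _ _ _ _ _ k hk

theorem embedZ_bdd (c : ArithC) (emb : List ProgC) (a i : ℕ) : Bdd c (embedZ c emb a i) := by
  apply progZ_bdd
  intro k hk
  rw [List.mem_singleton.1 hk]
  exact abs_reprZ_le _ _ _

theorem embedWordZ_bdd (c : ArithC) (emb : List ProgC) (w : List ℕ) :
    ∀ x ∈ embedWordZ c emb w, Bdd c x := by
  intro x hx
  simp only [embedWordZ, List.mem_map] at hx
  obtain ⟨i, -, rfl⟩ := hx
  exact embedZ_bdd _ _ _ _

/-- The precision `n` suffices for all numbers of the arithmetic. -/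
def Precise (c : ArithC) (n : ℕ) : Prop := ∀ k : ℤ, |k| ≤ maxZ c → expOK c n k = true

theorem numerators_eval {c : ArithC} {n : ℕ} (hn : Precise c n) (ν : Bool) {s : List ℤ}
    (hs : Bdd c s) :
    (bif ν then Norm.hardmax else Norm.softmax).numerators (toArith c) (s.map (val c)) =
      (numeratorsZ c n ν s).map (val c) := by
  cases ν
  · simp only [cond_false, Norm.numerators, numeratorsZ, List.map_map]
    apply List.map_congr_left
    intro k hk
    exact expZ_eq (hn k (hs k hk))
  · simp only [cond_true, Norm.numerators, numeratorsZ, List.map_map]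
    apply List.map_congr_left
    intro k hk
    have h1 : (toArith c).repr 1 = val c (reprZ c 1 1) := by
      have := repr_int c 1
      simpa using this
    simp only [Function.comp_apply, List.forall_mem_map, val_le, h1]
    by_cases h : ∀ b ∈ s, b ≤ k
    · have h2 : (s.all fun b => decide (b ≤ k)) = true := by simpa using h
      rw [if_pos h, h2, cond_true]
    · have h2 : (s.all fun b => decide (b ≤ k)) = false := by
        rw [Bool.eq_false_iff]; simpa using h
      rw [if_neg h, h2, cond_false, val_zero]

theorem score_eval {c : ArithC} {h : HeadC} (hh : HeadOK c h) (x y : List ℤ) :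
    (toHead h).scoreOf (toArith c) (x.map (val c)) (y.map (val c)) = val c (scoreZ c h x y) := by
  simp only [Head.scoreOf, toHead, scoreZ]
  rw [← List.map_append, prog_eval hh.1, headD_val]

theorem headNumZ_eval {c : ArithC} {n : ℕ} (hn : Precise c n) {h : HeadC} (hh : HeadOK c h)
    {x : List ℤ} (hx : Bdd c x) {X : List (List ℤ)} (hX : ∀ y ∈ X, Bdd c y) :
    (toHead h).norm.numerators (toArith c) ((X.map (List.map (val c))).map
      ((toHead h).scoreOf (toArith c) (x.map (val c)))) = (headNumZ c n h x X).map (val c) := by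
  have h1 : (X.map (List.map (val c))).map ((toHead h).scoreOf (toArith c) (x.map (val c))) =
      (X.map (fun y => scoreZ c h x y)).map (val c) := by
    rw [List.map_map, List.map_map]
    apply List.map_congr_left
    intro y _
    exact score_eval hh x y
  rw [h1, headNumZ, ← numerators_eval hn]
  · rfl
  · intro k hk
    obtain ⟨y, hy, rfl⟩ := List.mem_map.1 hk
    exact (progZ_bdd (hx.append (hX y hy)) _).headD

theorem pool_eval {c : ArithC} {n : ℕ} (hn : Precise c n) {h : HeadC} (hh : HeadOK c h)
    {x : List ℤ} (hx : Bdd c x) {X : List (List ℤ)} (hX : ∀ y ∈ X, Bdd c y) :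
    (toHead h).pool (toArith c) (x.map (val c)) (X.map (List.map (val c))) =
      (poolZ c n h x X).map (val c) := by
  simp only [Head.pool, Norm.eval]
  rw [headNumZ_eval hn hh hx hX, sum_val]
  simp only [poolZ, toHead, List.map_map]
  apply List.map_congr_left
  intro row hrow
  simp only [Function.comp_apply]
  refine Eq.trans ?_ (sum_val c _)
  congr 1
  have h2 : row.map toRat = (row.map (fun q => reprZ c q.1 q.2)).map (val c) := by
    rw [List.map_map]
    apply List.map_congr_left
    intro q hq
    exact (hh.2 row hrow q hq).symm
  rw [h2, List.zipWith_map, List.map_zipWith]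
  simp only [dot_val, Function.comp_apply, div_val, mul_val, termZ]

theorem layer_eval {c : ArithC} {n : ℕ} (hn : Precise c n) {l : LayerC} (hl : LayerOK c l)
    {X : List (List ℤ)} (hX : ∀ y ∈ X, Bdd c y) :
    (toLayer l).eval (toArith c) (X.map (List.map (val c))) =
      (layerZ c n l X).map (List.map (val c)) := by
  simp only [Layer.eval, layerZ, toLayer, List.map_map]
  apply List.map_congr_left
  intro x hx
  simp only [Function.comp_apply]
  rw [← prog_eval hl.2, List.map_append]
  congr 2
  rw [List.flatMap_map, List.map_flatMap]
  apply List.flatMap_congr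
  intro h hh
  exact pool_eval hn (hl.1 h hh) (hX x hx) hX

theorem layers_eval {c : ArithC} {n : ℕ} (hn : Precise c n) {ls : List LayerC}
    (hl : ∀ l ∈ ls, LayerOK c l) {X : List (List ℤ)} (hX : ∀ y ∈ X, Bdd c y) :
    (ls.map toLayer).foldl (fun X l => l.eval (toArith c) X) (X.map (List.map (val c))) =
      (layersZ c n ls X).map (List.map (val c)) := by
  unfold layersZ
  induction ls generalizing X with
  | nil => simp
  | cons l ls ih =>
    simp only [List.map_cons, List.foldl_cons]
    rw [layer_eval hn (hl l (by simp)) hX]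
    exact ih (fun l' hl' => hl l' (by simp [hl'])) (layerZ_bdd c n l hX)

theorem embedWord_eval {t : TEC} (ht : TEOK t) (w : List (toTE t).Alphabet) :
    (toTE t).embedWord w =
      (embedWordZ t.1 t.2.1 (w.map Fin.val)).map (List.map (val t.1)) := by
  apply List.ext_getElem
  · simp [TE.embedWord, embedWordZ]
  · intro i h1 h2
    have hi : i < w.length := by simpa [TE.embedWord] using h1
    simp only [TE.embedWord, embedWordZ, List.getElem_mapIdx, List.getElem_map,
      List.getElem_range, embedZ, TE.embed]
    have ha : (w[i] : ℕ) < t.2.1.length := by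
      have := (w[i]).2
      simpa [toTE] using this
    have h3 : (w.map Fin.val).getD i 0 = (w[i] : ℕ) := by
      simp [List.getD_eq_getElem?_getD, hi]
    have h4 : t.2.1.getD (w[i] : ℕ) ([], []) = t.2.1[(w[i] : ℕ)] := by
      simp [List.getD_eq_getElem?_getD, ha]
    have h5 : (toTE t).emb.get w[i] = toProg t.2.1[(w[i] : ℕ)] := by
      simp [toTE]
    rw [h3, h4, h5, ← prog_eval (ht.1 _ (List.getElem_mem ha))]
    have := repr_int t.1 ((i + 1 : ℕ) : ℤ)
    rw [List.map_singleton, ← this]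
    rfl

theorem eval_toTE {t : TEC} (ht : TEOK t) {n : ℕ} (hn : Precise t.1 n)
    (w : List (toTE t).Alphabet) :
    (toTE t).eval w = val t.1 (evalZ n t (w.map Fin.val)) := by
  simp only [TE.eval]
  rw [embedWord_eval ht]
  have h1 := layers_eval hn ht.2.1 (embedWordZ_bdd t.1 t.2.1 (w.map Fin.val))
  have h2 : (toTE t).layers.foldl (fun X l => l.eval (toTE t).arith X)
      ((embedWordZ t.1 t.2.1 (w.map Fin.val)).map (List.map (val t.1))) = _ := h1
  rw [h2]
  have h3 : ((layersZ t.1 n t.2.2.1 (embedWordZ t.1 t.2.1 (w.map Fin.val))).map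
      (List.map (val t.1))).getLastD [] =
      ((layersZ t.1 n t.2.2.1 (embedWordZ t.1 t.2.1 (w.map Fin.val))).getLastD []).map
        (val t.1) := by
    rw [List.getLastD_eq_getLast?, List.getLastD_eq_getLast?, List.getLast?_map]
    cases List.getLast? _ <;> simp
  rw [h3]
  have h4 := prog_eval ht.2.2 ((layersZ t.1 n t.2.2.1
    (embedWordZ t.1 t.2.1 (w.map Fin.val))).getLastD [])
  have h5 : (toTE t).out.eval (toTE t).arith _ = _ := h4
  rw [h5, headD_val]
  rfl

/-! ### Positions are ultimately periodic -/

theorem le_roundZ (r : Bool × Bool) {x : ℤ} (hx : 0 ≤ x) {d : ℕ} (hd : 0 < d) :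
    x / (d : ℤ) ≤ roundZ r x d := by
  have hd' : (0 : ℤ) < d := by exact_mod_cast hd
  have h1 : x / (d : ℤ) ≤ -((-x) / (d : ℤ)) := by
    have h2 := Int.ediv_mul_le (-x) hd'.ne'
    have h3 := Int.ediv_mul_le x hd'.ne'
    have h4 : (x / d + (-x) / d) * (d : ℤ) ≤ 0 := by linarith
    have h5 : x / d + (-x) / d ≤ 0 := nonpos_of_mul_nonpos_left h4 hd'
    linarith
  obtain ⟨_ | _, _ | _⟩ := r
  · simp [roundZ]
  · simpa [roundZ] using h1
  · simp [roundZ, hx]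
  · simp only [roundZ, cond_true]
    rw [Int.le_ediv_iff_mul_le (by push_cast; linarith)]
    have h3 := Int.ediv_mul_le x hd'.ne'
    push_cast
    linarith

theorem roundZ_one (r : Bool × Bool) (x : ℤ) : roundZ r x 1 = x := by
  obtain ⟨_ | _, _ | _⟩ := r
  · simp [roundZ]
  · simp [roundZ]
  · simp [roundZ]
  · simp only [roundZ, cond_true]
    push_cast
    omega

/-- Large positions are represented periodically: if overflow saturates, then their representation
is constant, and wrap-around has a period that divides `2 * maxZ c`. -/
theorem reprZ_shift (c : ArithC) {i : ℕ} (hi : 8 * maxZ c ≤ i) :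
    reprZ c ((i + 2 * maxZ c : ℕ) : ℤ) 1 = reprZ c (i : ℤ) 1 := by
  have hM := maxZ_pos c
  obtain ⟨b, e, m, o, r⟩ := c
  cases b
  · have hs : ∀ x : ℤ, sigZ (false, e, m, o, r) x 1 = x * 2 ^ m := by
      intro x
      simp [sigZ, unitDen, unitNum, binadeZ, roundZ_one]
    have hp : (1 : ℤ) ≤ 2 ^ m := one_le_pow₀ (by norm_num)
    simp only [reprZ, hs]
    set M := maxZ (false, e, m, o, r) with hMdef
    cases o
    · have h : ∀ k : ℤ, (M : ℤ) ≤ k → finish (false, e, m, false, r) 0 k = M - 1 := by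
        intro k hk
        simp only [finish, cond_false, ← hMdef]
        omega
      have h1 : (M : ℤ) ≤ i * 2 ^ m := by nlinarith
      have h2 : (M : ℤ) ≤ ((i + 2 * M : ℕ) : ℤ) * 2 ^ m := by push_cast; nlinarith
      simp only [binadeZ, cond_false]
      rw [h _ h1, h _ h2]
    · simp only [finish, cond_false, cond_true, ← hMdef, wrapZ_eq]
      have : ((i + 2 * M : ℕ) : ℤ) * 2 ^ m = i * 2 ^ m + ((2 * M : ℕ) : ℤ) * 2 ^ m := by
        push_cast; ring
      rw [this, Int.add_mul_bmod_self_left]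
  · set M := maxZ (true, e, m, o, r) with hMdef
    have h : ∀ j : ℕ, 8 * M ≤ j → reprZ (true, e, m, o, r) (j : ℤ) 1 = M := by
      intro j hj
      have hlarge : (M : ℤ) ≤ sigZ (true, e, m, o, r) (j : ℤ) 1 *
          ((2 ^ binadeZ (true, e, m, o, r) (j : ℤ) 1 : ℕ) : ℤ) := by
        set q := binadeZ (true, e, m, o, r) (j : ℤ) 1 with hq
        have hq' : q = Nat.log 2 (j * 2 ^ (2 ^ e) / 4) := by simp [hq, binadeZ]
        have h2e : 2 ≤ 2 ^ (2 ^ e) := by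
          calc 2 = 2 ^ 1 := rfl
            _ ≤ 2 ^ (2 ^ e) := Nat.pow_le_pow_right (by norm_num) Nat.one_le_two_pow
        have hy : 1 ≤ j * 2 ^ (2 ^ e) / 4 := by
          rw [Nat.le_div_iff_mul_le (by norm_num)]; nlinarith
        have hpow : 2 ^ q ≤ j * 2 ^ (2 ^ e) / 4 := by
          rw [hq']; exact Nat.pow_log_le_self 2 (by omega)
        have hpow4 : 4 * 2 ^ q ≤ j * 2 ^ (2 ^ e) := by omega
        set Y := j * 2 ^ (2 ^ e + m) with hY
        have hm1 : 1 ≤ 2 ^ m := Nat.one_le_two_pow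
        have hYge : j * 2 ^ (2 ^ e) ≤ Y := by
          rw [hY, pow_add, ← mul_assoc]; exact Nat.le_mul_of_pos_right _ hm1
        have hsig : ((Y / (4 * 2 ^ q) : ℕ) : ℤ) ≤ sigZ (true, e, m, o, r) (j : ℤ) 1 := by
          have h5 : sigZ (true, e, m, o, r) (j : ℤ) 1 = roundZ r (Y : ℤ) (4 * 2 ^ q) := by
            simp [sigZ, unitDen, unitNum, ← hq, hY]
          rw [h5]
          have := le_roundZ r (x := (Y : ℤ)) (by positivity) (d := 4 * 2 ^ q) (by positivity)
          exact_mod_cast this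
        have h6 : 1 ≤ Y / (4 * 2 ^ q) := by
          rw [Nat.le_div_iff_mul_le (by positivity)]; omega
        have h7 := Nat.lt_div_mul_add (a := Y) (b := 4 * 2 ^ q) (by positivity)
        have h8 : M ≤ Y / (4 * 2 ^ q) * 2 ^ q := by
          have h9 : 2 * j ≤ j * 2 ^ (2 ^ e) := by nlinarith
          have h10 : 4 * 2 ^ q ≤ Y / (4 * 2 ^ q) * (4 * 2 ^ q) := Nat.le_mul_of_pos_left _ h6
          have h11 : Y / (4 * 2 ^ q) * (4 * 2 ^ q) = 4 * (Y / (4 * 2 ^ q) * 2 ^ q) := by ring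
          omega
        calc (M : ℤ) ≤ ((Y / (4 * 2 ^ q) * 2 ^ q : ℕ) : ℤ) := by exact_mod_cast h8
          _ = ((Y / (4 * 2 ^ q) : ℕ) : ℤ) * ((2 ^ q : ℕ) : ℤ) := by push_cast; ring
          _ ≤ _ := mul_le_mul_of_nonneg_right hsig (by positivity)
      simp only [reprZ, finish, cond_true, ← hMdef]
      omega
    rw [h _ hi, h _ (by omega)]

theorem reprZ_shift_mul (c : ArithC) {i : ℕ} (hi : 8 * maxZ c ≤ i) (s : ℕ) :
    reprZ c ((i + 2 * maxZ c * s : ℕ) : ℤ) 1 = reprZ c (i : ℤ) 1 := by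
  induction s with
  | zero => simp
  | succ s ih =>
    rw [← ih, ← reprZ_shift c (i := i + 2 * maxZ c * s) (by omega)]
    congr 2
    ring

/-! ### Cutting out a part of a word -/

/-- The list without the elements from position `i` to position `j - 1`. -/
def cut {α : Type*} (i j : ℕ) (l : List α) : List α := l.take i ++ l.drop j

theorem cut_map {α β : Type*} (i j : ℕ) (f : α → β) (l : List α) :
    cut i j (l.map f) = (cut i j l).map f := by
  simp [cut, List.map_take, List.map_drop]

theorem cut_zipWith {α β γ : Type*} {i j : ℕ} (f : α → β → γ) {l : List α} {m : List β}
    (h : l.length = m.length) :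
    List.zipWith f (cut i j l) (cut i j m) = cut i j (List.zipWith f l m) := by
  simp only [cut]
  rw [List.zipWith_append (by simp [h]), ← List.take_zipWith, ← List.drop_zipWith]

theorem sumZ_cut (c : ArithC) {i j : ℕ} {l : List ℤ}
    (h : sumZ c (l.take i) = sumZ c (l.take j)) : sumZ c (cut i j l) = sumZ c l := by
  unfold sumZ at h ⊢
  rw [cut, List.foldl_append, h, ← List.foldl_append, List.take_append_drop]

theorem mem_cut {α : Type*} {i j : ℕ} {l : List α}
    (h : ∀ x ∈ l, x ∈ l.take i ↔ x ∈ l.take j) (x : α) : x ∈ cut i j l ↔ x ∈ l := by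
  constructor
  · intro hx
    rcases List.mem_append.1 hx with h | h
    · exact List.mem_of_mem_take h
    · exact List.mem_of_mem_drop h
  · intro hx
    rw [← List.take_append_drop j l] at hx
    rcases List.mem_append.1 hx with h' | h'
    · exact List.mem_append.2 (Or.inl ((h x (List.mem_of_mem_take h')).2 h'))
    · exact List.mem_append.2 (Or.inr h')

/-- The prefixes of lengths `i` and `j` of the sequence `X` have the same influence on the vector
computed from `x` by the layer `l`: `x` occurs in both or in none of them, and all partial sums
agree. -/
def Agree (c : ArithC) (n : ℕ) (l : LayerC) (X : List (List ℤ)) (i j : ℕ) (x : List ℤ) : Prop :=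
  (x ∈ X.take i ↔ x ∈ X.take j) ∧ ∀ h ∈ l.1,
    sumZ c ((headNumZ c n h x X).take i) = sumZ c ((headNumZ c n h x X).take j) ∧
    ∀ row ∈ h.2.2,
      sumZ c ((List.zipWith (fun a y => termZ c row (sumZ c (headNumZ c n h x X)) a y)
        (headNumZ c n h x X) X).take i) =
      sumZ c ((List.zipWith (fun a y => termZ c row (sumZ c (headNumZ c n h x X)) a y)
        (headNumZ c n h x X) X).take j)

theorem headNumZ_length (c : ArithC) (n : ℕ) (h : HeadC) (x : List ℤ) (X : List (List ℤ)) :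
    (headNumZ c n h x X).length = X.length := by
  unfold headNumZ numeratorsZ
  cases h.2.1 <;> simp

theorem headNumZ_cut (c : ArithC) (n : ℕ) (h : HeadC) (x : List ℤ) {X : List (List ℤ)} {i j : ℕ}
    (hX : ∀ y ∈ X, y ∈ X.take i ↔ y ∈ X.take j) :
    headNumZ c n h x (cut i j X) = cut i j (headNumZ c n h x X) := by
  unfold headNumZ numeratorsZ
  cases h.2.1
  · simp only [cond_false, cut_map]
  · simp only [cond_true, ← cut_map]
    congr 1
    apply List.map_congr_left
    intro a _
    congr 1
    rw [Bool.eq_iff_iff, cut_map, List.all_map, List.all_map, List.all_eq_true, List.all_eq_true]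
    simp only [mem_cut hX]

theorem layerZ_cut {c : ArithC} {n : ℕ} {l : LayerC} {X : List (List ℤ)} {i j : ℕ}
    (h : ∀ x ∈ X, Agree c n l X i j x) :
    layerZ c n l (cut i j X) = cut i j (layerZ c n l X) := by
  have hX : ∀ y ∈ X, y ∈ X.take i ↔ y ∈ X.take j := fun y hy => (h y hy).1
  unfold layerZ
  rw [cut_map]
  apply List.map_congr_left
  intro x hx
  rw [mem_cut hX] at hx
  congr 2
  apply List.flatMap_congr
  intro hd hhd
  obtain ⟨h1, h2⟩ := (h x hx).2 hd hhd
  unfold poolZ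
  apply List.map_congr_left
  intro row hrow
  rw [headNumZ_cut c n hd x hX, sumZ_cut c h1, cut_zipWith _ (headNumZ_length c n hd x X)]
  exact sumZ_cut c (h2 row hrow)

/-- The prefixes of lengths `i` and `j` agree in all layers. -/
def AgreeAll (c : ArithC) (n : ℕ) (i j : ℕ) : List LayerC → List (List ℤ) → Prop
  | [], _ => True
  | l :: ls, X => (∀ x ∈ X, Agree c n l X i j x) ∧ AgreeAll c n i j ls (layerZ c n l X)

theorem layersZ_cut {c : ArithC} {n i j : ℕ} {ls : List LayerC} {X : List (List ℤ)}
    (h : AgreeAll c n i j ls X) : layersZ c n ls (cut i j X) = cut i j (layersZ c n ls X) := by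
  induction ls generalizing X with
  | nil => rfl
  | cons l ls ih =>
    simp only [layersZ, List.foldl_cons]
    rw [layerZ_cut h.1]
    exact ih h.2

theorem agreeAll_of_forall {c : ArithC} {n i j : ℕ} {ls : List LayerC} {X : List (List ℤ)}
    (h : ∀ k (hk : k < ls.length), ∀ x ∈ layersZ c n (ls.take k) X,
      Agree c n ls[k] (layersZ c n (ls.take k) X) i j x) : AgreeAll c n i j ls X := by
  induction ls generalizing X with
  | nil => trivial
  | cons l ls ih =>
    refine ⟨fun x hx => h 0 (by simp) x hx, ih fun k hk x hx => ?_⟩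
    exact h (k + 1) (by simpa using hk) x hx

theorem embedWordZ_cut (c : ArithC) (emb : List ProgC) {w : List ℕ} {i s : ℕ}
    (hi : 8 * maxZ c ≤ i) (hj : i + 2 * maxZ c * s ≤ w.length) :
    embedWordZ c emb (cut i (i + 2 * maxZ c * s) w) =
      cut i (i + 2 * maxZ c * s) (embedWordZ c emb w) := by
  set j := i + 2 * maxZ c * s with hjdef
  apply List.ext_getElem
  · simp [embedWordZ, cut]
  · intro k h1 h2
    have hk : k < (cut i j w).length := by simpa [embedWordZ] using h1
    have hlen : (cut i j w).length = i + (w.length - j) := by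
      simp only [cut, List.length_append, List.length_take, List.length_drop]; omega
    rw [hlen] at hk
    simp only [embedWordZ, List.getElem_map, List.getElem_range]
    simp only [cut]
    rcases lt_or_ge k i with hki | hki
    · have hkl : k < (List.take i w).length := by rw [List.length_take]; omega
      rw [List.getElem_append_left (by simp; omega)]
      simp only [List.getElem_take, List.getElem_map, List.getElem_range]
      congr 1
      rw [List.getD_append _ _ _ _ hkl]
      simp [List.getD_eq_getElem?_getD, hki]
    · have h3 : (List.take i w).length ≤ k := by rw [List.length_take]; omega
      rw [List.getElem_append_right (by simp; omega)]
      simp only [List.getElem_drop, List.getElem_map, List.getElem_range, List.length_take,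
        List.length_map, List.length_range]
      have hmin : min i w.length = i := by omega
      have h4 : (List.take i w ++ List.drop j w).getD k 0 = w.getD (j + (k - i)) 0 := by
        rw [List.getD_append_right _ _ _ _ h3, List.getD_eq_getElem?_getD, List.getElem?_drop,
          List.length_take, hmin, List.getD_eq_getElem?_getD]
      rw [h4, hmin]
      unfold embedZ
      have h5 : j + (k - i) + 1 = (k + 1) + 2 * maxZ c * s := by omega
      rw [h5, reprZ_shift_mul c (by omega)]

theorem getLastD_cut {α : Type*} {i j : ℕ} {l : List α} (hj : j < l.length) (d : α) :
    (cut i j l).getLastD d = l.getLastD d := by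
  rw [List.getLastD_eq_getLast?, List.getLastD_eq_getLast?, cut,
    List.getLast?_append_of_ne_nil _ (by simp; omega), List.getLast?_drop,
    if_neg (by omega)]

/-! ### A bound on the length of shortest accepted words -/

/-- Codes of the vectors of length at most `N` with entries of absolute value at most `M`. -/
abbrev VecCode (M N : ℕ) : Type := Fin (N + 1) × (Fin N → Fin (2 * M + 1))

/-- The vector with a given code: entries are shifted by `M`, and the length is part of the code. -/
def decodeVec {M N : ℕ} (v : VecCode M N) : List ℤ :=
  (List.ofFn fun i => ((v.2 i : ℕ) : ℤ) - M).take v.1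

theorem exists_decodeVec {M N : ℕ} {x : List ℤ} (hx : ∀ k ∈ x, |k| ≤ M) (hN : x.length ≤ N) :
    ∃ v : VecCode M N, decodeVec v = x := by
  have hget : ∀ i : ℕ, |x.getD i 0| ≤ M := by
    intro i
    rw [List.getD_eq_getElem?_getD]
    rcases hv : x[i]? with _ | k
    · simp
    · exact hx k (List.mem_of_getElem? hv)
  refine ⟨(⟨x.length, by omega⟩, fun i => ⟨(x.getD i 0 + M).toNat, ?_⟩), ?_⟩
  · have := abs_le.1 (hget i)
    omega
  · apply List.ext_getElem
    · simp [decodeVec, hN]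
    · intro i h1 h2
      have := abs_le.1 (hget i)
      simp only [decodeVec, List.getElem_take, List.getElem_ofFn]
      rw [Int.toNat_of_nonneg (by omega)]
      simp [List.getD_eq_getElem?_getD, h2]

/-- The information on a prefix of a word that matters for the rest of the computation: the
position modulo the period, which vectors have occurred in each layer, and all partial sums. -/
abbrev PrefixState (M N : ℕ) : Type :=
  Fin (2 * M) × (Fin N × VecCode M N → Bool) ×
    (Fin N × VecCode M N × Fin N × Option (Fin N) → Fin (2 * M + 1))

/-- The number of elements of `PrefixState (maxZ c) N`, plus the length of the initial part of a
word where positions are not yet periodic. -/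
def wordBound (c : ArithC) (N : ℕ) : ℕ :=
  8 * maxZ c + 2 * maxZ c * (2 ^ (N * ((N + 1) * (2 * maxZ c + 1) ^ N)) *
    (2 * maxZ c + 1) ^ (N * ((N + 1) * (2 * maxZ c + 1) ^ N * (N * (N + 1))))) + 1

theorem card_prefixState (M N : ℕ) : Fintype.card (PrefixState M N) =
    2 * M * (2 ^ (N * ((N + 1) * (2 * M + 1) ^ N)) *
    (2 * M + 1) ^ (N * ((N + 1) * (2 * M + 1) ^ N * (N * (N + 1))))) := by
  simp [Fintype.card_pi]

/-- Sums over the first `t` elements: of the numerators, or of the terms of the `r`-th row. -/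
def partialSum (c : ArithC) (n : ℕ) (h : HeadC) (x : List ℤ) (X : List (List ℤ)) (t : ℕ) :
    Option ℕ → ℤ
  | none => sumZ c ((headNumZ c n h x X).take t)
  | some r => sumZ c ((List.zipWith
      (fun a y => termZ c (h.2.2.getD r []) (sumZ c (headNumZ c n h x X)) a y)
      (headNumZ c n h x X) X).take t)

theorem abs_partialSum_le (c : ArithC) (n : ℕ) (h : HeadC) (x : List ℤ) (X : List (List ℤ))
    (t : ℕ) (r : Option ℕ) : |partialSum c n h x X t r| ≤ maxZ c := by
  cases r <;> exact abs_sumZ_le _ _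

open Classical in
/-- The state of the prefix of length `t` of a word whose embedding is `X`. -/
noncomputable def prefixState (c : ArithC) (n N : ℕ) (ls : List LayerC) (X : List (List ℤ))
    (t : ℕ) : PrefixState (maxZ c) N :=
  (⟨t % (2 * maxZ c), Nat.mod_lt _ (by have := maxZ_pos c; omega)⟩,
   fun p => decide (decodeVec p.2 ∈ (layersZ c n (ls.take p.1) X).take t),
   fun p => Fin.ofNat _ (partialSum c n
      ((ls.getD p.1 ([], ([], []))).1.getD p.2.2.1 (([], []), false, []))
      (decodeVec p.2.1) (layersZ c n (ls.take p.1) X) t (p.2.2.2.map Fin.val) +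
      (maxZ c : ℤ)).toNat)

/-- The numbers of layers, heads, rows and coordinates are at most `N`. -/
def SizeLE (N : ℕ) (t : TEC) : Prop :=
  t.2.2.1.length ≤ N ∧ (∀ p ∈ t.2.1, p.2.length ≤ N) ∧
    ∀ l ∈ t.2.2.1, l.2.2.length ≤ N ∧ l.1.length ≤ N ∧ ∀ h ∈ l.1, h.2.2.length ≤ N

theorem ofNat_inj_of_abs_le {M : ℕ} {a b : ℤ} (ha : |a| ≤ M) (hb : |b| ≤ M)
    (h : Fin.ofNat (2 * M + 1) (a + M).toNat = Fin.ofNat (2 * M + 1) (b + M).toNat) : a = b := by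
  have ha := abs_le.1 ha
  have hb := abs_le.1 hb
  have h1 := congrArg Fin.val h
  simp only [Fin.ofNat_eq_cast, Fin.val_natCast] at h1
  rw [Nat.mod_eq_of_lt (by omega), Nat.mod_eq_of_lt (by omega)] at h1
  omega

theorem layersZ_props {c : ArithC} {n N : ℕ} {ls : List LayerC} {X : List (List ℤ)}
    (hl : ∀ l ∈ ls, l.2.2.length ≤ N) (hX : ∀ x ∈ X, Bdd c x ∧ x.length ≤ N) :
    ∀ x ∈ layersZ c n ls X, Bdd c x ∧ x.length ≤ N := by
  induction ls generalizing X with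
  | nil => exact hX
  | cons l ls ih =>
    simp only [layersZ, List.foldl_cons]
    apply ih (fun l' hl' => hl l' (by simp [hl']))
    intro x hx
    refine ⟨layerZ_bdd c n l (fun y hy => (hX y hy).1) x hx, ?_⟩
    simp only [layerZ, List.mem_map] at hx
    obtain ⟨y, -, rfl⟩ := hx
    simpa [progZ] using hl l (by simp)

theorem agree_of_prefixState_eq {c : ArithC} {n N : ℕ} {ls : List LayerC} {X : List (List ℤ)}
    (hlen : ls.length ≤ N)
    (hl : ∀ l ∈ ls, l.2.2.length ≤ N ∧ l.1.length ≤ N ∧ ∀ h ∈ l.1, h.2.2.length ≤ N)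
    (hX : ∀ x ∈ X, Bdd c x ∧ x.length ≤ N) {i j : ℕ}
    (h : prefixState c n N ls X i = prefixState c n N ls X j) : AgreeAll c n i j ls X := by
  apply agreeAll_of_forall
  intro k hk x hx
  obtain ⟨hb, hxN⟩ := layersZ_props (n := n)
    (fun l hl' => (hl l (List.mem_of_mem_take hl')).1) hX x hx
  obtain ⟨v, rfl⟩ := exists_decodeVec hb hxN
  have hseen := congrFun (congrArg (fun s => s.2.1) h) (⟨k, by omega⟩, v)
  have hsum := fun hd r => congrFun (congrArg (fun s => s.2.2) h) (⟨k, by omega⟩, v, hd, r)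
  have hlk : ls.getD k ([], ([], [])) = ls[k] := by simp [List.getD_eq_getElem?_getD, hk]
  simp only [prefixState, decide_eq_decide] at hseen
  refine ⟨hseen, ?_⟩
  intro hd hhd
  obtain ⟨a, ha, rfl⟩ := List.getElem_of_mem hhd
  obtain ⟨-, hh1, hh2⟩ := hl _ (List.getElem_mem hk)
  have hga : ls[k].1.getD a (([], []), false, []) = ls[k].1[a] := by
    simp [List.getD_eq_getElem?_getD, ha]
  constructor
  · have h1 := ofNat_inj_of_abs_le (abs_partialSum_le _ _ _ _ _ _ _)
      (abs_partialSum_le _ _ _ _ _ _ _) (hsum ⟨a, by omega⟩ none)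
    simpa only [hlk, hga, partialSum, Option.map_none] using h1
  · intro row hrow
    obtain ⟨b, hb', rfl⟩ := List.getElem_of_mem hrow
    have hrows := hh2 _ (List.getElem_mem ha)
    have hgb : ls[k].1[a].2.2.getD b [] = ls[k].1[a].2.2[b] := by
      simp [List.getD_eq_getElem?_getD, hb']
    have h1 := ofNat_inj_of_abs_le (abs_partialSum_le _ _ _ _ _ _ _)
      (abs_partialSum_le _ _ _ _ _ _ _) (hsum ⟨a, by omega⟩ (some ⟨b, by omega⟩))
    simpa only [hlk, hga, hgb, partialSum, Option.map_some] using h1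

/-- A long word can be shortened without changing the value of the encoder: two of its prefixes
have the same state, and the part between them is cut out. -/
theorem exists_shorter {n N : ℕ} {t : TEC} (ht : SizeLE N t) {w : List ℕ}
    (hw : wordBound t.1 N < w.length) :
    ∃ w' : List ℕ, w' ≠ [] ∧ w'.length < w.length ∧ (∀ a ∈ w', a ∈ w) ∧
      evalZ n t w' = evalZ n t w := by
  set c := t.1
  have hM := maxZ_pos c
  set X := embedWordZ c t.2.1 w with hXdef
  have hX : ∀ x ∈ X, Bdd c x ∧ x.length ≤ N := by
    intro x hx
    refine ⟨embedWordZ_bdd _ _ _ x hx, ?_⟩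
    simp only [hXdef, embedWordZ, List.mem_map] at hx
    obtain ⟨i, -, rfl⟩ := hx
    simp only [embedZ, progZ, List.length_map]
    rw [List.getD_eq_getElem?_getD]
    rcases hv : t.2.1[w.getD i 0]? with _ | p
    · simp
    · exact ht.2.1 p (List.mem_of_getElem? hv)
  set K := Fintype.card (PrefixState (maxZ c) N) with hK
  have hbound : wordBound c N = 8 * maxZ c + K + 1 := by
    rw [hK, card_prefixState, wordBound]
  obtain ⟨a, b, hab, heq⟩ := Fintype.exists_ne_map_eq_of_card_lt
    (fun s : Fin (K + 1) => prefixState c n N t.2.2.1 X (8 * maxZ c + s)) (by simp [hK])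
  wlog hlt : a < b generalizing a b
  · exact this b a hab.symm heq.symm (lt_of_le_of_ne (not_lt.1 hlt) hab.symm)
  have hab' : (a : ℕ) < b := hlt
  have hmod : (8 * maxZ c + a) % (2 * maxZ c) = (8 * maxZ c + b) % (2 * maxZ c) := by
    have := congrArg Fin.val (congrArg Prod.fst heq)
    simpa only [prefixState] using this
  obtain ⟨s, hs⟩ := (Nat.modEq_iff_dvd' (by omega)).1 hmod
  have hj : 8 * maxZ c + b = 8 * maxZ c + a + 2 * maxZ c * s := by omega
  have hb := b.2
  set i := 8 * maxZ c + (a : ℕ) with hi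
  have hagree := agree_of_prefixState_eq ht.1 ht.2.2 hX heq
  rw [hj] at hagree
  have hlt' : i + 2 * maxZ c * s < w.length := by omega
  refine ⟨cut i (i + 2 * maxZ c * s) w, ?_, ?_, ?_, ?_⟩
  · intro h
    have := congrArg List.length h
    simp only [cut, List.length_append, List.length_take, List.length_drop, List.length_nil]
      at this
    omega
  · simp only [cut, List.length_append, List.length_take, List.length_drop]
    omega
  · intro x hx
    rcases List.mem_append.1 hx with h | h
    · exact List.mem_of_mem_take h
    · exact List.mem_of_mem_drop h
  · unfold evalZ
    rw [embedWordZ_cut c t.2.1 (by omega) hlt'.le, layersZ_cut hagree, getLastD_cut]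
    have : ∀ (ls : List LayerC) (X : List (List ℤ)), (layersZ c n ls X).length = X.length := by
      intro ls
      induction ls with
      | nil => intro X; rfl
      | cons l ls ih =>
        intro X
        have := ih (layerZ c n l X)
        simpa [layersZ, layerZ] using this
    rw [this, hXdef]
    simpa [embedWordZ] using hlt'

/-- The value on a word is also the value on a word of bounded length over the same symbols. -/
theorem exists_short {n N : ℕ} {t : TEC} (ht : SizeLE N t) {w : List ℕ} (hw : w ≠ []) :
    ∃ w' : List ℕ, w' ≠ [] ∧ w'.length ≤ wordBound t.1 N ∧ (∀ a ∈ w', a ∈ w) ∧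
      evalZ n t w' = evalZ n t w := by
  induction hlen : w.length using Nat.strong_induction_on generalizing w with
  | _ m ih =>
    rcases le_or_gt w.length (wordBound t.1 N) with h | h
    · exact ⟨w, hw, h, fun a ha => ha, rfl⟩
    · obtain ⟨w1, h1, h2, h3, h4⟩ := exists_shorter (n := n) ht h
      obtain ⟨w2, h5, h6, h7, h8⟩ := ih w1.length (by omega) h1 rfl
      exact ⟨w2, h5, h6, fun a ha => h3 a (h7 a ha), h8.trans h4⟩

@[fun_prop] theorem prim_wordBound {α : Type*} [Primcodable α] {c : α → ArithC} {n : α → ℕ}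
    (hc : Primrec c) (hn : Primrec n) : Primrec fun a => wordBound (c a) (n a) := by
  unfold wordBound
  fun_prop

/-! ### Codes as bit strings -/

def encListC {α : Type} (e : α → List Bool) (l : List α) : List Bool :=
  l.flatMap (fun a => true :: e a) ++ [false]

theorem encList_eq {α β : Type} {e : α → List Bool} {e' : β → List Bool} {f : β → α} {l : List β}
    (h : ∀ b ∈ l, e (f b) = e' b) : encList e (l.map f) = encListC e' l := by
  induction l with
  | nil => rfl
  | cons b l ih =>
    rw [List.map_cons, encList, ih (fun b' hb' => h b' (by simp [hb'])), h b (by simp)]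
    simp [encListC]

def encNatC (n : ℕ) : List Bool :=
  encListC (fun b => [b]) ((List.range (bif decide (n = 0) then 0 else Nat.log 2 n + 1)).map
    (fun i => decide (n / 2 ^ i % 2 = 1)))

theorem bits_eq (n : ℕ) : n.bits = (List.range (bif decide (n = 0) then 0 else Nat.log 2 n + 1)).map
    (fun i => decide (n / 2 ^ i % 2 = 1)) := by
  have hlen : n.bits.length = bif decide (n = 0) then 0 else Nat.log 2 n + 1 := by
    rw [Nat.size_eq_bits_len]
    rcases Nat.eq_zero_or_pos n with rfl | hn
    · simp
    · simp only [hn.ne', decide_false, cond_false]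
      apply le_antisymm
      · rw [Nat.size_le]; exact Nat.lt_pow_succ_log_self (by norm_num) n
      · have := Nat.pow_log_le_self 2 hn.ne'
        exact Nat.lt_size.2 this
  apply List.ext_getElem
  · simp [hlen]
  · intro i h1 h2
    have h3 := Nat.testBit_eq_inth n i
    rw [List.getI_eq_getElem _ h1] at h3
    rw [← h3]
    simp [Nat.testBit_eq_decide_div_mod_eq]

theorem encNat_eq (n : ℕ) : encNat n = encNatC n := by
  rw [encNat, encNatC, ← bits_eq]
  have := encList_eq (e := fun b : Bool => [b]) (e' := fun b : Bool => [b]) (f := id)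
    (l := n.bits) (fun _ _ => rfl)
  simpa using this

def encUnaryC (n : ℕ) : List Bool := List.replicate n true ++ [false]

def encRatC (q : RatC) : List Bool :=
  (!decide (0 ≤ q.1)) :: (encNatC q.1.natAbs ++ encNatC q.2)

def encGateC (g : GateC) : List Bool :=
  encUnaryC g.1 ++ bif decide (g.1 = 0) then encRatC g.2.1
    else bif decide (g.1 ≤ 4) then encUnaryC g.2.2.1 ++ encUnaryC g.2.2.2.1
    else encUnaryC g.2.2.1 ++ (encUnaryC g.2.2.2.1 ++
      (encUnaryC g.2.2.2.2.1 ++ encUnaryC g.2.2.2.2.2))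

def encProgC (p : ProgC) : List Bool :=
  encListC (fun g => encGateC g) p.1 ++ encListC (fun i => encUnaryC i) p.2

def encHeadC (h : HeadC) : List Bool :=
  encProgC h.1 ++ ([h.2.1] ++ encListC (fun r => encListC (fun q => encRatC q) r) h.2.2)

def encLayerC (l : LayerC) : List Bool := encListC (fun h => encHeadC h) l.1 ++ encProgC l.2

def encArithC (c : ArithC) : List Bool :=
  bif c.1 then true :: (encUnaryC c.2.1 ++ (encUnaryC c.2.2.1 ++ [c.2.2.2.2.1, c.2.2.2.2.2]))
  else false :: (encUnaryC c.2.1 ++ (encUnaryC c.2.2.1 ++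
    ([c.2.2.2.1] ++ [c.2.2.2.2.1, c.2.2.2.2.2])))

/-- The bit string for a code. It is the encoding of the encoder if the code is canonical. -/
def encTEC (t : TEC) : List Bool :=
  encArithC t.1 ++ (encListC (fun p => encProgC p) t.2.1 ++
    (encListC (fun l => encLayerC l) t.2.2.1 ++ encProgC t.2.2.2))

section
variable {α : Type*} [Primcodable α]

@[fun_prop] theorem prim_encListC {β : Type} [Primcodable β] {f : α → List β}
    {e : α → β → List Bool} (hf : Primrec f) (he : Primrec fun p : α × β => e p.1 p.2) :
    Primrec fun a => encListC (e a) (f a) := by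
  unfold encListC
  fun_prop

@[fun_prop] theorem prim_encNatC {f : α → ℕ} (hf : Primrec f) :
    Primrec fun a => encNatC (f a) := by
  unfold encNatC
  fun_prop

@[fun_prop] theorem prim_encUnaryC {f : α → ℕ} (hf : Primrec f) :
    Primrec fun a => encUnaryC (f a) := by
  unfold encUnaryC
  fun_prop

@[fun_prop] theorem prim_encRatC {f : α → RatC} (hf : Primrec f) :
    Primrec fun a => encRatC (f a) := by
  unfold encRatC
  fun_prop

@[fun_prop] theorem prim_encGateC {f : α → GateC} (hf : Primrec f) :
    Primrec fun a => encGateC (f a) := by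
  unfold encGateC
  fun_prop

@[fun_prop] theorem prim_encProgC {f : α → ProgC} (hf : Primrec f) :
    Primrec fun a => encProgC (f a) := by
  unfold encProgC
  fun_prop

@[fun_prop] theorem prim_encHeadC {f : α → HeadC} (hf : Primrec f) :
    Primrec fun a => encHeadC (f a) := by
  unfold encHeadC
  fun_prop

@[fun_prop] theorem prim_encLayerC {f : α → LayerC} (hf : Primrec f) :
    Primrec fun a => encLayerC (f a) := by
  unfold encLayerC
  fun_prop

@[fun_prop] theorem prim_encArithC {f : α → ArithC} (hf : Primrec f) :
    Primrec fun a => encArithC (f a) := by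
  unfold encArithC
  fun_prop

@[fun_prop] theorem prim_encTEC {f : α → TEC} (hf : Primrec f) :
    Primrec fun a => encTEC (f a) := by
  unfold encTEC
  fun_prop

end

/-! A code is canonical if its fractions are in lowest terms and the kinds of its instructions
are at most `5`. -/

def CanonRat (q : RatC) : Prop := 0 < q.2 ∧ q.1.natAbs.Coprime q.2

def CanonGate (g : GateC) : Prop := g.1 ≤ 5 ∧ (g.1 = 0 → CanonRat g.2.1)

def CanonProg (p : ProgC) : Prop := ∀ g ∈ p.1, CanonGate g

def CanonHead (h : HeadC) : Prop := CanonProg h.1 ∧ ∀ r ∈ h.2.2, ∀ q ∈ r, CanonRat q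

def CanonLayer (l : LayerC) : Prop := (∀ h ∈ l.1, CanonHead h) ∧ CanonProg l.2

def CanonTE (t : TEC) : Prop :=
  (∀ p ∈ t.2.1, CanonProg p) ∧ (∀ l ∈ t.2.2.1, CanonLayer l) ∧ CanonProg t.2.2.2

theorem encode_rat {q : RatC} (h : CanonRat q) : encRat (toRat q) = encRatC q := by
  have h1 : (toRat q).num = q.1 := Rat.num_div_eq_of_coprime (by exact_mod_cast h.1) h.2
  have h2 : ((toRat q).den : ℤ) = q.2 := Rat.den_div_eq_of_coprime (by exact_mod_cast h.1) h.2
  have h3 : (toRat q).den = q.2 := by exact_mod_cast h2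
  have h4 : toRat q < 0 ↔ ¬ 0 ≤ q.1 := by rw [← Rat.num_neg, h1, not_le]
  rw [encRat, encRatC, h1, h3, encNat_eq, encNat_eq, ← decide_not]
  congr 1
  exact decide_eq_decide.2 h4

theorem encode_gate {g : GateC} (h : CanonGate g) : (toGate g).encode = encGateC g := by
  obtain ⟨k, q, i, j, k1, k2⟩ := g
  have hk : k ≤ 5 := h.1
  unfold toGate encGateC
  match k, hk, h with
  | 0, _, h => simp [Gate.encode, encUnary, encUnaryC, encode_rat (h.2 rfl)]
  | 1, _, _ => simp [Gate.encode, encUnary, encUnaryC]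
  | 2, _, _ => simp [Gate.encode, encUnary, encUnaryC]
  | 3, _, _ => simp [Gate.encode, encUnary, encUnaryC]
  | 4, _, _ => simp [Gate.encode, encUnary, encUnaryC]
  | 5, _, _ => simp [Gate.encode, encUnary, encUnaryC]

theorem encode_prog {p : ProgC} (h : CanonProg p) : (toProg p).encode = encProgC p := by
  simp only [Prog.encode, toProg, encProgC]
  rw [encList_eq (fun g hg => encode_gate (h g hg))]
  have := encList_eq (e := encUnary) (e' := fun i => encUnaryC i) (f := id)
    (l := p.2) (fun _ _ => rfl)
  rw [← this, List.map_id]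

theorem encode_head {h : HeadC} (hh : CanonHead h) : (toHead h).encode = encHeadC h := by
  simp only [Head.encode, toHead, encHeadC]
  rw [encode_prog hh.1, encList_eq (fun r hr => encList_eq (fun q hq => encode_rat (hh.2 r hr q hq)))]
  cases h.2.1 <;> rfl

theorem encode_layer {l : LayerC} (h : CanonLayer l) : (toLayer l).encode = encLayerC l := by
  simp only [Layer.encode, toLayer, encLayerC]
  rw [encode_prog h.2, encList_eq (fun r hr => encode_head (h.1 r hr))]

theorem encode_arith (c : ArithC) : (toArith c).encode = encArithC c := by
  obtain ⟨b, e, m, o, r1, r2⟩ := c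
  cases b <;> cases o <;> cases r1 <;> cases r2 <;> rfl

theorem encode_te {t : TEC} (h : CanonTE t) : (toTE t).encode = encTEC t := by
  simp only [TE.encode, toTE, encTEC]
  rw [encode_prog h.2.2, encList_eq (fun l hl => encode_layer (h.2.1 l hl)),
    encList_eq (fun p hp => encode_prog (h.1 p hp)), encode_arith]

/-! Canonical codes. -/

def ofRat (q : ℚ) : RatC := (q.num, q.den)

def ofGate : Gate → GateC
  | .const q => (0, ofRat q, 0, 0, 0, 0)
  | .add i j => (1, (0, 0), i, j, 0, 0)
  | .sub i j => (2, (0, 0), i, j, 0, 0)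
  | .mul i j => (3, (0, 0), i, j, 0, 0)
  | .div i j => (4, (0, 0), i, j, 0, 0)
  | .ite i j k l => (5, (0, 0), i, j, k, l)

def ofProg (p : Prog) : ProgC := (p.gates.map ofGate, p.outs)

def ofNorm : Norm → Bool
  | .softmax => false
  | .hardmax => true

def ofHead (h : Head) : HeadC := (ofProg h.score, ofNorm h.norm, h.mat.map (List.map ofRat))

def ofLayer (l : Layer) : LayerC := (l.heads.map ofHead, ofProg l.comb)

def ofRounding : Rounding → Bool × Bool
  | .down => (false, false)
  | .up => (false, true)
  | .cut => (true, false)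
  | .nearest => (true, true)

def ofOverflow : Overflow → Bool
  | .saturate => false
  | .wrap => true

def ofArith : Arith → ArithC
  | .fixed i f o r => (false, i, f, ofOverflow o, ofRounding r)
  | .float e m r => (true, e, m, false, ofRounding r)

/-- A canonical code of an encoder. -/
def ofTE (T : TE) : TEC :=
  (ofArith T.arith, T.emb.map ofProg, T.layers.map ofLayer, ofProg T.out)

theorem map_map_eq_self {α β : Type} {f : α → β} {g : β → α} (h : ∀ a, g (f a) = a) (l : List α) :
    (l.map f).map g = l := by
  rw [List.map_map, show g ∘ f = id from funext h, List.map_id]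

theorem toRat_ofRat (q : ℚ) : toRat (ofRat q) = q := Rat.num_div_den q

theorem toGate_ofGate (g : Gate) : toGate (ofGate g) = g := by
  cases g
  · exact congrArg Gate.const (toRat_ofRat _)
  all_goals rfl

theorem toProg_ofProg (p : Prog) : toProg (ofProg p) = p := by
  simp only [toProg, ofProg, map_map_eq_self toGate_ofGate]

theorem toHead_ofHead (h : Head) : toHead (ofHead h) = h := by
  obtain ⟨s, n, m⟩ := h
  simp only [toHead, ofHead, toProg_ofProg, map_map_eq_self (map_map_eq_self toRat_ofRat)]
  cases n <;> rfl

theorem toLayer_ofLayer (l : Layer) : toLayer (ofLayer l) = l := by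
  simp only [toLayer, ofLayer, toProg_ofProg, map_map_eq_self toHead_ofHead]

theorem toArith_ofArith (F : Arith) : toArith (ofArith F) = F := by
  rcases F with ⟨i, f, o, r⟩ | ⟨e, m, r⟩
  · cases o <;> cases r <;> rfl
  · cases r <;> rfl

theorem toTE_ofTE (T : TE) : toTE (ofTE T) = T := by
  simp only [toTE, ofTE, toProg_ofProg, toArith_ofArith, map_map_eq_self toProg_ofProg,
    map_map_eq_self toLayer_ofLayer]

theorem canonRat_ofRat (q : ℚ) : CanonRat (ofRat q) := ⟨q.den_pos, q.reduced⟩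

theorem canonProg_ofProg (p : Prog) : CanonProg (ofProg p) := by
  intro g hg
  obtain ⟨g, -, rfl⟩ := List.mem_map.1 hg
  cases g
  · exact ⟨by simp [ofGate], fun _ => canonRat_ofRat _⟩
  all_goals exact ⟨by simp [ofGate], by simp [ofGate]⟩

theorem canonHead_ofHead (h : Head) : CanonHead (ofHead h) := by
  refine ⟨canonProg_ofProg _, fun r hr q hq => ?_⟩
  obtain ⟨r, -, rfl⟩ := List.mem_map.1 hr
  obtain ⟨q, -, rfl⟩ := List.mem_map.1 hq
  exact canonRat_ofRat q

theorem canonLayer_ofLayer (l : Layer) : CanonLayer (ofLayer l) := by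
  refine ⟨fun h hh => ?_, canonProg_ofProg _⟩
  obtain ⟨h, -, rfl⟩ := List.mem_map.1 hh
  exact canonHead_ofHead h

theorem canonTE_ofTE (T : TE) : CanonTE (ofTE T) := by
  refine ⟨fun p hp => ?_, fun l hl => ?_, canonProg_ofProg _⟩
  · obtain ⟨p, -, rfl⟩ := List.mem_map.1 hp
    exact canonProg_ofProg p
  · obtain ⟨l, -, rfl⟩ := List.mem_map.1 hl
    exact canonLayer_ofLayer l

/-! ### Well-formedness is primitive recursive -/

def coprimeB (a b : ℕ) : Bool :=
  (List.range (b + 1)).all (fun k => !(decide (a % k = 0) && decide (b % k = 0)) || decide (k ≤ 1))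

theorem coprimeB_iff {a b : ℕ} (hb : 0 < b) : coprimeB a b = true ↔ a.Coprime b := by
  simp only [coprimeB, List.all_eq_true, List.mem_range, Bool.or_eq_true, Bool.not_eq_true',
    Bool.and_eq_false_iff, decide_eq_false_iff_not, decide_eq_true_eq, ← Nat.dvd_iff_mod_eq_zero]
  constructor
  · intro h
    have h1 := h (a.gcd b) (Nat.lt_succ_of_le (Nat.gcd_le_right a hb))
    have h2 := Nat.gcd_pos_of_pos_right a hb
    rcases h1 with h1 | h1
    · rcases h1 with h1 | h1
      · exact absurd (Nat.gcd_dvd_left a b) h1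
      · exact absurd (Nat.gcd_dvd_right a b) h1
    · unfold Nat.Coprime; omega
  · intro h k _
    by_cases h1 : k ∣ a
    · by_cases h2 : k ∣ b
      · right
        exact (Nat.eq_one_of_dvd_coprimes h h1 h2).le
      · exact Or.inl (Or.inr h2)
    · exact Or.inl (Or.inl h1)

/-- Decides whether the fraction is in lowest terms and is a number of the arithmetic. -/
def ratOK (c : ArithC) (q : RatC) : Bool :=
  decide (0 < q.2) && coprimeB q.1.natAbs q.2 &&
    decide (reprZ c q.1 q.2 * (unitNum c * q.2 : ℕ) = q.1 * unitDen c)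

def gateOK (c : ArithC) (n : ℕ) (g : GateC) : Bool :=
  bif decide (g.1 = 0) then ratOK c g.2.1
  else bif decide (g.1 ≤ 4) then decide (g.2.2.1 < n) && decide (g.2.2.2.1 < n)
  else decide (g.1 = 5) && decide (g.2.2.1 < n) && decide (g.2.2.2.1 < n) &&
    decide (g.2.2.2.2.1 < n) && decide (g.2.2.2.2.2 < n)

def progOK (c : ArithC) (n k : ℕ) (p : ProgC) : Bool :=
  (List.range p.1.length).all (fun j => gateOK c (n + j) (p.1.getD j default)) &&
    decide (p.2.length = k) && p.2.all (fun i => decide (i < n + p.1.length))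

def headOK (c : ArithC) (d : ℕ) (h : HeadC) : Bool :=
  progOK c (d + d) 1 h.1 &&
    h.2.2.all (fun row => decide (row.length = d) && row.all (fun q => ratOK c q))

def layerOK (c : ArithC) (d : ℕ) (l : LayerC) : Bool :=
  l.1.all (fun h => headOK c d h) &&
    progOK c (d + (l.1.map (fun h => h.2.2.length)).sum) l.2.2.length l.2

def layersOK (c : ArithC) (out : ProgC) (s : Bool × ℕ) (ls : List LayerC) : Bool :=
  (ls.foldl (fun s l => (s.1 && layerOK c s.2 l, l.2.2.length)) s).1 &&
    progOK c (ls.foldl (fun s l => (s.1 && layerOK c s.2 l, l.2.2.length)) s).2 1 out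

/-- Decides whether the code is a canonical code of a well-formed encoder. -/
def teOK (t : TEC) : Bool :=
  t.2.1.all (fun p => progOK t.1 1 (t.2.1.headD ([], [])).2.length p) &&
    layersOK t.1 t.2.2.2 (true, (t.2.1.headD ([], [])).2.length) t.2.2.1

section
variable {α : Type*} [Primcodable α]

@[fun_prop] theorem prim_coprimeB {f g : α → ℕ} (hf : Primrec f) (hg : Primrec g) :
    Primrec fun a => coprimeB (f a) (g a) := by
  unfold coprimeB
  fun_prop

@[fun_prop] theorem prim_ratOK {c : α → ArithC} {q : α → RatC} (hc : Primrec c)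
    (hq : Primrec q) : Primrec fun a => ratOK (c a) (q a) := by
  unfold ratOK
  fun_prop

@[fun_prop] theorem prim_gateOK {c : α → ArithC} {n : α → ℕ} {g : α → GateC} (hc : Primrec c)
    (hn : Primrec n) (hg : Primrec g) : Primrec fun a => gateOK (c a) (n a) (g a) := by
  unfold gateOK
  fun_prop

@[fun_prop] theorem prim_progOK {c : α → ArithC} {n k : α → ℕ} {p : α → ProgC} (hc : Primrec c)
    (hn : Primrec n) (hk : Primrec k) (hp : Primrec p) :
    Primrec fun a => progOK (c a) (n a) (k a) (p a) := by
  unfold progOK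
  fun_prop

@[fun_prop] theorem prim_headOK {c : α → ArithC} {n : α → ℕ} {h : α → HeadC} (hc : Primrec c)
    (hn : Primrec n) (hh : Primrec h) : Primrec fun a => headOK (c a) (n a) (h a) := by
  unfold headOK
  fun_prop

@[fun_prop] theorem prim_layerOK {c : α → ArithC} {n : α → ℕ} {l : α → LayerC} (hc : Primrec c)
    (hn : Primrec n) (hl : Primrec l) : Primrec fun a => layerOK (c a) (n a) (l a) := by
  unfold layerOK
  fun_prop

@[fun_prop] theorem prim_layersOK {c : α → ArithC} {p : α → ProgC} {s : α → Bool × ℕ}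
    {l : α → List LayerC} (hc : Primrec c) (hp : Primrec p) (hs : Primrec s) (hl : Primrec l) :
    Primrec fun a => layersOK (c a) (p a) (s a) (l a) := by
  unfold layersOK
  fun_prop

@[fun_prop] theorem prim_teOK {t : α → TEC} (ht : Primrec t) : Primrec fun a => teOK (t a) := by
  unfold teOK
  fun_prop

end

theorem representable_iff (c : ArithC) {q : RatC} (hq : 0 < q.2) :
    (toArith c).Representable (toRat q) ↔ RatOK c q := by
  rw [Arith.Representable, RatOK, toRat, repr_div c _ hq]

theorem ratOK_iff (c : ArithC) (q : RatC) :
    ratOK c q = true ↔ CanonRat q ∧ (toArith c).Representable (toRat q) := by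
  rcases Nat.eq_zero_or_pos q.2 with h | h
  · simp [ratOK, CanonRat, h]
  · rw [representable_iff c h]
    simp only [ratOK, Bool.and_eq_true, decide_eq_true_eq, coprimeB_iff h, CanonRat]
    refine and_congr_right fun _ => ?_
    have h1 : (0 : ℚ) < q.2 := by exact_mod_cast h
    have h2 : (0 : ℚ) < unitDen c := by exact_mod_cast unitDen_pos c
    rw [RatOK, toRat, val, div_eq_div_iff h2.ne' h1.ne']
    rw [← Int.cast_inj (α := ℚ)]
    push_cast
    rw [mul_assoc]

theorem gateOK_iff (c : ArithC) (n : ℕ) (g : GateC) :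
    gateOK c n g = true ↔ CanonGate g ∧ (toGate g).WellFormed (toArith c) n := by
  obtain ⟨k, q, i, j, k1, k2⟩ := g
  unfold gateOK toGate CanonGate
  match k with
  | 0 => simp [Gate.WellFormed, ratOK_iff]
  | 1 => simp [Gate.WellFormed]
  | 2 => simp [Gate.WellFormed]
  | 3 => simp [Gate.WellFormed]
  | 4 => simp [Gate.WellFormed]
  | 5 => simp [Gate.WellFormed, and_assoc]
  | k + 6 => simp

theorem progOK_iff (c : ArithC) (n k : ℕ) (p : ProgC) :
    progOK c n k p = true ↔ CanonProg p ∧ (toProg p).WellFormed (toArith c) n k := by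
  have key : ((List.range p.1.length).all
      (fun j => gateOK c (n + j) (p.1.getD j default)) = true) ↔ CanonProg p ∧
      ∀ (j : ℕ) (g : Gate), (toProg p).gates[j]? = some g → g.WellFormed (toArith c) (n + j) := by
    simp only [List.all_eq_true, List.mem_range, gateOK_iff]
    have hget : ∀ (j : ℕ) (hj : j < p.1.length), p.1.getD j default = p.1[j] := by
      intro j hj; simp [List.getD_eq_getElem?_getD, hj]
    constructor
    · intro h
      constructor
      · intro g hg
        obtain ⟨j, hj, rfl⟩ := List.getElem_of_mem hg
        have := (h j hj).1
        rwa [hget j hj] at this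
      · intro j g hg
        simp only [toProg, List.getElem?_map, Option.map_eq_some_iff] at hg
        obtain ⟨g', hg', rfl⟩ := hg
        obtain ⟨hj, rfl⟩ := List.getElem?_eq_some_iff.1 hg'
        have := (h j hj).2
        rwa [hget j hj] at this
    · rintro ⟨h1, h2⟩ j hj
      rw [hget j hj]
      exact ⟨h1 _ (List.getElem_mem hj), h2 j _ (by simp [toProg, hj])⟩
  rw [progOK, Bool.and_eq_true, Bool.and_eq_true, key, Prog.WellFormed]
  simp only [decide_eq_true_eq, List.all_eq_true, toProg, List.length_map]
  tauto

theorem headOK_iff (c : ArithC) (d : ℕ) (h : HeadC) :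
    headOK c d h = true ↔ CanonHead h ∧ (toHead h).WellFormed (toArith c) d := by
  rw [headOK, Bool.and_eq_true, progOK_iff, Head.WellFormed, CanonHead]
  simp only [List.all_eq_true, Bool.and_eq_true, decide_eq_true_eq, ratOK_iff, toHead,
    List.forall_mem_map, List.length_map]
  constructor
  · rintro ⟨⟨h1, h2⟩, h3⟩
    exact ⟨⟨h1, fun r hr q hq => ((h3 r hr).2 q hq).1⟩, h2,
      fun r hr => ⟨(h3 r hr).1, fun q hq => ((h3 r hr).2 q hq).2⟩⟩
  · rintro ⟨⟨h1, h2⟩, h3, h4⟩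
    exact ⟨⟨h1, h3⟩, fun r hr => ⟨(h4 r hr).1, fun q hq => ⟨h2 r hr q hq, (h4 r hr).2 q hq⟩⟩⟩

theorem layerOK_iff (c : ArithC) (d : ℕ) (l : LayerC) :
    layerOK c d l = true ↔ CanonLayer l ∧ (toLayer l).WellFormed (toArith c) d l.2.2.length := by
  rw [layerOK, Bool.and_eq_true, progOK_iff, Layer.WellFormed, CanonLayer]
  simp only [List.all_eq_true, headOK_iff, toLayer, List.forall_mem_map, List.map_map]
  have : (l.1.map ((fun h : Head => h.mat.length) ∘ toHead)) =
      l.1.map (fun h => h.2.2.length) := by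
    apply List.map_congr_left
    intro h _
    simp [toHead]
  rw [this]
  constructor
  · rintro ⟨h1, h2, h3⟩
    exact ⟨⟨fun h hh => (h1 h hh).1, h2⟩, fun h hh => (h1 h hh).2, h3⟩
  · rintro ⟨⟨h1, h2⟩, h3, h4⟩
    exact ⟨fun h hh => ⟨h1 h hh, h3 h hh⟩, h2, h4⟩

theorem layersOK_iff (c : ArithC) (out : ProgC) (b : Bool) (d : ℕ) (ls : List LayerC) :
    layersOK c out (b, d) ls = true ↔ b = true ∧ (∀ l ∈ ls, CanonLayer l) ∧ CanonProg out ∧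
      TE.LayersWellFormed (toArith c) (toProg out) d (ls.map toLayer) := by
  induction ls generalizing b d with
  | nil => simp [layersOK, progOK_iff, TE.LayersWellFormed]
  | cons l ls ih =>
    have h1 : layersOK c out (b, d) (l :: ls) =
        layersOK c out (b && layerOK c d l, l.2.2.length) ls := rfl
    have h2 : ∀ d', (toLayer l).WellFormed (toArith c) d d' → d' = l.2.2.length := by
      intro d' h
      exact h.2.2.1.symm
    rw [h1, ih, Bool.and_eq_true, layerOK_iff]
    simp only [List.mem_cons, forall_eq_or_imp, List.map_cons, TE.LayersWellFormed]
    constructor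
    · rintro ⟨⟨h3, h4, h5⟩, h6, h7, h8⟩
      exact ⟨h3, ⟨h4, h6⟩, h7, _, h5, h8⟩
    · rintro ⟨h3, ⟨h4, h6⟩, h7, d', h5, h8⟩
      obtain rfl := h2 d' h5
      exact ⟨⟨h3, h4, h5⟩, h6, h7, h8⟩

theorem teOK_iff {t : TEC} (ht : t.2.1 ≠ []) :
    teOK t = true ↔ CanonTE t ∧ (toTE t).WellFormed := by
  rw [teOK, Bool.and_eq_true, layersOK_iff, TE.WellFormed, CanonTE]
  simp only [List.all_eq_true, progOK_iff, toTE, List.forall_mem_map, true_and]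
  constructor
  · rintro ⟨h1, h2, h3, h4⟩
    exact ⟨⟨fun p hp => (h1 p hp).1, h2, h3⟩, _, fun p hp => (h1 p hp).2, h4⟩
  · rintro ⟨⟨h1, h2, h3⟩, d, h4, h5⟩
    have hd : d = (t.2.1.headD ([], [])).2.length := by
      obtain ⟨p, ps, hp⟩ := List.exists_cons_of_ne_nil ht
      have := (h4 p (by simp [hp])).2.1
      rw [hp]
      exact this.symm
    rw [← hd]
    exact ⟨fun p hp => ⟨h1 p hp, h4 p hp⟩, h2, h3, h5⟩

theorem progOK_of_wellFormed {c : ArithC} {n k : ℕ} {p : ProgC} (hc : CanonProg p)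
    (h : (toProg p).WellFormed (toArith c) n k) : ProgOK c p := by
  intro g hg h0
  obtain ⟨j, hj, rfl⟩ := List.getElem_of_mem hg
  have h1 := h.1 j (toGate p.1[j]) (by simp [toProg, hj])
  have h2 : toGate p.1[j] = .const (toRat p.1[j].2.1) := by simp [toGate, h0]
  rw [h2] at h1
  exact (representable_iff c ((hc _ hg).2 h0).1).1 h1

theorem layersOK_of_wellFormed {c : ArithC} {out : ProgC} {d : ℕ} {ls : List LayerC}
    (hc : ∀ l ∈ ls, CanonLayer l) (ho : CanonProg out)
    (h : TE.LayersWellFormed (toArith c) (toProg out) d (ls.map toLayer)) :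
    (∀ l ∈ ls, LayerOK c l) ∧ ProgOK c out := by
  induction ls generalizing d with
  | nil => exact ⟨by simp, progOK_of_wellFormed ho h⟩
  | cons l ls ih =>
    simp only [List.map_cons, TE.LayersWellFormed] at h
    obtain ⟨d', h1, h2⟩ := h
    obtain ⟨h3, h4⟩ := ih (fun l' hl' => hc l' (by simp [hl'])) h2
    refine ⟨?_, h4⟩
    simp only [List.mem_cons, forall_eq_or_imp]
    refine ⟨?_, h3⟩
    obtain ⟨c1, c2⟩ := hc l (by simp)
    refine ⟨fun hd hhd => ?_, progOK_of_wellFormed c2 h1.2⟩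
    have h5 := h1.1 (toHead hd) (List.mem_map_of_mem hhd)
    refine ⟨progOK_of_wellFormed (c1 hd hhd).1 h5.1, fun row hrow q hq => ?_⟩
    have h6 := (h5.2 (row.map toRat) (by simpa [toHead] using ⟨row, hrow, rfl⟩)).2 (toRat q)
      (List.mem_map_of_mem hq)
    exact (representable_iff c ((c1 hd hhd).2 row hrow q hq).1).1 h6

theorem teOK_of_wellFormed {t : TEC} (hc : CanonTE t) (h : (toTE t).WellFormed) : TEOK t := by
  obtain ⟨d, h1, h2⟩ := h
  obtain ⟨h3, h4⟩ := layersOK_of_wellFormed hc.2.1 hc.2.2 h2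
  exact ⟨fun p hp => progOK_of_wellFormed (hc.1 p hp) (h1 _ (List.mem_map_of_mem hp)), h3, h4⟩

/-! ### Enumeration of the encoders with short codes -/

def prodL {α β : Type} (l : List α) (m : List β) : List (α × β) :=
  l.flatMap (fun a => m.map (fun b => (a, b)))

theorem mem_prodL {α β : Type} {l : List α} {m : List β} {p : α × β} :
    p ∈ prodL l m ↔ p.1 ∈ l ∧ p.2 ∈ m := by
  obtain ⟨a, b⟩ := p
  simp [prodL]

/-- The lists of length at most `n` with entries in `l`. -/
def allLists {α : Type} (l : List α) (n : ℕ) : List (List α) :=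
  (List.range n).foldl (fun s _ => [] :: l.flatMap (fun a => s.map (fun r => a :: r))) [[]]

theorem mem_allLists {α : Type} {l : List α} {n : ℕ} {r : List α} :
    r ∈ allLists l n ↔ r.length ≤ n ∧ ∀ a ∈ r, a ∈ l := by
  induction n generalizing r with
  | zero =>
    cases r <;> simp [allLists]
  | succ n ih =>
    have h : allLists l (n + 1) =
        [] :: l.flatMap (fun a => (allLists l n).map (fun r => a :: r)) := by
      rw [allLists, List.range_succ, List.foldl_append]
      rfl
    rw [h]
    cases r with
    | nil => simp
    | cons a r =>
      simp only [List.mem_cons, reduceCtorEq, List.mem_flatMap, List.mem_map, List.cons.injEq,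
        false_or, List.length_cons, forall_eq_or_imp, add_le_add_iff_right]
      constructor
      · rintro ⟨b, hb, r', hr', rfl, rfl⟩
        exact ⟨(ih.1 hr').1, hb, (ih.1 hr').2⟩
      · rintro ⟨h1, h2, h3⟩
        exact ⟨a, h2, r, ih.2 ⟨h1, h3⟩, rfl, rfl⟩

/-- The integers `k` with `|k| ≤ n`. -/
def intsTo (n : ℕ) : List ℤ := (List.range (2 * n + 1)).map (fun i : ℕ => (i : ℤ) - (n : ℤ))

theorem mem_intsTo {n : ℕ} {k : ℤ} : k ∈ intsTo n ↔ |k| ≤ n := by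
  simp only [intsTo, List.mem_map, List.mem_range, abs_le]
  constructor
  · rintro ⟨i, hi, rfl⟩
    constructor <;> omega
  · rintro ⟨h1, h2⟩
    exact ⟨(k + n).toNat, by omega, by omega⟩

def bools : List Bool := [false, true]

theorem mem_bools (b : Bool) : b ∈ bools := by cases b <;> simp [bools]

/-! The canonical codes of objects whose bit strings have length at most `n` are in the following
lists. -/

def ratCodes (n : ℕ) : List RatC := prodL (intsTo (2 ^ n)) (List.range (2 ^ n))

def gateCodes (n : ℕ) : List GateC :=
  prodL (List.range 6) (prodL ((0, 0) :: ratCodes n) (prodL (List.range (n + 1))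
    (prodL (List.range (n + 1)) (prodL (List.range (n + 1)) (List.range (n + 1))))))

def progCodes (n : ℕ) : List ProgC :=
  prodL (allLists (gateCodes n) n) (allLists (List.range (n + 1)) n)

def headCodes (n : ℕ) : List HeadC :=
  prodL (progCodes n) (prodL bools (allLists (allLists (ratCodes n) n) n))

def layerCodes (n : ℕ) : List LayerC := prodL (allLists (headCodes n) n) (progCodes n)

def arithCodes (n : ℕ) : List ArithC :=
  prodL bools (prodL (List.range (n + 1)) (prodL (List.range (n + 1)) (prodL bools
    (prodL bools bools))))

/-- A list that contains `ofTE T` for all encoders `T` whose encoding has length at most `n`. -/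
def teCodes (n : ℕ) : List TEC :=
  prodL (arithCodes n) (prodL (allLists (progCodes n) n) (prodL (allLists (layerCodes n) n)
    (progCodes n)))

section
variable {α : Type*} [Primcodable α]

@[fun_prop] theorem prim_prodL {β γ : Type} [Primcodable β] [Primcodable γ] {f : α → List β}
    {g : α → List γ} (hf : Primrec f) (hg : Primrec g) : Primrec fun a => prodL (f a) (g a) := by
  unfold prodL
  fun_prop

@[fun_prop] theorem prim_allLists {β : Type} [Primcodable β] {f : α → List β} {g : α → ℕ}
    (hf : Primrec f) (hg : Primrec g) : Primrec fun a => allLists (f a) (g a) := by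
  unfold allLists
  fun_prop

@[fun_prop] theorem prim_intsTo {f : α → ℕ} (hf : Primrec f) :
    Primrec fun a => intsTo (f a) := by
  unfold intsTo
  fun_prop

@[fun_prop] theorem prim_ratCodes {f : α → ℕ} (hf : Primrec f) :
    Primrec fun a => ratCodes (f a) := by
  unfold ratCodes
  fun_prop

@[fun_prop] theorem prim_gateCodes {f : α → ℕ} (hf : Primrec f) :
    Primrec fun a => gateCodes (f a) := by
  unfold gateCodes
  fun_prop

@[fun_prop] theorem prim_progCodes {f : α → ℕ} (hf : Primrec f) :
    Primrec fun a => progCodes (f a) := by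
  unfold progCodes
  fun_prop

@[fun_prop] theorem prim_headCodes {f : α → ℕ} (hf : Primrec f) :
    Primrec fun a => headCodes (f a) := by
  unfold headCodes
  fun_prop

@[fun_prop] theorem prim_layerCodes {f : α → ℕ} (hf : Primrec f) :
    Primrec fun a => layerCodes (f a) := by
  unfold layerCodes
  fun_prop

@[fun_prop] theorem prim_arithCodes {f : α → ℕ} (hf : Primrec f) :
    Primrec fun a => arithCodes (f a) := by
  unfold arithCodes
  fun_prop

@[fun_prop] theorem prim_teCodes {f : α → ℕ} (hf : Primrec f) :
    Primrec fun a => teCodes (f a) := by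
  unfold teCodes
  fun_prop

end

theorem length_le_encList {α : Type} (e : α → List Bool) (l : List α) :
    l.length ≤ (encList e l).length := by
  induction l with
  | nil => simp
  | cons a l ih => simp only [encList, List.length_cons, List.length_append]; omega

theorem encode_length_le_encList {α : Type} (e : α → List Bool) {l : List α} {a : α}
    (ha : a ∈ l) : (e a).length ≤ (encList e l).length := by
  induction l with
  | nil => simp at ha
  | cons b l ih =>
    simp only [encList, List.length_cons, List.length_append]
    rcases List.mem_cons.1 ha with rfl | h
    · omega
    · have := ih h; omega

theorem map_mem_allLists {α β : Type} {e : α → List Bool} {f : α → β} {l : List α} {n : ℕ}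
    {c : List β} (hl : (encList e l).length ≤ n)
    (h : ∀ a, (e a).length ≤ n → f a ∈ c) : l.map f ∈ allLists c n := by
  rw [mem_allLists]
  refine ⟨by have := length_le_encList e l; simp; omega, fun b hb => ?_⟩
  obtain ⟨a, ha, rfl⟩ := List.mem_map.1 hb
  exact h a (by have := encode_length_le_encList e ha; omega)

theorem le_encUnary (n : ℕ) : n ≤ (encUnary n).length := by simp [encUnary]

theorem lt_two_pow_encNat (n : ℕ) : n < 2 ^ (encNat n).length := by
  have h1 := length_le_encList (fun b : Bool => [b]) n.bits
  rw [Nat.size_eq_bits_len] at h1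
  exact (Nat.lt_size_self n).trans_le (Nat.pow_le_pow_right (by norm_num) h1)

theorem ofRat_mem {q : ℚ} {n : ℕ} (h : (encRat q).length ≤ n) : ofRat q ∈ ratCodes n := by
  simp only [encRat, List.length_cons, List.length_append] at h
  rw [ratCodes, mem_prodL, mem_intsTo, List.mem_range, ofRat]
  have h1 := lt_two_pow_encNat q.num.natAbs
  have h2 := lt_two_pow_encNat q.den
  have h3 : 2 ^ (encNat q.num.natAbs).length ≤ 2 ^ n := Nat.pow_le_pow_right (by norm_num) (by omega)
  have h4 : 2 ^ (encNat q.den).length ≤ 2 ^ n := Nat.pow_le_pow_right (by norm_num) (by omega)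
  refine ⟨?_, h2.trans_le h4⟩
  rw [Int.abs_eq_natAbs]
  exact_mod_cast (h1.trans_le h3).le

theorem ofGate_mem {g : Gate} {n : ℕ} (h : g.encode.length ≤ n) : ofGate g ∈ gateCodes n := by
  simp only [gateCodes, mem_prodL, List.mem_range]
  cases g <;> simp only [Gate.encode, encUnary, List.length_append, List.length_replicate,
    List.length_cons, List.length_nil] at h <;> simp only [ofGate] <;>
    refine ⟨by omega, ?_, by omega, by omega, by omega, by omega⟩
  · exact List.mem_cons_of_mem _ (ofRat_mem (by omega))
  all_goals exact List.mem_cons_self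

theorem ofProg_mem {p : Prog} {n : ℕ} (h : p.encode.length ≤ n) : ofProg p ∈ progCodes n := by
  simp only [Prog.encode, List.length_append] at h
  rw [progCodes, mem_prodL]
  refine ⟨map_mem_allLists (e := Gate.encode) (by omega) (fun g => ofGate_mem), ?_⟩
  have := map_mem_allLists (e := encUnary) (f := id) (l := p.outs) (n := n)
    (c := List.range (n + 1)) (by omega) (fun i hi => by
      have := le_encUnary i
      simp only [id, List.mem_range]; omega)
  rwa [List.map_id] at this

theorem ofHead_mem {h : Head} {n : ℕ} (hn : h.encode.length ≤ n) : ofHead h ∈ headCodes n := by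
  simp only [Head.encode, List.length_append] at hn
  rw [headCodes, mem_prodL, mem_prodL]
  exact ⟨ofProg_mem (by omega), mem_bools _, map_mem_allLists (e := encList encRat) (by omega)
    (fun r hr => map_mem_allLists (e := encRat) hr (fun q => ofRat_mem))⟩

theorem ofLayer_mem {l : Layer} {n : ℕ} (hn : l.encode.length ≤ n) :
    ofLayer l ∈ layerCodes n := by
  simp only [Layer.encode, List.length_append] at hn
  rw [layerCodes, mem_prodL]
  exact ⟨map_mem_allLists (e := Head.encode) (by omega) (fun h => ofHead_mem),
    ofProg_mem (by omega)⟩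

theorem ofArith_mem {F : Arith} {n : ℕ} (hn : F.encode.length ≤ n) : ofArith F ∈ arithCodes n := by
  simp only [arithCodes, mem_prodL, mem_bools, List.mem_range, true_and, and_true]
  rcases F with ⟨i, f, o, r⟩ | ⟨e, m, r⟩ <;>
    simp only [Arith.encode, encUnary, List.length_append, List.length_replicate,
      List.length_cons, List.length_nil] at hn <;> simp only [ofArith] <;> omega

theorem ofTE_mem (T : TE) : ofTE T ∈ teCodes T.encode.length := by
  obtain ⟨n, hn⟩ : ∃ n, n = T.encode.length := ⟨_, rfl⟩
  have h := hn.ge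
  rw [← hn]
  simp only [TE.encode, List.length_append] at h
  rw [teCodes, mem_prodL, mem_prodL, mem_prodL]
  exact ⟨ofArith_mem (by omega), map_mem_allLists (e := Prog.encode) (by omega)
    (fun p => ofProg_mem), map_mem_allLists (e := Layer.encode) (by omega)
    (fun p => ofLayer_mem), ofProg_mem (by omega)⟩

theorem sizeLE_of_encode {t : TEC} {n : ℕ} (h : (toTE t).encode.length ≤ n) : SizeLE n t := by
  simp only [TE.encode, List.length_append] at h
  have h1 := length_le_encList Layer.encode (toTE t).layers
  refine ⟨?_, fun p hp => ?_, fun l hl => ?_⟩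
  · have h2 : (toTE t).layers.length = t.2.2.1.length := by simp [toTE]
    omega
  · have h2 := encode_length_le_encList Prog.encode (l := (toTE t).emb) (a := toProg p)
      (List.mem_map_of_mem hp)
    have h3 := length_le_encList encUnary p.2
    simp only [Prog.encode, List.length_append, toProg] at h2
    omega
  · have h2 := encode_length_le_encList Layer.encode (l := (toTE t).layers) (a := toLayer l)
      (List.mem_map_of_mem hl)
    have h3 := length_le_encList encUnary l.2.2
    have h4 := length_le_encList Head.encode (toLayer l).heads
    have h5 : (toLayer l).heads.length = l.1.length := by simp [toLayer]
    have h6 : (toLayer l).comb.outs = l.2.2 := rfl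
    simp only [Layer.encode, List.length_append, Prog.encode, h6] at h2
    refine ⟨by omega, by omega, fun hd hhd => ?_⟩
    have h7 := encode_length_le_encList Head.encode (l := (toLayer l).heads) (a := toHead hd)
      (List.mem_map_of_mem hhd)
    have h8 := length_le_encList (encList encRat) (toHead hd).mat
    have h9 : (toHead hd).mat.length = hd.2.2.length := by simp [toHead]
    simp only [Head.encode, List.length_append] at h7
    omega

/-! ### The decision procedure -/

/-- Approximations of order `n` determine all values of the exponential function that occur in
encoders with codes as long as `s`. -/
def sufficient (s : List Bool) (n : ℕ) : Bool :=
  (teCodes s.length).all (fun t => (intsTo (maxZ t.1)).all (fun k => expOK t.1 n k))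

theorem exists_sufficient (s : List Bool) : ∃ n, sufficient s n = true := by
  have : ∀ᶠ n in Filter.atTop, ∀ t ∈ teCodes s.length, ∀ k ∈ intsTo (maxZ t.1),
      expOK t.1 n k = true := by
    have h1 : ∀ {β : Type} (l : List β) (p : β → ℕ → Prop),
        (∀ b ∈ l, ∀ᶠ n in Filter.atTop, p b n) → ∀ᶠ n in Filter.atTop, ∀ b ∈ l, p b n := by
      intro β l p h
      exact (Filter.eventually_all_finite (l.finite_toSet)).2 h
    exact h1 _ _ fun t _ => h1 _ _ fun k _ => expOK_eventually t.1 k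
  obtain ⟨n, hn⟩ := this.exists
  refine ⟨n, ?_⟩
  simpa only [sufficient, List.all_eq_true] using hn

/-- The search for an accepted word, among the words of bounded length. -/
def acceptsShort (n N : ℕ) (t : TEC) : Bool :=
  (allLists (List.range t.2.1.length) (wordBound t.1 N)).any
    (fun w => !decide (w.length = 0) && decide (evalZ n t w * unitNum t.1 = (unitDen t.1 : ℕ)))

/-- The decision procedure for `trSAT`, restricted to arithmetics with saturation if `sat` is set,
where `n` is the precision of the exponential function. -/
def decideSat (sat : Bool) (s : List Bool) (n : ℕ) : Bool :=
  (teCodes s.length).any (fun t => decide (encTEC t = s) && teOK t &&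
    (!sat || (t.1.1 || !t.1.2.2.2.1)) && acceptsShort n s.length t)

section
variable {α : Type*} [Primcodable α]

@[fun_prop] theorem prim_sufficient {s : α → List Bool} {n : α → ℕ} (hs : Primrec s)
    (hn : Primrec n) : Primrec fun a => sufficient (s a) (n a) := by
  unfold sufficient
  fun_prop

@[fun_prop] theorem prim_acceptsShort {n m : α → ℕ} {t : α → TEC} (hn : Primrec n)
    (hm : Primrec m) (ht : Primrec t) : Primrec fun a => acceptsShort (n a) (m a) (t a) := by
  unfold acceptsShort
  fun_prop

@[fun_prop] theorem prim_decideSat (sat : Bool) {s : α → List Bool} {n : α → ℕ} (hs : Primrec s)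
    (hn : Primrec n) : Primrec fun a => decideSat sat (s a) (n a) := by
  unfold decideSat
  fun_prop

end

theorem val_eq_one (c : ArithC) (k : ℤ) : val c k = 1 ↔ k * unitNum c = (unitDen c : ℕ) := by
  have h2 : (unitDen c : ℚ) ≠ 0 := by exact_mod_cast (unitDen_pos c).ne'
  rw [val, div_eq_one_iff_eq h2]
  exact_mod_cast Iff.rfl

theorem satisfiable_iff_evalZ {t : TEC} (ht : TEOK t) {e : ℕ} (he : Precise t.1 e) :
    (toTE t).Satisfiable ↔ ∃ w : List ℕ, w ≠ [] ∧ (∀ a ∈ w, a < t.2.1.length) ∧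
      val t.1 (evalZ e t w) = 1 := by
  have hlen : (toTE t).emb.length = t.2.1.length := by simp [toTE]
  constructor
  · rintro ⟨w, h1, h2⟩
    rw [TE.Accepts, eval_toTE ht he] at h2
    refine ⟨w.map Fin.val, by simpa using h1, fun a ha => ?_, h2⟩
    obtain ⟨b, -, rfl⟩ := List.mem_map.1 ha
    rw [← hlen]; exact b.2
  · rintro ⟨w, h1, h2, h3⟩
    obtain ⟨w', rfl⟩ : ∃ w' : List (toTE t).Alphabet, w'.map Fin.val = w :=
      ⟨w.pmap (fun a ha => ⟨a, ha⟩) (fun a ha => by rw [hlen]; exact h2 a ha),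
        by rw [List.map_pmap]; simp⟩
    exact ⟨w', by simpa using h1, by rw [TE.Accepts, eval_toTE ht he, h3]⟩

theorem acceptsShort_iff {n N : ℕ} {t : TEC} (hN : SizeLE N t) (hn : Precise t.1 n)
    (ht : TEOK t) : acceptsShort n N t = true ↔ (toTE t).Satisfiable := by
  simp only [satisfiable_iff_evalZ ht hn, acceptsShort, List.any_eq_true, mem_allLists,
    List.mem_range, Bool.and_eq_true, Bool.not_eq_true', decide_eq_false_iff_not, decide_eq_true_eq,
    List.length_eq_zero_iff, ← val_eq_one]
  constructor
  · rintro ⟨w, ⟨-, h1⟩, h2, h3⟩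
    exact ⟨w, h2, h1, h3⟩
  · rintro ⟨w, h1, h2, h3⟩
    obtain ⟨w', h4, h5, h6, h7⟩ := exists_short (n := n) hN h1
    exact ⟨w', ⟨h5, fun a ha => h2 a (h6 a ha)⟩, h4, by rw [h7, h3]⟩

theorem satisfiable_emb_ne_nil {T : TE} (h : T.Satisfiable) : T.emb ≠ [] := by
  obtain ⟨w, h1, -⟩ := h
  intro h2
  obtain ⟨a, l, rfl⟩ := List.exists_cons_of_ne_nil h1
  have := a.2
  simp [h2] at this

theorem saturating_toArith (c : ArithC) :
    (toArith c).Saturating ↔ (c.1 || !c.2.2.2.1) = true := by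
  obtain ⟨b, e, m, o, r⟩ := c
  cases b <;> cases o <;> simp [toArith, Arith.Saturating]

theorem decideSat_iff {C : Set TE} {sat : Bool}
    (hC : ∀ T, T ∈ C ↔ T.WellFormed ∧ (sat = true → T.arith.Saturating)) {s : List Bool} {n : ℕ}
    (hn : sufficient s n = true) : decideSat sat s n = true ↔ s ∈ trSAT C := by
  have hprec : ∀ t ∈ teCodes s.length, Precise t.1 n := by
    intro t ht k hk
    simp only [sufficient, List.all_eq_true] at hn
    exact hn t ht k (mem_intsTo.2 hk)
  have hsat : ∀ t : TEC, (!sat || (t.1.1 || !t.1.2.2.2.1)) = true ↔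
      (sat = true → (toTE t).arith.Saturating) := by
    intro t
    rw [Bool.or_eq_true, ← saturating_toArith, Bool.not_eq_true']
    cases sat <;> simp [toTE]
  simp only [decideSat, List.any_eq_true, Bool.and_eq_true, decide_eq_true_eq, hsat]
  constructor
  · rintro ⟨t, ht, ⟨⟨⟨h1, h2⟩, h3⟩, h4⟩⟩
    have hne : t.2.1 ≠ [] := by
      intro h0
      simp only [acceptsShort, h0, List.any_eq_true, mem_allLists, Bool.and_eq_true] at h4
      obtain ⟨w, ⟨-, h5⟩, h6, -⟩ := h4
      cases w with
      | nil => simp at h6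
      | cons a w => simpa using h5 a (by simp)
    obtain ⟨h5, h6⟩ := (teOK_iff hne).1 h2
    have h7 : (toTE t).encode = s := by rw [encode_te h5, h1]
    refine ⟨toTE t, (hC _).2 ⟨h6, h3⟩, h7, ?_⟩
    exact (acceptsShort_iff (sizeLE_of_encode (by rw [h7])) (hprec t ht)
      (teOK_of_wellFormed h5 h6)).1 h4
  · rintro ⟨T, hT, rfl, hS⟩
    have h1 := canonTE_ofTE T
    have h2 := toTE_ofTE T
    have h3 := (hC T).1 hT
    have hne : (ofTE T).2.1 ≠ [] := by
      have := satisfiable_emb_ne_nil hS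
      simpa [ofTE] using this
    have h4 : teOK (ofTE T) = true := (teOK_iff hne).2 ⟨h1, by rw [h2]; exact h3.1⟩
    refine ⟨ofTE T, ofTE_mem T, ⟨⟨⟨?_, h4⟩, ?_⟩, ?_⟩⟩
    · rw [← encode_te h1, h2]
    · rw [h2]; exact h3.2
    · rw [acceptsShort_iff (sizeLE_of_encode (by rw [h2])) (hprec _ (ofTE_mem T))
        (teOK_of_wellFormed h1 (by rw [h2]; exact h3.1)), h2]
      exact hS

theorem decidable_trSAT {C : Set TE} {sat : Bool}
    (hC : ∀ T, T ∈ C ↔ T.WellFormed ∧ (sat = true → T.arith.Saturating)) :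
    Complexity.Decidable (trSAT C) := by
  classical
  rw [Complexity.Decidable, ComputablePred.computable_iff]
  have hf : Primrec fun p : List Bool × ℕ =>
      bif sufficient p.1 p.2 then some (decideSat sat p.1 p.2) else none := by
    fun_prop
  refine ⟨fun s => decide (s ∈ trSAT C), ?_, by ext; simp⟩
  refine (Partrec.rfindOpt (f := fun s n => bif sufficient s n then some (decideSat sat s n)
    else none) hf.to_comp).of_eq_tot fun s => ?_
  have hdom : (Nat.rfindOpt fun n => bif sufficient s n then some (decideSat sat s n)
      else none).Dom := by
    rw [Nat.rfindOpt_dom]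
    obtain ⟨n, hn⟩ := exists_sufficient s
    exact ⟨n, decideSat sat s n, by simp [hn]⟩
  obtain ⟨b, hb⟩ := Part.dom_iff_mem.1 hdom
  obtain ⟨n, hn⟩ := Nat.rfindOpt_spec hb
  cases h : sufficient s n with
  | false => simp [h] at hn
  | true =>
    simp only [h, cond_true, Option.mem_def, Option.some.injEq] at hn
    have h1 := decideSat_iff hC h
    have : decide (s ∈ trSAT C) = b := by
      rw [← hn, Bool.eq_iff_iff, decide_eq_true_eq, h1]
    rwa [this]

theorem decidable_trSAT_fix : Complexity.Decidable (trSAT TFix) :=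
  decidable_trSAT (sat := false) fun T => by simp [TFix]

theorem decidable_trSAT_fixSat : Complexity.Decidable (trSAT TFixSat) :=
  decidable_trSAT (sat := true) fun T => by simp [TFixSat]

/-! ### Saturating integers -/

/-- The arithmetic of the integers from `-2 ^ W` to `2 ^ W - 1`, with saturation, rounding up. -/
def satC (W : ℕ) : ArithC := (false, W, 0, false, (false, true))

/-- The numbers of this arithmetic. -/
def InRange (W : ℕ) (k : ℤ) : Prop := -2 ^ W ≤ k ∧ k ≤ 2 ^ W - 1

/-- Saturation to the range of the arithmetic. -/
def clamp (W : ℕ) (k : ℤ) : ℤ := max (-2 ^ W) (min (2 ^ W - 1) k)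

theorem clamp_eq {W : ℕ} {k : ℤ} (h : InRange W k) : clamp W k = k := by
  rw [clamp, min_eq_right h.2, max_eq_right h.1]

theorem inRange_zero (W : ℕ) : InRange W 0 := by
  have : (0 : ℤ) < 2 ^ W := by positivity
  constructor <;> omega

theorem inRange_one {W : ℕ} (hW : 1 ≤ W) : InRange W 1 := by
  have : (2 : ℤ) ^ 1 ≤ 2 ^ W := pow_le_pow_right₀ (by norm_num) hW
  constructor <;> omega

theorem reprZ_satC (W : ℕ) (k : ℤ) : reprZ (satC W) k 1 = clamp W k := by
  simp [reprZ, finish, satC, maxZ, sigZ, roundZ, binadeZ, unitDen, unitNum, clamp]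

theorem addZ_satC (W : ℕ) (a b : ℤ) : addZ (satC W) a b = clamp W (a + b) := by
  rw [← reprZ_satC]; simp [addZ, unitNum, unitDen, satC]

theorem subZ_satC (W : ℕ) (a b : ℤ) : subZ (satC W) a b = clamp W (a - b) := by
  rw [← reprZ_satC]; simp [subZ, unitNum, unitDen, satC]

theorem mulZ_satC (W : ℕ) (a b : ℤ) : mulZ (satC W) a b = clamp W (a * b) := by
  rw [← reprZ_satC]; simp [mulZ, unitNum, unitDen, satC]

theorem divZ_zero_satC (W : ℕ) (b : ℤ) : divZ (satC W) 0 b = 0 := by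
  have h := clamp_eq (inRange_zero W)
  by_cases hb : b = 0
  · simp [divZ, hb, reprZ_satC, h]
  · have : (1 : ℤ) ≤ 2 ^ W := Int.pow_pos (by norm_num)
    simpa [divZ, hb, reprZ, finish, satC, maxZ, sigZ, roundZ, binadeZ, unitDen, unitNum] using this

/-- As quotients are rounded up, the hardmax weights are `0` and `1`. -/
theorem divZ_one_satC {W : ℕ} (hW : 1 ≤ W) {b : ℤ} (hb : 0 < b) : divZ (satC W) 1 b = 1 := by
  have h1 : (b.natAbs : ℤ) = b := Int.natAbs_of_nonneg hb.le
  have h2 : -(-b / (b * b)) = 1 := by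
    have : -b / (b * b) = -1 := by
      rw [Int.ediv_eq_iff_of_pos (by positivity)]
      constructor
      · nlinarith
      · nlinarith
    omega
  have h3 : divZ (satC W) 1 b = clamp W (-(-b / (b * b))) := by
    simp [divZ, hb.ne', reprZ, finish, satC, maxZ, sigZ, roundZ, binadeZ, unitDen, unitNum, clamp,
      abs_mul_abs_self]
  rw [h3, h2, clamp_eq (inRange_one hW)]

theorem sumZ_range {W n : ℕ} {f : ℕ → ℤ}
    (h : ∀ k ≤ n, InRange W (∑ l ∈ Finset.range k, f l)) :
    sumZ (satC W) ((List.range n).map f) = ∑ l ∈ Finset.range n, f l := by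
  induction n with
  | zero => simp [sumZ]
  | succ n ih =>
    have h1 := ih fun k hk => h k (by omega)
    have h2 := h (n + 1) le_rfl
    rw [sumZ, List.range_succ, List.map_append, List.foldl_append, ← sumZ, h1,
      Finset.sum_range_succ]
    rw [Finset.sum_range_succ] at h2
    simp [addZ_satC, clamp_eq h2]

/-- Sums of ones are positive even if they saturate. -/
theorem sumZ_pos {W : ℕ} (hW : 1 ≤ W) {l : List ℤ} (h : ∀ a ∈ l, a = 0 ∨ a = 1)
    (h1 : (1 : ℤ) ∈ l) : 0 < sumZ (satC W) l := by
  have hr := inRange_one hW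
  have step : ∀ a b : ℤ, 0 ≤ a → 0 ≤ b → 0 ≤ addZ (satC W) a b ∧
      (0 < a + b → 0 < addZ (satC W) a b) := by
    intro a b ha hb
    rw [addZ_satC, clamp]
    have := hr.2
    constructor
    · exact le_max_of_le_right (le_min (by omega) (by omega))
    · intro h
      exact lt_max_of_lt_right (lt_min (by omega) h)
  have key : ∀ (l : List ℤ) (a : ℤ), 0 ≤ a → (∀ a ∈ l, a = 0 ∨ a = 1) →
      0 ≤ l.foldl (fun a b => addZ (satC W) a b) a ∧
        ((0 < a ∨ (1 : ℤ) ∈ l) → 0 < l.foldl (fun a b => addZ (satC W) a b) a) := by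
    intro l
    induction l with
    | nil => intro a ha _; simpa using ha
    | cons b l ih =>
      intro a ha hl
      have hb : 0 ≤ b := by rcases hl b (by simp) with h | h <;> omega
      obtain ⟨h2, h3⟩ := step a b ha hb
      obtain ⟨h4, h5⟩ := ih _ h2 (fun a ha => hl a (by simp [ha]))
      refine ⟨h4, fun h => h5 ?_⟩
      rcases h with h | h
      · exact Or.inl (h3 (by omega))
      · rcases List.mem_cons.1 h with h | h
        · exact Or.inl (h3 (by omega))
        · exact Or.inr h
  exact (key l 0 le_rfl h).2 (Or.inr h1)

/-- The entry at `i` of an attention head with hardmax is the sum of the projected vectors over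
the set of positions with maximal score, provided that the partial sums do not saturate. -/
theorem pool_row {W : ℕ} (hW : 1 ≤ W) {e n : ℕ} {h : HeadC} (hh : h.2.1 = true) {x : List ℤ}
    {V : ℕ → List ℤ} {S f : ℕ → ℤ} {row : List RatC} {P : ℕ → Prop} [DecidablePred P]
    (hS : ∀ l < n, scoreZ (satC W) h x (V l) = S l)
    (hf : ∀ l < n, dotZ (satC W) (row.map (fun q => reprZ (satC W) q.1 q.2)) (V l) = f l)
    (hP : ∀ l < n, P l ↔ ∀ k < n, S k ≤ S l) (hex : ∃ l < n, P l)
    (hr0 : ∀ l < n, InRange W (f l))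
    (hr : ∀ k ≤ n, InRange W (∑ l ∈ Finset.range k, if P l then f l else 0)) :
    sumZ (satC W) (List.zipWith
      (fun a y => termZ (satC W) row (sumZ (satC W) (headNumZ (satC W) e h x
        ((List.range n).map V))) a y) (headNumZ (satC W) e h x ((List.range n).map V))
        ((List.range n).map V)) = ∑ l ∈ Finset.range n, if P l then f l else 0 := by
  have hnum : headNumZ (satC W) e h x ((List.range n).map V) =
      (List.range n).map (fun l => if P l then (1 : ℤ) else 0) := by
    rw [headNumZ, hh, numeratorsZ, cond_true, List.map_map, List.map_map]
    apply List.map_congr_left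
    intro l hl
    have hl := List.mem_range.1 hl
    have h1 : (((List.range n).map V).map (fun y => scoreZ (satC W) h x y)).all
        (fun b => decide (b ≤ scoreZ (satC W) h x (V l))) = decide (P l) := by
      rw [Bool.eq_iff_iff, decide_eq_true_eq, hP l hl]
      simp only [List.all_map, List.all_eq_true, List.mem_range, Function.comp,
        decide_eq_true_eq]
      exact forall₂_congr fun k hk => by rw [hS k hk, hS l hl]
    simp only [Function.comp]
    rw [h1, reprZ_satC, clamp_eq (inRange_one hW)]
    by_cases h2 : P l <;> simp [h2]
  have hpos : 0 < sumZ (satC W) (headNumZ (satC W) e h x ((List.range n).map V)) := by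
    rw [hnum]
    apply sumZ_pos hW
    · intro a ha
      obtain ⟨l, -, rfl⟩ := List.mem_map.1 ha
      by_cases h2 : P l <;> simp [h2]
    · obtain ⟨l, hl, h2⟩ := hex
      exact List.mem_map.2 ⟨l, List.mem_range.2 hl, by simp [h2]⟩
  generalize sumZ (satC W) (headNumZ (satC W) e h x ((List.range n).map V)) = s at hpos ⊢
  rw [hnum, List.zipWith_map, List.zipWith_self, ← sumZ_range hr]
  congr 1
  apply List.map_congr_left
  intro l hl
  have hl := List.mem_range.1 hl
  rw [termZ, hf l hl]
  by_cases h2 : P l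
  · simp [h2, divZ_one_satC hW hpos, mulZ_satC, clamp_eq (hr0 l hl)]
  · simp [h2, divZ_zero_satC, mulZ_satC, clamp_eq (inRange_zero W)]

/-- If only the position `m` has the maximal score, then the projected vector at `m` is
fetched. -/
theorem pool_row_single {W : ℕ} (hW : 1 ≤ W) {e n m : ℕ} (hm : m < n) {h : HeadC}
    (hh : h.2.1 = true) {x : List ℤ} {V : ℕ → List ℤ} {S f : ℕ → ℤ} {row : List RatC}
    (hS : ∀ l < n, scoreZ (satC W) h x (V l) = S l)
    (hf : ∀ l < n, dotZ (satC W) (row.map (fun q => reprZ (satC W) q.1 q.2)) (V l) = f l)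
    (hmax : ∀ l < n, l ≠ m → S l < S m) (hr0 : ∀ l < n, InRange W (f l)) :
    sumZ (satC W) (List.zipWith
      (fun a y => termZ (satC W) row (sumZ (satC W) (headNumZ (satC W) e h x
        ((List.range n).map V))) a y) (headNumZ (satC W) e h x ((List.range n).map V))
        ((List.range n).map V)) = f m := by
  have hsum : ∀ k, (∑ l ∈ Finset.range k, if l = m then f l else 0) = if m < k then f m else 0 := by
    intro k
    rw [Finset.sum_ite_eq' (Finset.range k) m f]
    simp
  rw [pool_row hW hh (P := fun l => l = m) hS hf ?_ ⟨m, hm, rfl⟩ hr0 ?_, hsum, if_pos hm]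
  · intro l hl
    constructor
    · rintro rfl k hk
      by_cases hkl : k = l
      · rw [hkl]
      · exact (hmax k hk hkl).le
    · intro h1
      by_contra h2
      exact absurd (h1 m hm) (not_le.2 (hmax l hl h2))
  · intro k _
    rw [hsum]
    split_ifs
    · exact hr0 m hm
    · exact inRange_zero W

/-- If the positions up to `m` are those with the maximal score, then the projected vectors, when
small, are summed up to the position `m`. -/
theorem pool_row_prefix {W : ℕ} (hW : 1 ≤ W) {e n m : ℕ} (hm : m < n) (hn : (n : ℤ) ≤ 2 ^ W - 1)
    {h : HeadC} (hh : h.2.1 = true) {x : List ℤ} {V : ℕ → List ℤ} {f : ℕ → ℤ} {row : List RatC}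
    (hS : ∀ l < n, scoreZ (satC W) h x (V l) = if l ≤ m then 1 else 0)
    (hf : ∀ l < n, dotZ (satC W) (row.map (fun q => reprZ (satC W) q.1 q.2)) (V l) = f l)
    (hr0 : ∀ l < n, |f l| ≤ 1) :
    sumZ (satC W) (List.zipWith
      (fun a y => termZ (satC W) row (sumZ (satC W) (headNumZ (satC W) e h x
        ((List.range n).map V))) a y) (headNumZ (satC W) e h x ((List.range n).map V))
        ((List.range n).map V)) = ∑ l ∈ Finset.range (m + 1), f l := by
  have hrange : ∀ k ≤ n, InRange W (∑ l ∈ Finset.range k, if l ≤ m then f l else 0) := by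
    intro k hk
    have h1 : |∑ l ∈ Finset.range k, if l ≤ m then f l else 0| ≤ k := by
      refine (Finset.abs_sum_le_sum_abs _ _).trans ?_
      refine (Finset.sum_le_card_nsmul _ _ 1 fun l hl => ?_).trans (by simp)
      have := hr0 l (by have := Finset.mem_range.1 hl; omega)
      split_ifs <;> simp [this]
    have h2 := abs_le.1 h1
    constructor <;> omega
  rw [pool_row hW hh (P := fun l => l ≤ m) hS hf ?_ ⟨m, hm, le_rfl⟩ ?_ hrange]
  · rw [← Finset.sum_filter]
    congr 1
    ext l
    simp; omega
  · intro l hl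
    constructor
    · intro h1 k _
      rw [if_pos h1]
      split_ifs <;> simp
    · intro h1
      have := h1 0 (by omega)
      by_contra h2
      simp [h2] at this
  · intro l hl
    have h1 := abs_le.1 (hr0 l hl)
    constructor <;> omega

/-! ### An encoder that checks traces -/

/-- A record of one step of a machine with numbered states and symbols: state and symbol read, new
state and symbol written, and the displacement `d` of the head, `1` to the right, `-1` to the left,
and `0` for a left move on the leftmost cell. -/
structure Rec where
  q : ℤ
  g : ℤ
  q' : ℤ
  g' : ℤ
  d : ℤ

/-- The data of a machine that enter into the encoder. -/
structure Spec where
  recs : List Rec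
  start : ℤ
  accept : ℤ
  blank : ℤ
  bit : Bool → ℤ

/-- The head position before step `m` of a sequence of records. -/
def headPos (ρ : ℕ → Rec) (m : ℕ) : ℤ := ∑ l ∈ Finset.range m, (ρ l).d

/-- The content of the cell `c` before step `m`, if the tape initially contains `init`. -/
def content (init : ℤ → ℤ) (ρ : ℕ → Rec) : ℕ → ℤ → ℤ
  | 0, c => init c
  | m + 1, c => if headPos ρ m = c then (ρ m).g' else content init ρ m c

/-- Step `m` is consistent with the preceding ones. -/
def StepOK (S : Spec) (init : ℤ → ℤ) (ρ : ℕ → Rec) (m : ℕ) : Prop :=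
  (ρ m).q = (if m = 0 then S.start else (ρ (m - 1)).q') ∧
    (ρ m).g = content init ρ m (headPos ρ m) ∧ ((ρ m).d = 0 → headPos ρ m ≤ 0) ∧
    ((ρ m).d = -1 → 1 ≤ headPos ρ m)

/-- The tape that contains the input `x`. -/
def initTape (S : Spec) (x : List Bool) (c : ℤ) : ℤ :=
  if 0 ≤ c then (x[c.toNat]?).elim S.blank S.bit else S.blank

theorem content_of_forall_ne {init : ℤ → ℤ} {ρ : ℕ → Rec} {m : ℕ} {c : ℤ}
    (h : ∀ l < m, headPos ρ l ≠ c) : content init ρ m c = init c := by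
  induction m with
  | zero => rfl
  | succ m ih =>
    rw [content, if_neg (h m (by omega)), ih fun l hl => h l (by omega)]

theorem content_of_last {init : ℤ → ℤ} {ρ : ℕ → Rec} {l m : ℕ} {c : ℤ} (hl : l < m)
    (hc : headPos ρ l = c) (h : ∀ k, l < k → k < m → headPos ρ k ≠ c) :
    content init ρ m c = (ρ l).g' := by
  induction m with
  | zero => omega
  | succ m ih =>
    rw [content]
    by_cases hlm : l = m
    · rw [← hlm, if_pos hc]
    · rw [if_neg (h m (by omega) (by omega)), ih (by omega) fun k h1 h2 => h k h1 (by omega)]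

/-! Codes of instructions. -/

def constG (a : ℤ) : GateC := (0, (a, 1), 0, 0, 0, 0)

def addG (i j : ℕ) : GateC := (1, (0, 1), i, j, 0, 0)

def subG (i j : ℕ) : GateC := (2, (0, 1), i, j, 0, 0)

def iteG (i j k l : ℕ) : GateC := (5, (0, 1), i, j, k, l)

/-- The row of a matrix that selects a coordinate. -/
def unitRow (d i : ℕ) : List RatC := (List.range d).map (fun j => (if j = i then 1 else 0, 1))

/-- The embedding: position, and the entries of the record. -/
def embP (r : Rec) : ProgC :=
  ([constG r.q, constG r.g, constG r.q', constG r.g', constG r.d], [0, 1, 2, 3, 4, 5])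

/-- Score `1` for the positions up to the own one, in dimension `d`. -/
def prefixScore (d : ℕ) : ProgC :=
  ([constG 1, constG 0, iteG d 0 (2 * d) (2 * d + 1)], [2 * d + 2])

/-- The first layer computes the head position, and initialises a tape symbol and a counter. -/
def headLayer (S : Spec) : LayerC :=
  ([(prefixScore 6, true, [unitRow 6 5])],
    ([subG 6 5, constG S.blank, constG 0], [0, 1, 2, 3, 4, 5, 7, 8, 9]))

/-- The layer for a bit of the input: the tape symbol becomes `b` if the counter is the head
position, and the counter is incremented. -/
def bitLayer (S : Spec) (b : Bool) : LayerC :=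
  ([], ([constG (S.bit b), constG 1, iteG 8 6 9 7, iteG 6 8 11 7, addG 8 10],
    [0, 1, 2, 3, 4, 5, 6, 12, 13]))

/-- The score that singles out the predecessor of the own position, if it exists, and else the own
position. -/
def prevScore : ProgC :=
  ([constG 0, constG 1, constG (-1), addG 9 19, iteG 9 0 18 20, iteG 0 9 22 20, iteG 21 0 19 23,
    iteG 0 21 24 23], [25])

/-- The score that singles out the last earlier visit of the cell, if it exists, and else the own
position. -/
def visitScore : ProgC :=
  ([constG 0, constG (-1), iteG 6 15 9 19, iteG 15 6 20 19, iteG 9 0 18 19, iteG 0 9 22 21], [23])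

/-- The layer that computes whether a step is inconsistent with the preceding ones. -/
def checkLayer (S : Spec) : LayerC :=
  ([(prevScore, true, [unitRow 9 3]), (visitScore, true, [unitRow 9 0, unitRow 9 4])],
    ([constG 0, constG 1, constG S.start,
      iteG 0 13 14 9, iteG 0 10 7 11,
      iteG 1 15 12 13, iteG 15 1 17 13, iteG 2 16 18 13, iteG 16 2 19 13,
      iteG 6 12 20 13, iteG 13 6 20 13, iteG 12 5 21 22, iteG 5 12 23 20], [0, 1, 24]))

/-- The last layer counts the inconsistent steps. -/
def countLayer : LayerC :=
  ([(prefixScore 3, true, [unitRow 3 2])], ([], [0, 1, 3]))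

/-- The output is `1` if the last state is accepting, there is no inconsistent step, and the
position is not the largest number. -/
def outP (S : Spec) : ProgC :=
  ([constG 0, constG 1, constG S.accept, addG 0 4, iteG 6 0 3 4, iteG 2 3 7 3, iteG 1 5 8 3,
    iteG 5 1 9 3], [10])

/-- The encoder for the input `x`. -/
def traceTE (S : Spec) (W : ℕ) (x : List Bool) : TEC :=
  (satC W, S.recs.map embP, headLayer S :: (x.map (bitLayer S) ++ [checkLayer S, countLayer]),
    outP S)

/-! Evaluation of the programs. -/

theorem dot_unitRow6 {W : ℕ} (hW : 1 ≤ W) {a0 a1 a2 a3 a4 a5 : ℤ} (h : InRange W a5) :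
    dotZ (satC W) ((unitRow 6 5).map (fun q => reprZ (satC W) q.1 q.2)) [a0, a1, a2, a3, a4, a5] =
      a5 := by
  simp [unitRow, List.range_succ, reprZ_satC, dotZ, sumZ, addZ_satC, mulZ_satC,
    clamp_eq (inRange_zero W), clamp_eq (inRange_one hW), clamp_eq h]

theorem dot_unitRow9_3 {W : ℕ} (hW : 1 ≤ W) {a0 a1 a2 a3 a4 a5 a6 a7 a8 : ℤ} (h : InRange W a3) :
    dotZ (satC W) ((unitRow 9 3).map (fun q => reprZ (satC W) q.1 q.2))
      [a0, a1, a2, a3, a4, a5, a6, a7, a8] = a3 := by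
  simp [unitRow, List.range_succ, reprZ_satC, dotZ, sumZ, addZ_satC, mulZ_satC,
    clamp_eq (inRange_zero W), clamp_eq (inRange_one hW), clamp_eq h]

theorem dot_unitRow9_0 {W : ℕ} (hW : 1 ≤ W) {a0 a1 a2 a3 a4 a5 a6 a7 a8 : ℤ} (h : InRange W a0) :
    dotZ (satC W) ((unitRow 9 0).map (fun q => reprZ (satC W) q.1 q.2))
      [a0, a1, a2, a3, a4, a5, a6, a7, a8] = a0 := by
  simp [unitRow, List.range_succ, reprZ_satC, dotZ, sumZ, addZ_satC, mulZ_satC,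
    clamp_eq (inRange_zero W), clamp_eq (inRange_one hW), clamp_eq h]

theorem dot_unitRow9_4 {W : ℕ} (hW : 1 ≤ W) {a0 a1 a2 a3 a4 a5 a6 a7 a8 : ℤ} (h : InRange W a4) :
    dotZ (satC W) ((unitRow 9 4).map (fun q => reprZ (satC W) q.1 q.2))
      [a0, a1, a2, a3, a4, a5, a6, a7, a8] = a4 := by
  simp [unitRow, List.range_succ, reprZ_satC, dotZ, sumZ, addZ_satC, mulZ_satC,
    clamp_eq (inRange_zero W), clamp_eq (inRange_one hW), clamp_eq h]

theorem dot_unitRow3 {W : ℕ} (hW : 1 ≤ W) {a0 a1 a2 : ℤ} (h : InRange W a2) :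
    dotZ (satC W) ((unitRow 3 2).map (fun q => reprZ (satC W) q.1 q.2)) [a0, a1, a2] =
      a2 := by
  simp [unitRow, List.range_succ, reprZ_satC, dotZ, sumZ, addZ_satC, mulZ_satC,
    clamp_eq (inRange_zero W), clamp_eq (inRange_one hW), clamp_eq h]

section
variable {W : ℕ}

theorem gateZ_const (v : List ℤ) (a : ℤ) : gateZ (satC W) v (constG a) = clamp W a :=
  reprZ_satC W a

theorem gateZ_add (v : List ℤ) (i j : ℕ) :
    gateZ (satC W) v (addG i j) = clamp W (v.getD i 0 + v.getD j 0) :=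
  addZ_satC W _ _

theorem gateZ_sub (v : List ℤ) (i j : ℕ) :
    gateZ (satC W) v (subG i j) = clamp W (v.getD i 0 - v.getD j 0) :=
  subZ_satC W _ _

theorem gateZ_ite (v : List ℤ) (i j k l : ℕ) :
    gateZ (satC W) v (iteG i j k l) =
      if v.getD i 0 ≤ v.getD j 0 then v.getD k 0 else v.getD l 0 := by
  by_cases h : v.getD i 0 ≤ v.getD j 0
  · rw [if_pos h]; simp only [gateZ, iteG, h]; rfl
  · rw [if_neg h]; simp only [gateZ, iteG, h]; rfl

theorem ite_and_eq (a b x y : ℤ) :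
    (if a ≤ b then if b ≤ a then x else y else y) = if a = b then x else y := by
  split_ifs <;> first | rfl | omega

theorem emb_eval {r : Rec} (hq : InRange W r.q) (hg : InRange W r.g) (hq' : InRange W r.q')
    (hg' : InRange W r.g') (hd : InRange W r.d) (p : ℤ) :
    progZ (satC W) (embP r) [p] = [p, r.q, r.g, r.q', r.g', r.d] := by
  simp [progZ, embP, gateZ_const, clamp_eq hq, clamp_eq hg, clamp_eq hq', clamp_eq hg',
    clamp_eq hd]

theorem headLayer_eval {S : Spec} (hb : InRange W S.blank) (a0 a1 a2 a3 a4 a5 s : ℤ)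
    (h : InRange W (s - a5)) :
    progZ (satC W) (headLayer S).2 [a0, a1, a2, a3, a4, a5, s] =
      [a0, a1, a2, a3, a4, a5, s - a5, S.blank, 0] := by
  simp [progZ, headLayer, gateZ_const, gateZ_sub, clamp_eq hb, clamp_eq (inRange_zero W),
    clamp_eq h]

theorem bitLayer_eval {S : Spec} {b : Bool} (hb : InRange W (S.bit b)) (hW : 1 ≤ W)
    (a0 a1 a2 a3 a4 a5 h s c : ℤ) (hc : InRange W (c + 1)) :
    progZ (satC W) (bitLayer S b).2 [a0, a1, a2, a3, a4, a5, h, s, c] =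
      [a0, a1, a2, a3, a4, a5, h, if h = c then S.bit b else s, c + 1] := by
  simp [progZ, bitLayer, gateZ_const, gateZ_add, gateZ_ite, clamp_eq hb, clamp_eq (inRange_one hW),
    clamp_eq hc, ite_and_eq]

theorem prefixScore6_eval (hW : 1 ≤ W) (a0 a1 a2 a3 a4 a5 b0 b1 b2 b3 b4 b5 : ℤ) :
    progZ (satC W) (prefixScore 6) [a0, a1, a2, a3, a4, a5, b0, b1, b2, b3, b4, b5] =
      [if b0 ≤ a0 then 1 else 0] := by
  simp [progZ, prefixScore, gateZ_const, gateZ_ite, clamp_eq (inRange_zero W),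
    clamp_eq (inRange_one hW)]

theorem prefixScore3_eval (hW : 1 ≤ W) (a0 a1 a2 b0 b1 b2 : ℤ) :
    progZ (satC W) (prefixScore 3) [a0, a1, a2, b0, b1, b2] = [if b0 ≤ a0 then 1 else 0] := by
  simp [progZ, prefixScore, gateZ_const, gateZ_ite, clamp_eq (inRange_zero W),
    clamp_eq (inRange_one hW)]

theorem inRange_neg_one (W : ℕ) : InRange W (-1) := by
  have : (0 : ℤ) < 2 ^ W := by positivity
  constructor <;> omega

theorem prevScore_eval (hW : 1 ≤ W) (a0 a1 a2 a3 a4 a5 a6 a7 a8 b0 b1 b2 b3 b4 b5 b6 b7 b8 : ℤ)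
    (h : InRange W (b0 + 1)) :
    progZ (satC W) prevScore [a0, a1, a2, a3, a4, a5, a6, a7, a8, b0, b1, b2, b3, b4, b5, b6,
      b7, b8] = [if b0 + 1 = a0 then 1 else if a0 = b0 then 0 else -1] := by
  simp [progZ, prevScore, gateZ_const, gateZ_ite, gateZ_add, clamp_eq (inRange_zero W),
    clamp_eq (inRange_one hW), clamp_eq (inRange_neg_one W), clamp_eq h]
  split_ifs <;> first | rfl | omega

theorem visitScore_eval (a0 a1 a2 a3 a4 a5 a6 a7 a8 b0 b1 b2 b3 b4 b5 b6 b7 b8 : ℤ) :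
    progZ (satC W) visitScore [a0, a1, a2, a3, a4, a5, a6, a7, a8, b0, b1, b2, b3, b4, b5, b6,
      b7, b8] = [if b0 < a0 then (if a6 = b6 then b0 else -1) else if b0 = a0 then 0 else -1] := by
  simp [progZ, visitScore, gateZ_const, gateZ_ite, clamp_eq (inRange_zero W),
    clamp_eq (inRange_neg_one W)]
  split_ifs <;> first | rfl | omega

theorem checkLayer_eval {S : Spec} (hs : InRange W S.start) (hW : 1 ≤ W)
    (p q g q' g' d h s c pq vp vg : ℤ) :
    progZ (satC W) (checkLayer S).2 [p, q, g, q', g', d, h, s, c, pq, vp, vg] =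
      [p, q, if q = (if p ≤ 1 then S.start else pq) ∧ g = (if p ≤ vp then s else vg) ∧
        (d = 0 → h ≤ 0) ∧ (d < 0 → 1 ≤ h) then 0 else 1] := by
  simp [progZ, checkLayer, gateZ_const, gateZ_ite, clamp_eq (inRange_zero W),
    clamp_eq (inRange_one hW), clamp_eq hs]
  generalize (if p ≤ 1 then S.start else pq) = x
  generalize (if p ≤ vp then s else vg) = y
  by_cases h1 : q = x <;> by_cases h2 : g = y <;> split_ifs <;> omega

theorem outP_eval {S : Spec} (hs : InRange W S.accept) (hW : 1 ≤ W) (p q b : ℤ) :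
    progZ (satC W) (outP S) [p, q, b] =
      [if p < clamp W (p + 1) ∧ b ≤ 0 ∧ q = S.accept then 1 else 0] := by
  simp [progZ, outP, gateZ_const, gateZ_ite, gateZ_add, clamp_eq (inRange_zero W),
    clamp_eq (inRange_one hW), clamp_eq hs]
  split_ifs <;> omega

end

/-! ### The value of the trace encoder -/

/-- The numbers of a record are numbers of the arithmetic. -/
structure Rec.Fits (W : ℕ) (r : Rec) : Prop where
  q : InRange W r.q
  g : InRange W r.g
  q' : InRange W r.q'
  g' : InRange W r.g'
  d : r.d = 1 ∨ r.d = 0 ∨ r.d = -1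

/-- The numbers of a machine are numbers of the arithmetic. -/
structure Spec.Fits (W : ℕ) (S : Spec) : Prop where
  pos : 1 ≤ W
  recs : ∀ r ∈ S.recs, r.Fits W
  start : InRange W S.start
  accept : InRange W S.accept
  blank : InRange W S.blank
  bit : ∀ b, InRange W (S.bit b)

theorem Rec.Fits.abs_d {W : ℕ} {r : Rec} (h : r.Fits W) : |r.d| ≤ 1 := by
  rcases h.d with h | h | h <;> simp [h]

theorem layerZ_range {c : ArithC} {e n : ℕ} {l : LayerC} {V V' : ℕ → List ℤ}
    (h : ∀ m < n, progZ c l.2 (V m ++ l.1.flatMap (fun h => poolZ c e h (V m)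
      ((List.range n).map V))) = V' m) :
    layerZ c e l ((List.range n).map V) = (List.range n).map V' := by
  rw [layerZ, List.map_map]
  exact List.map_congr_left fun m hm => h m (List.mem_range.1 hm)

section
variable {W n e : ℕ} {S : Spec} {ρ : ℕ → Rec}

theorem abs_headPos_le (hρ : ∀ l < n, (ρ l).Fits W) {m : ℕ} (hm : m ≤ n) : |headPos ρ m| ≤ m := by
  refine (Finset.abs_sum_le_sum_abs _ _).trans ?_
  refine (Finset.sum_le_card_nsmul _ _ 1 fun l hl => ?_).trans (by simp)
  exact (hρ l (by have := Finset.mem_range.1 hl; omega)).abs_d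

theorem inRange_of_abs_le {k : ℤ} (hn : (n : ℤ) ≤ 2 ^ W - 1) (h : |k| ≤ n) : InRange W k := by
  have := abs_le.1 h
  constructor <;> omega

theorem headLayer_range (hS : S.Fits W) (hn : (n : ℤ) ≤ 2 ^ W - 1)
    (hρ : ∀ l < n, (ρ l).Fits W) :
    layerZ (satC W) e (headLayer S) ((List.range n).map fun m : ℕ =>
      [(m : ℤ) + 1, (ρ m).q, (ρ m).g, (ρ m).q', (ρ m).g', (ρ m).d]) =
    (List.range n).map fun m : ℕ => [(m : ℤ) + 1, (ρ m).q, (ρ m).g, (ρ m).q', (ρ m).g', (ρ m).d,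
      headPos ρ m, S.blank, 0] := by
  apply layerZ_range
  intro m hm
  have h1 : (headLayer S).1.flatMap (fun h => poolZ (satC W) e h
      [(m : ℤ) + 1, (ρ m).q, (ρ m).g, (ρ m).q', (ρ m).g', (ρ m).d] ((List.range n).map fun m : ℕ =>
      [(m : ℤ) + 1, (ρ m).q, (ρ m).g, (ρ m).q', (ρ m).g', (ρ m).d])) = [headPos ρ (m + 1)] := by
    refine congrArg (fun s => [s]) (pool_row_prefix hS.pos hm hn rfl (f := fun l => (ρ l).d)
      ?_ ?_ fun l hl => (hρ l hl).abs_d)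
    · intro l _
      have := prefixScore6_eval hS.pos ((m : ℤ) + 1) (ρ m).q (ρ m).g (ρ m).q' (ρ m).g' (ρ m).d
        ((l : ℤ) + 1) (ρ l).q (ρ l).g (ρ l).q' (ρ l).g' (ρ l).d
      rw [scoreZ]
      refine (congrArg (fun v => List.headD v 0) this).trans ?_
      simp
    · intro l hl
      exact dot_unitRow6 hS.pos
        (inRange_of_abs_le hn ((hρ l hl).abs_d.trans (by exact_mod_cast (by omega : 1 ≤ n))))
  have h2 : headPos ρ (m + 1) - (ρ m).d = headPos ρ m := by
    rw [headPos, Finset.sum_range_succ, ← headPos]; ring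
  have h3 := headLayer_eval hS.blank ((m : ℤ) + 1) (ρ m).q (ρ m).g (ρ m).q' (ρ m).g' (ρ m).d
    (headPos ρ (m + 1)) (by
      rw [h2]
      refine inRange_of_abs_le hn ((abs_headPos_le hρ hm.le).trans (by exact_mod_cast hm.le)))
  rw [h1]
  rw [h2] at h3
  exact h3

/-- The symbol after the layers for the bits `x`, if the counter was `c`. -/
def bitsFrom (S : Spec) : List Bool → ℤ → ℤ → ℤ → ℤ
  | [], _, _, s => s
  | b :: x, h, c, s => bitsFrom S x h (c + 1) (if h = c then S.bit b else s)

theorem bitsFrom_eq (S : Spec) (x : List Bool) (h c s : ℤ) :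
    bitsFrom S x h c s = if c ≤ h then (x[(h - c).toNat]?).elim s S.bit else s := by
  induction x generalizing c s with
  | nil => simp [bitsFrom]
  | cons b x ih =>
    rw [bitsFrom, ih]
    rcases lt_trichotomy h c with h1 | rfl | h1
    · rw [if_neg (by omega : ¬ c + 1 ≤ h), if_neg h1.ne, if_neg (by omega)]
    · rw [if_neg (by omega), if_pos rfl, if_pos le_rfl]
      simp
    · have h2 : (h - c).toNat = (h - (c + 1)).toNat + 1 := by omega
      rw [if_pos (by omega : c + 1 ≤ h), if_neg h1.ne', if_pos h1.le, h2, List.getElem?_cons_succ]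

theorem bitLayers_range (hS : S.Fits W) (x : List Bool) {c : ℕ} {s : ℕ → ℤ}
    (hx : (c + x.length : ℤ) ≤ 2 ^ W - 1) :
    layersZ (satC W) e (x.map (bitLayer S)) ((List.range n).map fun m : ℕ => [(m : ℤ) + 1, (ρ m).q,
      (ρ m).g, (ρ m).q', (ρ m).g', (ρ m).d, headPos ρ m, s m, c]) =
    (List.range n).map fun m : ℕ => [(m : ℤ) + 1, (ρ m).q, (ρ m).g, (ρ m).q', (ρ m).g', (ρ m).d,
      headPos ρ m, bitsFrom S x (headPos ρ m) c (s m), c + x.length] := by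
  induction x generalizing c s with
  | nil => simp [layersZ, bitsFrom]
  | cons b x ih =>
    have hlen : ((b :: x).length : ℤ) = x.length + 1 := by simp
    rw [hlen] at hx ⊢
    have h1 : layerZ (satC W) e (bitLayer S b) ((List.range n).map fun m : ℕ => [(m : ℤ) + 1, (ρ m).q,
        (ρ m).g, (ρ m).q', (ρ m).g', (ρ m).d, headPos ρ m, s m, c]) =
        (List.range n).map fun m : ℕ => [(m : ℤ) + 1, (ρ m).q,
        (ρ m).g, (ρ m).q', (ρ m).g', (ρ m).d, headPos ρ m,
        if headPos ρ m = c then S.bit b else s m, (c : ℤ) + 1] := by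
      apply layerZ_range
      intro m _
      refine bitLayer_eval (hS.bit b) hS.pos _ _ _ _ _ _ _ _ _ ?_
      have := (inRange_zero W).1
      constructor <;> omega
    have h2 := ih (c := c + 1) (s := fun m => if headPos ρ m = c then S.bit b else s m)
      (by push_cast; omega)
    rw [List.map_cons, layersZ, List.foldl_cons, h1, ← layersZ]
    push_cast at h2
    rw [h2]
    apply List.map_congr_left
    intro m _
    rw [bitsFrom, add_comm (x.length : ℤ) 1, add_assoc]

open Classical in
theorem checkLayer_range (hS : S.Fits W) (hn : (n : ℤ) + 1 ≤ 2 ^ W - 1)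
    (hρ : ∀ l < n, (ρ l).Fits W) (init : ℤ → ℤ) (k : ℤ) :
    layerZ (satC W) e (checkLayer S) ((List.range n).map fun m : ℕ =>
      [(m : ℤ) + 1, (ρ m).q, (ρ m).g, (ρ m).q', (ρ m).g', (ρ m).d, headPos ρ m,
        init (headPos ρ m), k]) =
    (List.range n).map fun m : ℕ => [(m : ℤ) + 1, (ρ m).q, if StepOK S init ρ m then 0 else 1] := by
  apply layerZ_range
  intro m hm
  set V : ℕ → List ℤ := fun m => [(m : ℤ) + 1, (ρ m).q, (ρ m).g, (ρ m).q', (ρ m).g', (ρ m).d,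
    headPos ρ m, init (headPos ρ m), k] with hV
  have hmW : ∀ l < n, InRange W ((l : ℤ) + 1) := fun l hl => by
    have := (inRange_zero W).1
    constructor <;> omega
  have hmW' : ∀ l < n, InRange W ((l : ℤ) + 1 + 1) := fun l hl => by
    have := (inRange_zero W).1
    constructor <;> omega
  have hprev : poolZ (satC W) e (prevScore, true, [unitRow 9 3]) (V m) ((List.range n).map V) =
      [(ρ (m - 1)).q'] := by
    refine congrArg (fun s => [s]) (pool_row_single hS.pos (m := m - 1) (by omega) rfl
      (S := fun l => if (l : ℤ) + 1 + 1 = m + 1 then 1 else if (m : ℤ) + 1 = l + 1 then 0 else -1)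
      (f := fun l => (ρ l).q') ?_ ?_ ?_ fun l hl => (hρ l hl).q')
    · intro l hl
      have := prevScore_eval hS.pos ((m : ℤ) + 1) (ρ m).q (ρ m).g (ρ m).q' (ρ m).g' (ρ m).d
        (headPos ρ m) (init (headPos ρ m)) k ((l : ℤ) + 1) (ρ l).q (ρ l).g (ρ l).q' (ρ l).g'
        (ρ l).d (headPos ρ l) (init (headPos ρ l)) k (hmW' l hl)
      rw [scoreZ]
      exact congrArg (fun v => List.headD v 0) this
    · intro l hl
      exact dot_unitRow9_3 hS.pos (hρ l hl).q'
    · intro l _ hlm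
      split_ifs <;> omega
  -- the position whose symbol is found by the second head
  obtain ⟨v, hvm, hv1, hv2⟩ : ∃ v ≤ m, (v < m → headPos ρ v = headPos ρ m) ∧
      ∀ l < m, headPos ρ l = headPos ρ m → v < m ∧ l ≤ v := by
    by_cases hex : ∃ l < m, headPos ρ l = headPos ρ m
    · obtain ⟨l0, hl0, hl0'⟩ := hex
      have hb : (Finset.filter (fun l => headPos ρ l = headPos ρ m) (Finset.range m)).Nonempty :=
        ⟨l0, by simp [hl0, hl0']⟩
      have hmem := Finset.max'_mem _ hb
      rw [Finset.mem_filter, Finset.mem_range] at hmem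
      refine ⟨_, hmem.1.le, fun _ => hmem.2, fun l hl h => ⟨hmem.1, ?_⟩⟩
      exact Finset.le_max' _ _ (by simp [hl, h])
    · push Not at hex
      exact ⟨m, le_rfl, fun h => by omega, fun l hl h => absurd h (hex l hl)⟩
  have hscore : ∀ l < n, scoreZ (satC W) (visitScore, true, [unitRow 9 0, unitRow 9 4]) (V m)
      (V l) = if l < m then (if headPos ρ m = headPos ρ l then (l : ℤ) + 1 else -1)
        else if l = m then 0 else -1 := by
    intro l hl
    have := visitScore_eval (W := W) ((m : ℤ) + 1) (ρ m).q (ρ m).g (ρ m).q' (ρ m).g' (ρ m).d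
      (headPos ρ m) (init (headPos ρ m)) k ((l : ℤ) + 1) (ρ l).q (ρ l).g (ρ l).q' (ρ l).g'
      (ρ l).d (headPos ρ l) (init (headPos ρ l)) k
    rw [scoreZ]
    refine (congrArg (fun v => List.headD v 0) this).trans ?_
    simp
  have hmax : ∀ l < n, l ≠ v → (fun l : ℕ => if l < m then
      (if headPos ρ m = headPos ρ l then (l : ℤ) + 1 else -1) else if l = m then 0 else -1) l <
      (fun l : ℕ => if l < m then (if headPos ρ m = headPos ρ l then (l : ℤ) + 1 else -1)
        else if l = m then 0 else -1) v := by
    intro l _ hlv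
    dsimp only
    have h2 := hv2 l
    by_cases hvm' : v < m
    · rw [if_pos hvm', if_pos (hv1 hvm').symm]
      split_ifs with h3 h4 h5
      · have := (h2 h3 h4.symm).2; omega
      · omega
      · omega
      · omega
    · obtain rfl : v = m := by omega
      rw [if_neg (lt_irrefl _), if_pos rfl]
      split_ifs with h3 h4
      · have := (h2 h3 h4.symm).1; omega
      · omega
      · omega
  have hvisit : poolZ (satC W) e (visitScore, true, [unitRow 9 0, unitRow 9 4]) (V m)
      ((List.range n).map V) = [(v : ℤ) + 1, (ρ v).g'] := by
    refine congrArg₂ (fun s t => [s, t]) ?_ ?_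
    · refine pool_row_single hS.pos (m := v) (by omega) rfl (f := fun l => (l : ℤ) + 1)
        hscore ?_ hmax hmW
      intro l hl
      exact dot_unitRow9_0 hS.pos (hmW l hl)
    · refine pool_row_single hS.pos (m := v) (by omega) rfl (f := fun l => (ρ l).g')
        hscore ?_ hmax fun l hl => (hρ l hl).g'
      intro l hl
      exact dot_unitRow9_4 hS.pos (hρ l hl).g'
  have hcontent : (if (m : ℤ) + 1 ≤ (v : ℤ) + 1 then init (headPos ρ m) else (ρ v).g') =
      content init ρ m (headPos ρ m) := by
    by_cases hvm' : v < m
    · rw [if_neg (by omega), content_of_last hvm' (hv1 hvm')]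
      intro l h1 h2 h3
      have := (hv2 l h2 h3).2
      omega
    · rw [if_pos (by omega), content_of_forall_ne]
      intro l h1 h2
      exact hvm' (hv2 l h1 h2).1
  have heval := checkLayer_eval hS.start hS.pos ((m : ℤ) + 1) (ρ m).q (ρ m).g (ρ m).q' (ρ m).g'
    (ρ m).d (headPos ρ m) (init (headPos ρ m)) k (ρ (m - 1)).q' ((v : ℤ) + 1) (ρ v).g'
  have happ : V m ++ (checkLayer S).1.flatMap (fun h => poolZ (satC W) e h (V m)
      ((List.range n).map V)) = [(m : ℤ) + 1, (ρ m).q, (ρ m).g, (ρ m).q', (ρ m).g', (ρ m).d,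
      headPos ρ m, init (headPos ρ m), k, (ρ (m - 1)).q', (v : ℤ) + 1, (ρ v).g'] := by
    rw [checkLayer, List.flatMap_cons, List.flatMap_cons, hprev, hvisit]
    rfl
  rw [happ, heval, hcontent]
  have h1 : ((m : ℤ) + 1 ≤ 1) ↔ m = 0 := by omega
  have h2 : (ρ m).d < 0 ↔ (ρ m).d = -1 := by
    rcases (hρ m hm).d with h | h | h <;> rw [h] <;> decide
  simp only [h1, h2, StepOK]
  congr

open Classical in
theorem countLayer_range (hW : 1 ≤ W) (hn : (n : ℤ) ≤ 2 ^ W - 1) (P : ℕ → Prop) :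
    layerZ (satC W) e countLayer ((List.range n).map fun m : ℕ => [(m : ℤ) + 1, (ρ m).q,
      if P m then 0 else 1]) =
    (List.range n).map fun m : ℕ => [(m : ℤ) + 1, (ρ m).q,
      ∑ l ∈ Finset.range (m + 1), if P l then 0 else 1] := by
  apply layerZ_range
  intro m hm
  have h1 : countLayer.1.flatMap (fun h => poolZ (satC W) e h [(m : ℤ) + 1, (ρ m).q,
      if P m then 0 else 1] ((List.range n).map fun m : ℕ => [(m : ℤ) + 1, (ρ m).q,
      if P m then 0 else 1])) = [∑ l ∈ Finset.range (m + 1), if P l then (0 : ℤ) else 1] := by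
    refine congrArg (fun s => [s]) (pool_row_prefix hW hm hn rfl
      (f := fun l => if P l then (0 : ℤ) else 1) ?_ ?_ fun l _ => by split_ifs <;> simp)
    · intro l _
      have := prefixScore3_eval hW ((m : ℤ) + 1) (ρ m).q (if P m then 0 else 1)
        ((l : ℤ) + 1) (ρ l).q (if P l then 0 else 1)
      rw [scoreZ]
      refine (congrArg (fun v => List.headD v 0) this).trans ?_
      simp
    · intro l hl
      refine dot_unitRow3 hW ?_
      split_ifs
      · exact inRange_zero W
      · exact inRange_one hW
  rw [h1]
  rfl

end

theorem embedWordZ_range {W : ℕ} {S : Spec} (hS : S.Fits W) {x : List Bool} {w : List ℕ} {ρ : ℕ → Rec}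
    (hn : (w.length : ℤ) ≤ 2 ^ W - 1)
    (hρ : ∀ i < w.length, S.recs[w.getD i 0]? = some (ρ i)) :
    embedWordZ (satC W) (traceTE S W x).2.1 w = (List.range w.length).map fun m : ℕ =>
      [(m : ℤ) + 1, (ρ m).q, (ρ m).g, (ρ m).q', (ρ m).g', (ρ m).d] := by
  rw [embedWordZ]
  apply List.map_congr_left
  intro m hm
  have hm := List.mem_range.1 hm
  have h0 := hρ m hm
  have h1 := hS.recs _ (List.mem_of_getElem? h0)
  have h2 : (traceTE S W x).2.1.getD (w.getD m 0) ([], []) = embP (ρ m) := by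
    rw [List.getD_eq_getElem?_getD, traceTE, List.getElem?_map, h0]
    rfl
  have h3 : InRange W (((m + 1 : ℕ) : ℤ)) := by
    have := (inRange_zero W).1
    constructor <;> omega
  have h4 : InRange W (ρ m).d := by
    rcases h1.d with h | h | h <;> rw [h]
    exacts [inRange_one hS.pos, inRange_zero W, inRange_neg_one W]
  rw [embedZ, h2, reprZ_satC, clamp_eq h3, emb_eval h1.q h1.g h1.q' h1.g' h4]
  push_cast
  rfl

/-- The encoder accepts exactly the consistent sequences of records that end in the accepting
state, as long as their length is less than the largest number of the arithmetic. -/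
theorem evalZ_traceTE {W e : ℕ} {S : Spec} (hS : S.Fits W) {x : List Bool}
    (hx : (x.length : ℤ) ≤ 2 ^ W - 1) {w : List ℕ} (hw : w ≠ [])
    {ρ : ℕ → Rec} (hn : (w.length : ℤ) + 1 ≤ 2 ^ W - 1)
    (hρ : ∀ i < w.length, S.recs[w.getD i 0]? = some (ρ i)) :
    evalZ e (traceTE S W x) w = 1 ↔ (∀ m < w.length, StepOK S (initTape S x) ρ m) ∧
      (ρ (w.length - 1)).q = S.accept := by
  classical
  have hfit : ∀ l < w.length, (ρ l).Fits W := fun l hl =>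
    hS.recs _ (List.mem_of_getElem? (hρ l hl))
  have hpos : 0 < w.length := List.length_pos_iff.2 hw
  have h1 : layersZ (satC W) e (traceTE S W x).2.2.1 (embedWordZ (satC W) (traceTE S W x).2.1 w) =
      (List.range w.length).map fun m : ℕ => [(m : ℤ) + 1, (ρ m).q,
        ∑ l ∈ Finset.range (m + 1), if StepOK S (initTape S x) ρ l then (0 : ℤ) else 1] := by
    have hb := bitLayers_range (e := e) (n := w.length) (ρ := ρ) hS x (c := 0)
      (s := fun _ => S.blank) (by simpa using hx)
    have hc : ∀ m, bitsFrom S x (headPos ρ m) 0 S.blank = initTape S x (headPos ρ m) := by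
      intro m
      rw [bitsFrom_eq, initTape, sub_zero]
    simp only [Nat.cast_zero, zero_add, hc] at hb
    rw [embedWordZ_range hS (by omega) hρ, layersZ, traceTE]
    simp only [List.foldl_cons, List.foldl_append, List.foldl_nil]
    rw [headLayer_range hS (by omega) hfit, ← layersZ, hb, checkLayer_range hS hn hfit,
      countLayer_range hS.pos (by omega)]
  have h2 : ((List.range w.length).map fun m : ℕ => [(m : ℤ) + 1, (ρ m).q,
        ∑ l ∈ Finset.range (m + 1), if StepOK S (initTape S x) ρ l then (0 : ℤ) else 1]).getLastD
      [] = [(w.length : ℤ), (ρ (w.length - 1)).q, ∑ l ∈ Finset.range w.length,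
        if StepOK S (initTape S x) ρ l then (0 : ℤ) else 1] := by
    obtain ⟨k, hk⟩ : ∃ k, w.length = k + 1 := ⟨w.length - 1, by omega⟩
    rw [hk, List.range_succ, List.map_append]
    simp
  have h3 : InRange W ((w.length : ℤ) + 1) := by
    have := (inRange_zero W).1
    constructor <;> omega
  have h4 : (∑ l ∈ Finset.range w.length, if StepOK S (initTape S x) ρ l then (0 : ℤ) else 1) ≤ 0 ↔
      ∀ m < w.length, StepOK S (initTape S x) ρ m := by
    have h5 : ∀ l ∈ Finset.range w.length,
        (0 : ℤ) ≤ if StepOK S (initTape S x) ρ l then (0 : ℤ) else 1 := by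
      intro l _; split_ifs <;> simp
    constructor
    · intro h m hm
      have h6 := (Finset.sum_eq_zero_iff_of_nonneg h5).1 (le_antisymm h (Finset.sum_nonneg h5)) m
        (Finset.mem_range.2 hm)
      by_contra h7
      simp [h7] at h6
    · intro h
      refine (Finset.sum_eq_zero fun l hl => ?_).le
      rw [if_pos (h l (Finset.mem_range.1 hl))]
  have h6 : evalZ e (traceTE S W x) w = if (∀ m < w.length, StepOK S (initTape S x) ρ m) ∧
      (ρ (w.length - 1)).q = S.accept then 1 else 0 := by
    have h7 : (traceTE S W x).2.2.2 = outP S := rfl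
    have h8 : (traceTE S W x).1 = satC W := rfl
    rw [evalZ, h8, h1, h2, h7, outP_eval hS.accept hS.pos, clamp_eq h3]
    simp only [h4, lt_add_one, true_and, List.headD_cons]
  rw [h6]
  simp

/-! Words whose length is not less than the largest number are rejected. -/

theorem progZ_cons (c : ArithC) (g : List GateC) (o : List ℕ) (a : ℤ) (v : List ℤ) :
    progZ c (g, 0 :: o) (a :: v) = a :: (progZ c (g, o) (a :: v)) := by
  have h : ∀ (g : List GateC) (v : List ℤ), ∃ u,
      g.foldl (fun v g => v ++ [gateZ c v g]) (a :: v) = a :: u := by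
    intro g
    induction g with
    | nil => exact fun v => ⟨v, rfl⟩
    | cons b g ih => exact fun v => ih _
  obtain ⟨u, hu⟩ := h g v
  simp only [progZ, hu, List.map_cons, List.getD_cons_zero]

/-- All layers copy the position. -/
theorem layersZ_position {c : ArithC} {e : ℕ} {ls : List LayerC}
    (hls : ∀ l ∈ ls, ∃ o, l.2.2 = 0 :: o) {n : ℕ} {p : ℕ → ℤ} {U : ℕ → List ℤ} :
    ∃ U' : ℕ → List ℤ, layersZ c e ls ((List.range n).map fun m : ℕ => p m :: U m) =
      (List.range n).map fun m : ℕ => p m :: U' m := by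
  induction ls generalizing U with
  | nil => exact ⟨U, rfl⟩
  | cons l ls ih =>
    obtain ⟨o, ho⟩ := hls l (by simp)
    rw [layersZ, List.foldl_cons, ← layersZ]
    have h1 : layerZ c e l ((List.range n).map fun m : ℕ => p m :: U m) =
        (List.range n).map fun m : ℕ => p m :: progZ c (l.2.1, o) (p m :: U m ++ l.1.flatMap
          (fun h => poolZ c e h (p m :: U m) ((List.range n).map fun m : ℕ => p m :: U m))) := by
      apply layerZ_range
      intro m _
      rw [show l.2 = (l.2.1, 0 :: o) from Prod.ext rfl ho]
      exact progZ_cons _ _ _ _ _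
    rw [h1]
    exact ih (fun l' hl' => hls l' (by simp [hl']))

theorem evalZ_traceTE_long {W e : ℕ} {S : Spec} (hS : S.Fits W) {x : List Bool} {w : List ℕ}
    (hn : 2 ^ W - 1 < (w.length : ℤ) + 1) (hw : ∀ a ∈ w, a < S.recs.length) :
    evalZ e (traceTE S W x) w ≠ 1 := by
  have hr := (inRange_one hS.pos).2
  have h0 : ∀ m < w.length, embedZ (satC W) (S.recs.map embP) (w.getD m 0) (m + 1) =
      clamp W ((m + 1 : ℕ) : ℤ) :: (embedZ (satC W) (S.recs.map embP) (w.getD m 0) (m + 1)).tail := by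
    intro m hm
    have h1 : w.getD m 0 < S.recs.length := by
      refine hw _ ?_
      rw [List.getD_eq_getElem?_getD, List.getElem?_eq_getElem hm]
      exact List.getElem_mem hm
    have h2 : (S.recs.map embP).getD (w.getD m 0) ([], []) = embP (S.recs[w.getD m 0]) := by
      rw [List.getD_eq_getElem?_getD, List.getElem?_eq_getElem (by simpa using h1)]
      simp
    rw [embedZ, h2, reprZ_satC, embP, progZ_cons]
    rfl
  have h1 : embedWordZ (satC W) (S.recs.map embP) w = (List.range w.length).map fun m : ℕ =>
      clamp W ((m + 1 : ℕ) : ℤ) ::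
        (embedZ (satC W) (S.recs.map embP) (w.getD m 0) (m + 1)).tail := by
    rw [embedWordZ]
    exact List.map_congr_left fun m hm => h0 m (List.mem_range.1 hm)
  have hlayers : (traceTE S W x).2.2.1 = (headLayer S :: (x.map (bitLayer S) ++ [checkLayer S])) ++
      [countLayer] := by simp [traceTE]
  obtain ⟨U, hU⟩ := layersZ_position (c := satC W) (e := e)
    (ls := headLayer S :: (x.map (bitLayer S) ++ [checkLayer S])) (n := w.length)
    (p := fun m => clamp W ((m + 1 : ℕ) : ℤ))
    (U := fun m => (embedZ (satC W) (S.recs.map embP) (w.getD m 0) (m + 1)).tail) (by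
      intro l hl
      simp only [List.mem_cons, List.mem_append, List.mem_map, List.not_mem_nil, or_false] at hl
      rcases hl with rfl | ⟨b, -, rfl⟩ | rfl <;> exact ⟨_, rfl⟩)
  obtain ⟨k, hk⟩ : ∃ k, w.length = k + 1 := ⟨w.length - 1, by omega⟩
  have hclamp : clamp W ((k + 1 : ℕ) : ℤ) = 2 ^ W - 1 := by
    rw [clamp, min_eq_left (by push_cast; omega), max_eq_right (by omega)]
  have hlast : ∃ a b, (layersZ (satC W) e (traceTE S W x).2.2.1
      (embedWordZ (satC W) (S.recs.map embP) w)).getLastD [] = [2 ^ W - 1, a, b] := by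
    rw [layersZ] at hU
    rw [hlayers, layersZ, List.foldl_append, h1, hU, List.foldl_cons, List.foldl_nil,
      layerZ, List.map_map, hk, List.range_succ, List.map_append]
    simp only [List.map_cons, List.map_nil, List.getLastD_concat, Function.comp, hclamp]
    have key : ∀ v : List ℤ, ∃ a b, progZ (satC W) countLayer.2 ((2 ^ W - 1) :: v) =
        [2 ^ W - 1, a, b] := fun v => ⟨_, _, progZ_cons _ _ _ _ _⟩
    exact key _
  obtain ⟨a, b, hab⟩ := hlast
  have h7 : (traceTE S W x).2.2.2 = outP S := rfl
  have h8 : (traceTE S W x).1 = satC W := rfl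
  have h9 : (traceTE S W x).2.1 = S.recs.map embP := rfl
  have h10 : clamp W (2 ^ W - 1 + 1) = 2 ^ W - 1 := by
    rw [clamp, min_eq_left (by omega), max_eq_right (by omega)]
  rw [evalZ, h8, h9, hab, h7, outP_eval hS.accept hS.pos, h10]
  simp

/-! ### Traces of nondeterministic Turing machines -/

section
variable (M : Complexity.NTM)

/-- A numbering of the states by `0, 1, …`; negative numbers are not codes. -/
noncomputable def stateCode (q : M.State) : ℤ :=
  haveI := M.finite_state
  ((Finite.equivFin M.State q : ℕ) : ℤ)

/-- A numbering of the tape symbols by `0, 1, …`. -/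
noncomputable def symCode (g : M.Sym) : ℤ :=
  haveI := M.finite_sym
  ((Finite.equivFin M.Sym g : ℕ) : ℤ)

theorem stateCode_injective : Function.Injective (stateCode M) := by
  intro a b h
  have := M.finite_state
  exact (Finite.equivFin M.State).injective (Fin.ext (Int.ofNat_inj.1 h))

theorem symCode_injective : Function.Injective (symCode M) := by
  intro a b h
  have := M.finite_sym
  exact (Finite.equivFin M.Sym).injective (Fin.ext (Int.ofNat_inj.1 h))

theorem stateCode_mem (q : M.State) : 0 ≤ stateCode M q ∧ stateCode M q < Nat.card M.State :=
  ⟨by simp [stateCode], by simp [stateCode]⟩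

theorem symCode_mem (g : M.Sym) : 0 ≤ symCode M g ∧ symCode M g < Nat.card M.Sym :=
  ⟨by simp [symCode], by simp [symCode]⟩

/-- A step of the machine: state, symbol read, the action (or none, after the last step), and the
claim that the head is on the leftmost cell, which matters for left moves. -/
abbrev MoveData : Type := M.State × M.Sym × Option (M.State × M.Sym × Turing.Dir) × Bool

/-- The action is allowed. -/
def Allowed (a : MoveData M) : Prop := ∀ b, a.2.2.1 = some b → b ∈ M.delta a.1 a.2.1

/-- The record of a step. Without an action, the new state is given by the number `-1`, which is
not the code of a state, so that no further record can follow. -/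
noncomputable def recOf (a : MoveData M) : Rec :=
  match a.2.2.1 with
  | none => ⟨stateCode M a.1, symCode M a.2.1, -1, 0, 1⟩
  | some (q, g, Turing.Dir.right) =>
    ⟨stateCode M a.1, symCode M a.2.1, stateCode M q, symCode M g, 1⟩
  | some (q, g, Turing.Dir.left) =>
    ⟨stateCode M a.1, symCode M a.2.1, stateCode M q, symCode M g, bif a.2.2.2 then 0 else -1⟩

theorem finite_moveData : Finite (MoveData M) := by
  have := M.finite_state
  have := M.finite_sym
  have : Finite Turing.Dir := by
    refine Finite.of_injective (fun d => decide (d = Turing.Dir.left)) ?_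
    intro a b
    cases a <;> cases b <;> simp
  infer_instance

/-- The data of a machine for the encoder. -/
noncomputable def specOf : Spec where
  recs :=
    haveI := finite_moveData M
    (Set.toFinite {a | Allowed M a}).toFinset.toList.map (recOf M)
  start := stateCode M M.start
  accept := stateCode M M.accept
  blank := symCode M M.blank
  bit b := symCode M (M.bit b)

theorem mem_recs {r : Rec} : r ∈ (specOf M).recs ↔ ∃ a, Allowed M a ∧ recOf M a = r := by
  simp [specOf]

theorem recOf_q (a : MoveData M) : (recOf M a).q = stateCode M a.1 := by
  unfold recOf; split <;> rfl

theorem recOf_g (a : MoveData M) : (recOf M a).g = symCode M a.2.1 := by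
  unfold recOf; split <;> rfl

theorem fits_specOf {W : ℕ} (hW : Nat.card M.State + Nat.card M.Sym ≤ W) :
    (specOf M).Fits W := by
  have h1 : (W : ℤ) < 2 ^ W := by exact_mod_cast Nat.lt_two_pow_self
  have hq : ∀ q, InRange W (stateCode M q) := by
    intro q
    have := stateCode_mem M q
    constructor <;> omega
  have hg : ∀ q, InRange W (symCode M q) := by
    intro q
    have := symCode_mem M q
    constructor <;> omega
  refine ⟨?_, ?_, hq _, hq _, hg _, fun b => hg _⟩
  · have := stateCode_mem M M.start
    omega
  · intro r hr
    obtain ⟨a, -, rfl⟩ := (mem_recs M).1 hr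
    obtain ⟨q, g, o, b⟩ := a
    rcases o with - | ⟨q', g', d⟩
    · exact ⟨hq _, hg _, inRange_neg_one W, inRange_zero W, Or.inl rfl⟩
    · cases d
      · refine ⟨hq _, hg _, hq _, hg _, ?_⟩
        cases b
        · exact Or.inr (Or.inr rfl)
        · exact Or.inr (Or.inl rfl)
      · exact ⟨hq _, hg _, hq _, hg _, Or.inl rfl⟩

end

section
variable {M : Complexity.NTM} {x : List Bool}

/-- The configuration `c` is the one before step `m` of the sequence of records. -/
structure Describes (M : Complexity.NTM) (x : List Bool) (ρ : ℕ → Rec) (m : ℕ)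
    (c : M.Config) : Prop where
  state : stateCode M c.state = if m = 0 then (specOf M).start else (ρ (m - 1)).q'
  head : (c.head : ℤ) = headPos ρ m
  tape : ∀ j : ℕ, symCode M (c.tape j) = content (initTape (specOf M) x) ρ m j

theorem describes_init (ρ : ℕ → Rec) : Describes M x ρ 0 (M.init x) := by
  refine ⟨rfl, by simp [headPos, Complexity.NTM.init], fun j => ?_⟩
  simp only [Complexity.NTM.init, content, initTape, Int.toNat_natCast, specOf,
    if_pos (Int.natCast_nonneg j)]
  cases x[j]? <;> rfl

/-- The displacement in a record and the conditions on it describe the move of the head. -/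
theorem describes_succ {ρ : ℕ → Rec} {m : ℕ} {c c' : M.Config} (hc : Describes M x ρ m c)
    {q : M.State} {g : M.Sym} {a : M.State × M.Sym × Turing.Dir} {b : Bool}
    (hρ : ρ m = recOf M (q, g, some a, b))
    (h0 : (ρ m).d = 0 → headPos ρ m ≤ 0) (h1 : (ρ m).d = -1 → 1 ≤ headPos ρ m)
    (hs : c'.state = a.1) (ht : c'.tape = Function.update c.tape c.head a.2.1)
    (hh : c'.head = Complexity.NTM.moveHead a.2.2 c.head) : Describes M x ρ (m + 1) c' := by
  obtain ⟨q', g', dir⟩ := a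
  have h2 : (ρ m).q' = stateCode M q' := by rw [hρ]; cases dir <;> rfl
  have h3 : (ρ m).g' = symCode M g' := by rw [hρ]; cases dir <;> rfl
  refine ⟨?_, ?_, fun j => ?_⟩
  · rw [hs, if_neg (by omega), Nat.add_sub_cancel, h2]
  · have hsum : headPos ρ (m + 1) = headPos ρ m + (ρ m).d := Finset.sum_range_succ _ _
    have hc2 := hc.head
    rw [hsum, hh]
    cases dir with
    | right =>
      have : (ρ m).d = 1 := by rw [hρ]; rfl
      simp only [Complexity.NTM.moveHead]
      push_cast; omega
    | left =>
      simp only [Complexity.NTM.moveHead]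
      cases b with
      | true =>
        have : (ρ m).d = 0 := by rw [hρ]; rfl
        have := h0 this
        omega
      | false =>
        have : (ρ m).d = -1 := by rw [hρ]; rfl
        have := h1 this
        omega
  · rw [ht, content, ← hc.head]
    by_cases hj : c.head = j
    · subst hj
      simp [h3]
    · rw [Function.update_of_ne (Ne.symm hj), if_neg (by exact_mod_cast hj), hc.tape]

theorem exists_reach {ρ : ℕ → Rec} {n : ℕ} (hρ : ∀ l < n, ρ l ∈ (specOf M).recs)
    (hok : ∀ m < n, StepOK (specOf M) (initTape (specOf M) x) ρ m) {m : ℕ} (hm : m < n) :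
    ∃ c, M.Reach x m c ∧ Describes M x ρ m c := by
  induction m with
  | zero => exact ⟨M.init x, rfl, describes_init ρ⟩
  | succ m ih =>
    obtain ⟨c, hc, hd⟩ := ih (by omega)
    obtain ⟨s1, s2, s3, s4⟩ := hok m (by omega)
    obtain ⟨⟨q, g, o, b⟩, ha, hr⟩ := (mem_recs M).1 (hρ m (by omega))
    have hq : q = c.state := by
      apply stateCode_injective M
      rw [hd.state, ← s1, ← hr, recOf_q]
    have hg : g = c.tape c.head := by
      apply symCode_injective M
      rw [hd.tape, hd.head, ← s2, ← hr, recOf_g]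
    rcases o with - | a
    · have h1 := (hok (m + 1) hm).1
      rw [if_neg (by omega), Nat.add_sub_cancel, ← hr] at h1
      obtain ⟨a', -, hr'⟩ := (mem_recs M).1 (hρ (m + 1) hm)
      rw [← hr', recOf_q] at h1
      have h2 : stateCode M a'.1 = -1 := h1
      have := (stateCode_mem M a'.1).1
      omega
    · refine ⟨⟨a.1, Complexity.NTM.moveHead a.2.2 c.head, Function.update c.tape c.head a.2.1⟩,
        ⟨c, hc, a, ?_, rfl, rfl, rfl⟩, describes_succ hd hr.symm s3 s4 rfl rfl rfl⟩
      rw [← hq, ← hg]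
      exact ha a rfl

section
variable {ρ ρ' : ℕ → Rec} {m : ℕ}

theorem headPos_congr (h : ∀ l < m, ρ l = ρ' l) : headPos ρ m = headPos ρ' m :=
  Finset.sum_congr rfl fun l hl => by rw [h l (Finset.mem_range.1 hl)]

theorem content_congr {init : ℤ → ℤ} (h : ∀ l < m, ρ l = ρ' l) (c : ℤ) :
    content init ρ m c = content init ρ' m c := by
  induction m with
  | zero => rfl
  | succ m ih =>
    rw [content, content, ih fun l hl => h l (by omega),
      headPos_congr fun l hl => h l (by omega), h m (by omega)]

theorem stepOK_congr {S : Spec} {init : ℤ → ℤ} (h : ∀ l ≤ m, ρ l = ρ' l) :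
    StepOK S init ρ m ↔ StepOK S init ρ' m := by
  rw [StepOK, StepOK, headPos_congr fun l hl => h l hl.le, content_congr fun l hl => h l hl.le,
    h m le_rfl]
  cases m with
  | zero => rfl
  | succ m => simp only [Nat.add_sub_cancel, h m (by omega)]

theorem describes_congr {c : M.Config} (h : ∀ l < m, ρ l = ρ' l) (hc : Describes M x ρ m c) :
    Describes M x ρ' m c := by
  refine ⟨?_, ?_, fun j => ?_⟩
  · rw [hc.state]
    cases m with
    | zero => rfl
    | succ m => simp only [Nat.add_sub_cancel, h m (by omega)]
  · rw [hc.head, headPos_congr h]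
  · rw [hc.tape, content_congr h]

end

/-- A sequence of records of a computation can be extended by a consistent record. -/
theorem extend_trace {ρ : ℕ → Rec} {n : ℕ} {c : M.Config}
    (hρ : ∀ l < n, ρ l ∈ (specOf M).recs)
    (hok : ∀ m < n, StepOK (specOf M) (initTape (specOf M) x) ρ m) (hd : Describes M x ρ n c)
    (o : Option (M.State × M.Sym × Turing.Dir)) (b : Bool)
    (ho : ∀ a, o = some a → a ∈ M.delta c.state (c.tape c.head))
    (h0 : (recOf M (c.state, c.tape c.head, o, b)).d = 0 → c.head = 0)
    (h1 : (recOf M (c.state, c.tape c.head, o, b)).d = -1 → 1 ≤ c.head) :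
    ∃ ρ' : ℕ → Rec, (∀ l < n + 1, ρ' l ∈ (specOf M).recs) ∧
      (∀ m < n + 1, StepOK (specOf M) (initTape (specOf M) x) ρ' m) ∧
      ρ' n = recOf M (c.state, c.tape c.head, o, b) ∧ Describes M x ρ' n c := by
  obtain ⟨ρ', h2, h3⟩ : ∃ ρ' : ℕ → Rec, (∀ l < n, ρ l = ρ' l) ∧
      ρ' n = recOf M (c.state, c.tape c.head, o, b) :=
    ⟨Function.update ρ n (recOf M (c.state, c.tape c.head, o, b)),
      fun l hl => by rw [Function.update_of_ne (by omega)], by simp⟩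
  have hd' := describes_congr h2 hd
  refine ⟨ρ', fun l hl => ?_, fun m hm => ?_, h3, hd'⟩
  · by_cases hln : l = n
    · rw [hln, h3]
      exact (mem_recs M).2 ⟨(c.state, c.tape c.head, o, b), ho, rfl⟩
    · rw [← h2 l (by omega)]
      exact hρ l (by omega)
  · by_cases hmn : m = n
    · subst hmn
      refine ⟨?_, ?_, ?_, ?_⟩
      · rw [← hd'.state, h3, recOf_q]
      · rw [← hd'.head, ← hd'.tape, h3, recOf_g]
      · rw [h3, ← hd'.head]
        intro h
        exact_mod_cast (h0 h).le
      · rw [h3, ← hd'.head]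
        intro h
        exact_mod_cast h1 h
    · exact (stepOK_congr fun l hl => h2 l (by omega)).1 (hok m (by omega))

theorem exists_trace {n : ℕ} {c : M.Config} (hc : M.Reach x n c) :
    ∃ ρ : ℕ → Rec, (∀ l < n, ρ l ∈ (specOf M).recs) ∧
      (∀ m < n, StepOK (specOf M) (initTape (specOf M) x) ρ m) ∧ Describes M x ρ n c := by
  induction n generalizing c with
  | zero =>
    obtain rfl : c = M.init x := hc
    exact ⟨fun _ => ⟨0, 0, 0, 0, 0⟩, by simp, by simp, describes_init _⟩
  | succ n ih =>
    obtain ⟨c', hc', ⟨q, g, dir⟩, ha, e1, e2, e3⟩ := hc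
    obtain ⟨ρ, h1, h2, h3⟩ := ih hc'
    obtain ⟨ρ', h4, h5, h6, h7⟩ := extend_trace h1 h2 h3 (some (q, g, dir))
      (decide (c'.head = 0)) (fun b hb => by cases hb; exact ha)
      (by
        cases dir with
        | right => intro h; simp [recOf] at h
        | left => by_cases h : c'.head = 0 <;> simp [recOf, h])
      (by
        cases dir with
        | right => intro h; simp [recOf] at h
        | left =>
          by_cases h : c'.head = 0
          · simp [recOf, h]
          · intro _; omega)
    obtain ⟨-, -, s3, s4⟩ := h5 n (by omega)
    exact ⟨ρ', h4, h5, describes_succ h7 h6 s3 s4 e1 e2 e3⟩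

/-- A machine has an accepting computation if and only if there is a consistent sequence of
records that ends in the accepting state. -/
theorem accepts_iff_trace {N : ℕ} : (∃ n < N, ∃ c, M.Reach x n c ∧ c.state = M.accept) ↔
    ∃ n < N, ∃ ρ : ℕ → Rec, (∀ l < n + 1, ρ l ∈ (specOf M).recs) ∧
      (∀ m < n + 1, StepOK (specOf M) (initTape (specOf M) x) ρ m) ∧
      (ρ n).q = (specOf M).accept := by
  constructor
  · rintro ⟨n, hn, c, hc, ha⟩
    obtain ⟨ρ, h1, h2, h3⟩ := exists_trace hc
    obtain ⟨ρ', h4, h5, h6, -⟩ := extend_trace h1 h2 h3 none false (by simp)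
      (by simp [recOf]) (by simp [recOf])
    refine ⟨n, hn, ρ', h4, h5, ?_⟩
    rw [h6, recOf_q, ha]
    rfl
  · rintro ⟨n, hn, ρ, h1, h2, h3⟩
    obtain ⟨c, hc, hd⟩ := exists_reach h1 h2 (Nat.lt_succ_self n)
    refine ⟨n, hn, c, hc, stateCode_injective M ?_⟩
    rw [hd.state, ← (h2 n (Nat.lt_succ_self n)).1, h3]
    rfl

end

/-! ### Well-formedness of the trace encoder -/

theorem ratOK_int {W : ℕ} {a : ℤ} (h : InRange W a) : ratOK (satC W) (a, 1) = true := by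
  rw [ratOK_iff, representable_iff _ one_pos]
  refine ⟨⟨one_pos, Nat.coprime_one_right _⟩, ?_⟩
  rw [RatOK, reprZ_satC, clamp_eq h]
  simp [val, toRat, unitNum, unitDen, satC]

theorem unitRow_ok {W : ℕ} (hW : 1 ≤ W) (d i : ℕ) :
    (decide ((unitRow d i).length = d) && (unitRow d i).all (fun q => ratOK (satC W) q)) =
      true := by
  simp only [unitRow, List.length_map, List.length_range, decide_true, Bool.true_and,
    List.all_map, List.all_eq_true, Function.comp]
  intro j _
  split_ifs
  · exact ratOK_int (inRange_one hW)
  · exact ratOK_int (inRange_zero W)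

theorem teOK_traceTE {W : ℕ} {S : Spec} (hS : S.Fits W) (hne : S.recs ≠ []) (x : List Bool) :
    teOK (traceTE S W x) = true := by
  have r0 := ratOK_int (inRange_zero W)
  have r1 := ratOK_int (inRange_one hS.pos)
  have rm := ratOK_int (inRange_neg_one W)
  have rs := ratOK_int hS.start
  have ra := ratOK_int hS.accept
  have rb := ratOK_int hS.blank
  have hdim : ((traceTE S W x).2.1.headD ([], [])).2.length = 6 := by
    obtain ⟨r, l, hl⟩ := List.exists_cons_of_ne_nil hne
    simp [traceTE, hl, embP]
  have h1 : layerOK (satC W) 6 (headLayer S) = true := by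
    simp [layerOK, headLayer, headOK, unitRow_ok hS.pos 6 5, progOK, prefixScore, gateOK,
      constG, subG, iteG, List.range_succ, r0, r1, rb]
  have h2 : ∀ b, layerOK (satC W) 9 (bitLayer S b) = true := by
    intro b
    simp [layerOK, bitLayer, headOK, progOK, gateOK, constG, addG, iteG, List.range_succ, r1,
      ratOK_int (hS.bit b)]
  have h3 : layerOK (satC W) 9 (checkLayer S) = true := by
    simp [layerOK, checkLayer, headOK, unitRow_ok hS.pos, progOK, prevScore, visitScore, gateOK,
      constG, addG, iteG, List.range_succ, r0, r1, rm, rs]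
  have h4 : layerOK (satC W) 3 countLayer = true := by
    simp [layerOK, countLayer, headOK, unitRow_ok hS.pos, progOK, prefixScore, gateOK,
      constG, iteG, List.range_succ, r0, r1]
  have h5 : progOK (satC W) 3 1 (outP S) = true := by
    simp [outP, progOK, gateOK, constG, addG, iteG, List.range_succ, r0, r1, ra]
  have hbits : ∀ ls, layersOK (satC W) (outP S) (true, 9) (x.map (bitLayer S) ++ ls) =
      layersOK (satC W) (outP S) (true, 9) ls := by
    intro ls
    induction x with
    | nil => rfl
    | cons b x ih =>
      have : layersOK (satC W) (outP S) (true, 9) ((b :: x).map (bitLayer S) ++ ls) =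
        layersOK (satC W) (outP S) (true && layerOK (satC W) 9 (bitLayer S b), 9)
          (x.map (bitLayer S) ++ ls) := rfl
      rw [this, h2, Bool.true_and]
      exact ih (by simpa [traceTE] using hdim)
  rw [teOK, hdim, Bool.and_eq_true]
  constructor
  · simp only [traceTE, List.all_map, List.all_eq_true, Function.comp]
    intro r hr
    have hr := hS.recs r hr
    have hd : InRange W r.d := by
      rcases hr.d with h | h | h <;> rw [h]
      exacts [inRange_one hS.pos, inRange_zero W, inRange_neg_one W]
    simp [embP, progOK, gateOK, constG, List.range_succ, ratOK_int hr.q, ratOK_int hr.g,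
      ratOK_int hr.q', ratOK_int hr.g', ratOK_int hd]
  · have e1 : layersOK (satC W) (outP S) (true, 6) (traceTE S W x).2.2.1 =
        layersOK (satC W) (outP S) (true && layerOK (satC W) 6 (headLayer S), 9)
          (x.map (bitLayer S) ++ [checkLayer S, countLayer]) := rfl
    have e2 : layersOK (satC W) (outP S) (true, 9) [checkLayer S, countLayer] =
        ((true && layerOK (satC W) 9 (checkLayer S) && layerOK (satC W) 3 countLayer) &&
          progOK (satC W) 3 1 (outP S)) := rfl
    have e3 : layersOK (traceTE S W x).1 (traceTE S W x).2.2.2 (true, 6) (traceTE S W x).2.2.1 =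
        layersOK (satC W) (outP S) (true, 6) (traceTE S W x).2.2.1 := rfl
    rw [e3, e1, h1, Bool.true_and, hbits, e2, h3, h4, h5]
    rfl

theorem exists_precise (c : ArithC) : ∃ n, Precise c n := by
  have : ∀ᶠ n in Filter.atTop, ∀ k ∈ intsTo (maxZ c), expOK c n k = true :=
    (Filter.eventually_all_finite (intsTo (maxZ c)).finite_toSet).2 fun k _ => expOK_eventually c k
  obtain ⟨n, hn⟩ := this.exists
  exact ⟨n, fun k hk => hn k (mem_intsTo.2 hk)⟩

/-- The trace encoder of a machine is satisfiable if and only if the machine has an accepting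
computation that is short enough for the arithmetic. -/
theorem satisfiable_traceTE {M : Complexity.NTM} {W : ℕ} (hS : (specOf M).Fits W) {x : List Bool}
    (hx : (x.length : ℤ) ≤ 2 ^ W - 1) :
    (toTE (traceTE (specOf M) W x)).WellFormed ∧ CanonTE (traceTE (specOf M) W x) ∧
    ((toTE (traceTE (specOf M) W x)).Satisfiable ↔
      ∃ n < 2 ^ W - 2, ∃ c, M.Reach x n c ∧ c.state = M.accept) := by
  have hne : (specOf M).recs ≠ [] := by
    have : recOf M (M.start, M.blank, none, false) ∈ (specOf M).recs :=
      (mem_recs M).2 ⟨_, by simp [Allowed], rfl⟩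
    exact List.ne_nil_of_mem this
  have hne' : (traceTE (specOf M) W x).2.1 ≠ [] := by simpa [traceTE] using hne
  obtain ⟨hc, hwf⟩ := (teOK_iff hne').1 (teOK_traceTE hS hne x)
  refine ⟨hwf, hc, ?_⟩
  obtain ⟨e, he⟩ := exists_precise (satC W)
  have hval : ∀ k, val (satC W) k = k := by simp [val, unitNum, unitDen, satC]
  have h8 : (traceTE (specOf M) W x).1 = satC W := rfl
  have hlen : (traceTE (specOf M) W x).2.1.length = (specOf M).recs.length := by simp [traceTE]
  rw [satisfiable_iff_evalZ (teOK_of_wellFormed hc hwf) he, accepts_iff_trace]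
  simp only [h8, hval, hlen]
  have h2W : ((2 ^ W : ℕ) : ℤ) = 2 ^ W := by push_cast; rfl
  constructor
  · rintro ⟨w, h1, h2, h3⟩
    have h3 : evalZ e (traceTE (specOf M) W x) w = 1 := by exact_mod_cast h3
    have hn : (w.length : ℤ) + 1 ≤ 2 ^ W - 1 := by
      by_contra hcon
      exact evalZ_traceTE_long hS (by omega) h2 h3
    have hpos : 0 < w.length := List.length_pos_iff.2 h1
    obtain ⟨ρ, hρ⟩ : ∃ ρ : ℕ → Rec, ∀ i < w.length,
        (specOf M).recs[w.getD i 0]? = some (ρ i) := by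
      refine ⟨fun i => (specOf M).recs.getD (w.getD i 0) ⟨0, 0, 0, 0, 0⟩, fun i hi => ?_⟩
      have : w.getD i 0 < (specOf M).recs.length := by
        refine h2 _ ?_
        rw [List.getD_eq_getElem?_getD, List.getElem?_eq_getElem hi]
        exact List.getElem_mem hi
      simp only [List.getD_eq_getElem _ _ this, List.getElem?_eq_getElem this]
    obtain ⟨h4, h5⟩ := (evalZ_traceTE hS hx h1 hn hρ).1 h3
    obtain ⟨k, hk⟩ : ∃ k, w.length = k + 1 := ⟨w.length - 1, by omega⟩
    rw [hk] at h4 h5 hρ hn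
    refine ⟨k, by push_cast at hn; omega, ρ, fun l hl => ?_, h4,
      by simpa using h5⟩
    have h6 := hρ l hl
    exact List.mem_of_getElem? h6
  · rintro ⟨n, hn, ρ, h1, h2, h3⟩
    have hidx : ∀ l : ℕ, ∃ i : ℕ, l < n + 1 → (specOf M).recs[i]? = some (ρ l) := by
      intro l
      by_cases hl : l < n + 1
      · obtain ⟨i, hi⟩ := List.getElem?_of_mem (h1 l hl)
        exact ⟨i, fun _ => hi⟩
      · exact ⟨0, fun h => absurd h hl⟩
    choose idx hidx using hidx
    have hw : ((List.range (n + 1)).map idx).length = n + 1 := by simp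
    have hget : ∀ l < n + 1, ((List.range (n + 1)).map idx).getD l 0 = idx l := by
      intro l hl
      rw [List.getD_eq_getElem?_getD, List.getElem?_map, List.getElem?_range hl]
      rfl
    refine ⟨(List.range (n + 1)).map idx, by simp, fun a ha => ?_, ?_⟩
    · obtain ⟨l, hl, rfl⟩ := List.mem_map.1 ha
      exact (List.getElem?_eq_some_iff.1 (hidx l (List.mem_range.1 hl))).1
    · have := (evalZ_traceTE (e := e) hS hx (w := (List.range (n + 1)).map idx) (by simp)
        (ρ := ρ) (by rw [hw]; push_cast; omega)
        (by rw [hw]; intro i hi; rw [hget i hi]; exact hidx i hi)).2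
        ⟨by rw [hw]; exact h2, by rw [hw]; exact h3⟩
      exact_mod_cast this

/-! ### A machine for string substitutions with padding -/

/-- The stacks: input, reversed input, output, and two stacks of tokens. -/
inductive Stack
  | inp | rev | out | tok | aux
  deriving DecidableEq

instance : Fintype Stack :=
  ⟨{.inp, .rev, .out, .tok, .aux}, fun s => by cases s <;> decide⟩

/-- The phases of the computation. `emit` writes the images of the bits, `mul`, `fwd`, `ret` and
`back` multiply the number of tokens by `n + 1`, `pad` writes a `true` for each token. -/
inductive Phase
  | start | load | emit | mul | fwd | ret | back | pad | clear
  deriving DecidableEq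

instance : Fintype Phase :=
  ⟨{.start, .load, .emit, .mul, .fwd, .ret, .back, .pad, .clear}, fun s => by cases s <;> decide⟩

/-- Statements of the machines below; the internal state is the result of the last `pop`. -/
abbrev PadStmt (k : ℕ) : Type :=
  Turing.TM2.Stmt (fun _ : Stack => Bool) (Phase × Fin (k + 1)) (Option Bool)

open Turing.TM2.Stmt in
/-- Pushing a fixed string. -/
def pushAll {k : ℕ} (s : Stack) : List Bool → PadStmt k → PadStmt k
  | [], q => q
  | b :: l, q => pushAll s l (push s (fun _ => b) q)

open Turing.TM2.Stmt in
/-- The program for the map `x ↦ P ++ true ^ (c * (n + 1) ^ k) ++ A ++ x.flatMap S ++ B`, where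
`n` is the length of `x`. -/
def padProg (P A B : List Bool) (S : Bool → List Bool) (c k : ℕ) :
    Phase × Fin (k + 1) → PadStmt k
  | (.start, i) => pushAll .out B (goto fun _ => (.load, i))
  | (.load, i) => pop .inp (fun _ o => o) (branch Option.isSome
      (push .rev (fun v => v.getD false) (goto fun _ => (.load, i))) (goto fun _ => (.emit, i)))
  | (.emit, i) => pop .rev (fun _ o => o) (branch Option.isSome
      (push .inp (fun v => v.getD false) (branch (fun v => v.getD false)
        (pushAll .out (S true) (goto fun _ => (.emit, i)))
        (pushAll .out (S false) (goto fun _ => (.emit, i)))))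
      (pushAll .out A (pushAll .tok (List.replicate c true) (goto fun _ => (.mul, i)))))
  | (.mul, i) => if h : (i : ℕ) < k then
        pop .tok (fun _ o => o) (branch Option.isSome (goto fun _ => (.fwd, i))
          (goto fun _ => (.back, ⟨i + 1, by omega⟩)))
      else goto fun _ => (.pad, i)
  | (.fwd, i) => pop .inp (fun _ o => o) (branch Option.isSome
      (push .rev (fun v => v.getD false) (push .aux (fun _ => true) (goto fun _ => (.fwd, i))))
      (push .aux (fun _ => true) (goto fun _ => (.ret, i))))
  | (.ret, i) => pop .rev (fun _ o => o) (branch Option.isSome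
      (push .inp (fun v => v.getD false) (goto fun _ => (.ret, i))) (goto fun _ => (.mul, i)))
  | (.back, i) => pop .aux (fun _ o => o) (branch Option.isSome
      (push .tok (fun _ => true) (goto fun _ => (.back, i))) (goto fun _ => (.mul, i)))
  | (.pad, i) => pop .tok (fun _ o => o) (branch Option.isSome
      (push .out (fun _ => true) (goto fun _ => (.pad, i))) (goto fun _ => (.clear, i)))
  | (.clear, i) => pop .inp (fun _ o => o) (branch Option.isSome
      (goto fun _ => (.clear, i)) (pushAll .out P halt))

/-- The stack machine with the transitions `padProg`. -/
def padTM (P A B : List Bool) (S : Bool → List Bool) (c k : ℕ) : Turing.FinTM2 where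
  K := Stack
  k₀ := .inp
  k₁ := .out
  Γ _ := Bool
  Λ := Phase × Fin (k + 1)
  main := (.start, 0)
  σ := Option Bool
  initialState := none
  m := padProg P A B S c k

/-- The stacks with given contents. -/
def stackFn (i r o t a : List Bool) : Stack → List Bool
  | .inp => i
  | .rev => r
  | .out => o
  | .tok => t
  | .aux => a

section
variable (i r o t a u : List Bool)

@[simp] theorem update_inp : Function.update (stackFn i r o t a) .inp u = stackFn u r o t a := by
  funext s; cases s <;> rfl

@[simp] theorem update_rev : Function.update (stackFn i r o t a) .rev u = stackFn i u o t a := by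
  funext s; cases s <;> rfl

@[simp] theorem update_out : Function.update (stackFn i r o t a) .out u = stackFn i r u t a := by
  funext s; cases s <;> rfl

@[simp] theorem update_tok : Function.update (stackFn i r o t a) .tok u = stackFn i r o u a := by
  funext s; cases s <;> rfl

@[simp] theorem update_aux : Function.update (stackFn i r o t a) .aux u = stackFn i r o t u := by
  funext s; cases s <;> rfl

end

theorem stepAux_pushAll {k : ℕ} (s : Stack) (l : List Bool) (q : PadStmt k) (v : Option Bool)
    (st : Stack → List Bool) : Turing.TM2.stepAux (pushAll s l q) v st =
      Turing.TM2.stepAux q v (Function.update st s (l ++ st s)) := by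
  induction l generalizing q with
  | nil => simp [pushAll]
  | cons b l ih => rw [pushAll, ih]; simp

section
variable {P A B : List Bool} {S : Bool → List Bool} {c k : ℕ}

/-- The configurations. -/
abbrev PadCfg (k : ℕ) : Type :=
  Turing.TM2.Cfg (fun _ : Stack => Bool) (Phase × Fin (k + 1)) (Option Bool)

/-- The configuration with label `l`, last popped symbol `v` and the given stack contents. -/
def cfg (l : Phase × Fin (k + 1)) (v : Option Bool) (i r o t a : List Bool) : PadCfg k :=
  ⟨some l, v, stackFn i r o t a⟩

/-- The machine goes from one configuration to another one in `n` steps. -/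
def Runs (P A B : List Bool) (S : Bool → List Bool) (c : ℕ) (n : ℕ) (x y : PadCfg k) : Prop :=
  (flip bind (Turing.TM2.step (padProg P A B S c k)))^[n] (some x) = some y

theorem Runs.trans {m n : ℕ} {x y z : PadCfg k} (h1 : Runs P A B S c m x y)
    (h2 : Runs P A B S c n y z) : Runs P A B S c (m + n) x z := by
  unfold Runs at *
  rw [Nat.add_comm m n, Function.iterate_add_apply, h1, h2]

theorem runs_one {x y : PadCfg k}
    (h : Turing.TM2.step (padProg P A B S c k) x = some y) : Runs P A B S c 1 x y := h

variable (j : Fin (k + 1)) (v : Option Bool) (i r o t a : List Bool)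

theorem runs_load : Runs P A B S c (i.length + 1)
    (cfg (.load, j) v i r o t a) (cfg (.emit, j) none [] (i.reverse ++ r) o t a) := by
  induction i generalizing r v with
  | nil => exact runs_one (by simp [cfg, padProg, stackFn])
  | cons b i ih =>
    have h1 : Runs P A B S c 1
        (cfg (.load, j) v (b :: i) r o t a) (cfg (.load, j) (some b) i (b :: r) o t a) :=
      runs_one (by simp [cfg, padProg, stackFn])
    have h2 := h1.trans (ih (some b) (b :: r))
    rw [Nat.add_comm] at h2
    simpa using h2

theorem runs_emit : Runs P A B S c (r.length + 1)
    (cfg (.emit, j) v i r o t a) (cfg (.mul, j) none (r.reverse ++ i) []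
      (A ++ (r.reverse.flatMap S ++ o)) (List.replicate c true ++ t) a) := by
  induction r generalizing i v o with
  | nil => exact runs_one (by simp [cfg, padProg, stackFn, stepAux_pushAll])
  | cons b r ih =>
    have h1 : Runs P A B S c 1
        (cfg (.emit, j) v i (b :: r) o t a)
        (cfg (.emit, j) (some b) (b :: i) r (S b ++ o) t a) :=
      runs_one (by cases b <;> simp [cfg, padProg, stackFn, stepAux_pushAll])
    have h2 := h1.trans (ih (some b) (b :: i) (S b ++ o))
    rw [Nat.add_comm] at h2
    simpa [List.flatMap_append] using h2

theorem runs_fwd : Runs P A B S c (i.length + 1)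
    (cfg (.fwd, j) v i r o t a) (cfg (.ret, j) none [] (i.reverse ++ r) o t
      (List.replicate (i.length + 1) true ++ a)) := by
  induction i generalizing r v a with
  | nil => exact runs_one (by simp [cfg, padProg, stackFn])
  | cons b i ih =>
    have h1 : Runs P A B S c 1
        (cfg (.fwd, j) v (b :: i) r o t a) (cfg (.fwd, j) (some b) i (b :: r) o t (true :: a)) :=
      runs_one (by simp [cfg, padProg, stackFn])
    have h2 := h1.trans (ih (some b) (b :: r) (true :: a))
    rw [Nat.add_comm] at h2
    have h3 : List.replicate (i.length + 1) true ++ true :: a =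
        List.replicate ((b :: i).length + 1) true ++ a := by
      rw [List.length_cons, List.replicate_succ' (n := i.length + 1), List.append_assoc]
      rfl
    rw [h3] at h2
    simpa using h2

theorem runs_ret : Runs P A B S c (r.length + 1)
    (cfg (.ret, j) v i r o t a) (cfg (.mul, j) none (r.reverse ++ i) [] o t a) := by
  induction r generalizing i v with
  | nil => exact runs_one (by simp [cfg, padProg, stackFn])
  | cons b r ih =>
    have h1 : Runs P A B S c 1
        (cfg (.ret, j) v i (b :: r) o t a) (cfg (.ret, j) (some b) (b :: i) r o t a) :=
      runs_one (by simp [cfg, padProg, stackFn])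
    have h2 := h1.trans (ih (some b) (b :: i))
    rw [Nat.add_comm] at h2
    simpa using h2

theorem runs_back (n : ℕ) : Runs P A B S c (n + 1)
    (cfg (.back, j) v i r o t (List.replicate n true))
    (cfg (.mul, j) none i r o (List.replicate n true ++ t) []) := by
  induction n generalizing t v with
  | zero => exact runs_one (by simp [cfg, padProg, stackFn])
  | succ n ih =>
    have h1 : Runs P A B S c 1
        (cfg (.back, j) v i r o t (List.replicate (n + 1) true))
        (cfg (.back, j) (some true) i r o (true :: t) (List.replicate n true)) :=
      runs_one (by simp [cfg, padProg, stackFn, List.replicate_succ])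
    have h2 := h1.trans (ih (some true) (true :: t))
    rw [Nat.add_comm] at h2
    rwa [← List.singleton_append (l := t), ← List.append_assoc, ← List.replicate_succ'] at h2

theorem runs_pad (n : ℕ) : Runs P A B S c (n + 1)
    (cfg (.pad, j) v i r o (List.replicate n true) a)
    (cfg (.clear, j) none i r (List.replicate n true ++ o) [] a) := by
  induction n generalizing o v with
  | zero => exact runs_one (by simp [cfg, padProg, stackFn])
  | succ n ih =>
    have h1 : Runs P A B S c 1
        (cfg (.pad, j) v i r o (List.replicate (n + 1) true) a)
        (cfg (.pad, j) (some true) i r (true :: o) (List.replicate n true) a) :=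
      runs_one (by simp [cfg, padProg, stackFn, List.replicate_succ])
    have h2 := h1.trans (ih (some true) (true :: o))
    rw [Nat.add_comm] at h2
    rwa [← List.singleton_append (l := o), ← List.append_assoc, ← List.replicate_succ'] at h2

theorem runs_clear : Runs P A B S c (i.length + 1)
    (cfg (.clear, j) v i r o t a) ⟨none, none, stackFn [] r (P ++ o) t a⟩ := by
  induction i generalizing v with
  | nil => exact runs_one (by simp [cfg, padProg, stackFn, stepAux_pushAll])
  | cons b i ih =>
    have h1 : Runs P A B S c 1
        (cfg (.clear, j) v (b :: i) r o t a) (cfg (.clear, j) (some b) i r o t a) :=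
      runs_one (by simp [cfg, padProg, stackFn])
    have h2 := h1.trans (ih (some b))
    rw [Nat.add_comm] at h2
    simpa using h2

/-- Each token is replaced with `n + 1` tokens. -/
theorem runs_mul (hj : (j : ℕ) < k) (n m : ℕ) :
    Runs P A B S c (n * (2 * i.length + 3) + 1)
    (cfg (.mul, j) v i [] o (List.replicate n true) (List.replicate m true))
    (cfg (.back, ⟨j + 1, by omega⟩) none i [] o [] (List.replicate (n * (i.length + 1) + m) true))
    := by
  induction n generalizing v m with
  | zero =>
    have h1 : Runs P A B S c 1 (cfg (.mul, j) v i [] o [] (List.replicate m true))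
        (cfg (.back, ⟨j + 1, by omega⟩) none i [] o [] (List.replicate m true)) :=
      runs_one (by simp [cfg, padProg, stackFn, hj])
    simpa using h1
  | succ n ih =>
    have h1 : Runs P A B S c 1
        (cfg (.mul, j) v i [] o (List.replicate (n + 1) true) (List.replicate m true))
        (cfg (.fwd, j) (some true) i [] o (List.replicate n true) (List.replicate m true)) :=
      runs_one (by simp [cfg, padProg, stackFn, hj, List.replicate_succ])
    have h2 := h1.trans (runs_fwd j (some true) i [] o (List.replicate n true)
      (List.replicate m true))
    have h3 := h2.trans (runs_ret j none [] (i.reverse ++ []) o (List.replicate n true) _)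
    rw [← List.replicate_add] at h3
    simp only [List.append_nil, List.reverse_reverse, List.length_reverse] at h3
    have h4 := h3.trans (ih none (i.length + 1 + m))
    have e1 : 1 + (i.length + 1) + (i.length + 1) + (n * (2 * i.length + 3) + 1) =
        (n + 1) * (2 * i.length + 3) + 1 := by ring
    have e2 : n * (i.length + 1) + (i.length + 1 + m) = (n + 1) * (i.length + 1) + m := by ring
    rwa [e1, e2] at h4

theorem runs_rounds (d : ℕ) (j : Fin (k + 1)) (hj : (j : ℕ) + d = k) (n : ℕ) :
    ∃ v', Runs P A B S c
      ((∑ l ∈ Finset.range d, (n * (i.length + 1) ^ l * (3 * i.length + 4) + 2)) + 1)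
      (cfg (.mul, j) v i [] o (List.replicate n true) [])
      (cfg (.pad, ⟨k, Nat.lt_succ_self k⟩) v' i [] o
        (List.replicate (n * (i.length + 1) ^ d) true) []) := by
  induction d generalizing j v n with
  | zero =>
    have hjk : j = ⟨k, Nat.lt_succ_self k⟩ := Fin.ext (by simpa using hj)
    subst hjk
    exact ⟨v, runs_one (by simp [cfg, padProg])⟩
  | succ d ih =>
    have h1 := runs_mul (P := P) (A := A) (B := B) (S := S) (c := c) j v i o (by omega) n 0
    have h2 := h1.trans (runs_back ⟨j + 1, by omega⟩ none i [] o [] _)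
    rw [List.append_nil, Nat.add_zero] at h2
    obtain ⟨v', h3⟩ := ih none ⟨j + 1, by omega⟩ (by simp only; omega) (n * (i.length + 1))
    refine ⟨v', ?_⟩
    have h4 := h2.trans h3
    have e1 : n * (2 * i.length + 3) + 1 + (n * (i.length + 1) + 1) +
        ((∑ l ∈ Finset.range d, (n * (i.length + 1) * (i.length + 1) ^ l * (3 * i.length + 4) + 2))
          + 1) =
        (∑ l ∈ Finset.range (d + 1), (n * (i.length + 1) ^ l * (3 * i.length + 4) + 2)) + 1 := by
      rw [Finset.sum_range_succ']
      have : ∀ l, n * (i.length + 1) * (i.length + 1) ^ l = n * (i.length + 1) ^ (l + 1) := by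
        intro l; ring
      simp only [this]
      ring
    have e2 : n * (i.length + 1) * (i.length + 1) ^ d = n * (i.length + 1) ^ (d + 1) := by ring
    rw [e1, e2] at h4
    exact h4

end

/-- The number of steps for an input of length `n`. -/
def padTime (c k n : ℕ) : ℕ :=
  1 + (n + 1) + (n + 1) +
    ((∑ l ∈ Finset.range k, (c * (n + 1) ^ l * (3 * n + 4) + 2)) + 1) +
    (c * (n + 1) ^ k + 1) + (n + 1)

/-- Maps that substitute fixed strings for the bits of the input, and add fixed strings and a
padding of polynomial length, are computable in polynomial time. -/
theorem polyTime_pad (P A B : List Bool) (S : Bool → List Bool) (c k : ℕ) :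
    Complexity.PolyTime (fun x => P ++ (List.replicate (c * (x.length + 1) ^ k) true ++
      (A ++ (x.flatMap S ++ B)))) := by
  have key : ∀ x : List Bool, Runs P A B S c (k := k)
      (padTime c k x.length)
      ⟨some (.start, 0), none, stackFn x [] [] [] []⟩
      ⟨none, none, stackFn [] [] (P ++ (List.replicate (c * (x.length + 1) ^ k) true ++
      (A ++ (x.flatMap S ++ B)))) [] []⟩ := by
    intro x
    have h1 : Runs P A B S c 1
        (cfg (.start, (0 : Fin (k + 1))) none x [] [] [] []) (cfg (.load, 0) none x [] B [] []) :=
      runs_one (by simp [cfg, padProg, stackFn, stepAux_pushAll])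
    have h2 := h1.trans (runs_load 0 none x [] B [] [])
    have h3 := h2.trans (runs_emit 0 none [] (x.reverse ++ []) B [] [])
    simp only [List.append_nil, List.reverse_reverse, List.length_reverse] at h3
    obtain ⟨v', h4⟩ := runs_rounds (P := P) (A := A) (B := B) (S := S) (c := c) none x
      (A ++ (x.flatMap S ++ B)) k (0 : Fin (k + 1)) (by simp) c
    exact ((h3.trans h4).trans (runs_pad _ v' x [] _ [] _)).trans (runs_clear _ none x [] _ [] [])
  refine ⟨{ tm := padTM P A B S c k
            inputAlphabet := Equiv.refl Bool
            outputAlphabet := Equiv.refl Bool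
            time := 1 + (Polynomial.X + 1) + (Polynomial.X + 1) +
              ((∑ l ∈ Finset.range k, ((c : Polynomial ℕ) * (Polynomial.X + 1) ^ l *
                (3 * Polynomial.X + 4) + 2)) + 1) + ((c : Polynomial ℕ) * (Polynomial.X + 1) ^ k + 1) +
              (Polynomial.X + 1)
            outputsFun := fun x => ⟨⟨padTime c k x.length, ?_⟩, le_of_eq ?_⟩ }⟩
  · have h0 : ∀ y : List Bool, y.map (Equiv.refl Bool).invFun = y := fun y => List.map_id y
    have h1 : ∀ y : List Bool, Turing.initList (padTM P A B S c k) y =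
        ⟨some (.start, 0), none, stackFn y [] [] [] []⟩ := by
      intro y
      refine congrArg (Turing.TM2.Cfg.mk _ _) (funext fun s => ?_)
      cases s <;> rfl
    have h2 : ∀ y : List Bool, Turing.haltList (padTM P A B S c k) y =
        ⟨none, none, stackFn [] [] y [] []⟩ := by
      intro y
      refine congrArg (Turing.TM2.Cfg.mk _ _) (funext fun s => ?_)
      cases s <;> rfl
    have h3 := (congrArg _ (h0 x)).trans (h1 x)
    have h4 := (congrArg _ (h0 _)).trans (h2 (P ++ (List.replicate (c * (x.length + 1) ^ k) true ++
      (A ++ (x.flatMap S ++ B)))))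
    exact (congrArg (fun z => (flip bind (padTM P A B S c k).step)^[padTime c k x.length]
      (some z)) h3).trans (Eq.trans (key x) (congrArg some h4.symm))
  · simp [Polynomial.eval_finsetSum, padTime]

/-! ### Hardness -/

theorem encTEC_traceTE (S : Spec) (W : ℕ) (x : List Bool) :
    encTEC (traceTE S W x) = [false] ++ (List.replicate W true ++
      (([false, false, false, false, true] ++ (encListC (fun p => encProgC p) (S.recs.map embP) ++
        (true :: encLayerC (headLayer S)))) ++
      (x.flatMap (fun b => true :: encLayerC (bitLayer S b)) ++
        ((true :: encLayerC (checkLayer S)) ++ ((true :: encLayerC countLayer) ++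
          ([false] ++ encProgC (outP S))))))) := by
  simp [encTEC, traceTE, encArithC, satC, encUnaryC, encListC, List.flatMap_map]

theorem eval_le (p : Polynomial ℕ) (n : ℕ) :
    p.eval n ≤ p.eval 1 * (n + 1) ^ (p.natDegree + 1) := by
  rw [Polynomial.eval_eq_sum_range, Polynomial.eval_eq_sum_range, Finset.sum_mul]
  refine Finset.sum_le_sum fun i hi => ?_
  rw [one_pow, mul_one]
  refine Nat.mul_le_mul_left _ ?_
  have hi := Finset.mem_range.1 hi
  exact (Nat.pow_le_pow_left (Nat.le_succ n) i).trans (Nat.pow_le_pow_right (by omega) (by omega))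

theorem nexptimeHard_trSAT {C : Set TE} (hC : TFixSat ⊆ C) :
    Complexity.NEXPTIMEHard (trSAT C) := by
  rintro A ⟨M, p, hM⟩
  set a := p.eval 1 + Nat.card M.State + Nat.card M.Sym + 3 with ha
  set k := p.natDegree + 1 with hk
  let W : List Bool → ℕ := fun x => a * (x.length + 1) ^ k
  refine ⟨fun x => encTEC (traceTE (specOf M) (W x) x), ?_, fun x => ?_⟩
  · simp only [encTEC_traceTE]
    exact polyTime_pad _ _ _ _ a k
  · have hpow : x.length + 1 ≤ (x.length + 1) ^ k := Nat.le_self_pow (by omega) _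
    have hW : p.eval x.length + Nat.card M.State + Nat.card M.Sym + 3 ≤ W x := by
      have e1 := eval_le p x.length
      rw [← hk] at e1
      have e2 : W x = p.eval 1 * (x.length + 1) ^ k +
          (Nat.card M.State + Nat.card M.Sym + 3) * (x.length + 1) ^ k := by
        simp only [W, ha]; ring
      have e3 : (Nat.card M.State + Nat.card M.Sym + 3) * 1 ≤
          (Nat.card M.State + Nat.card M.Sym + 3) * (x.length + 1) ^ k :=
        Nat.mul_le_mul_left _ (by omega)
      omega
    have hlen : x.length + 1 ≤ W x := by
      have : 1 * (x.length + 1) ^ k ≤ W x := Nat.mul_le_mul_right _ (by omega)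
      omega
    have hx : (x.length : ℤ) ≤ 2 ^ W x - 1 := by
      have : W x < 2 ^ W x := Nat.lt_two_pow_self
      have : (W x : ℤ) < 2 ^ W x := by exact_mod_cast this
      omega
    have hbound : 2 ^ p.eval x.length < 2 ^ W x - 2 := by
      have e1 : 2 ^ (p.eval x.length + 3) ≤ 2 ^ W x := Nat.pow_le_pow_right (by norm_num) (by omega)
      have e2 : 2 ^ (p.eval x.length + 3) = 8 * 2 ^ p.eval x.length := by ring
      have e3 : 0 < 2 ^ p.eval x.length := by positivity
      omega
    obtain ⟨hwf, hc, hsat⟩ := satisfiable_traceTE (M := M) (W := W x)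
      (fits_specOf M (by omega)) hx
    obtain ⟨hM1, hM2⟩ := hM x
    have hacc : x ∈ A ↔ (toTE (traceTE (specOf M) (W x) x)).Satisfiable := by
      rw [hM2, hsat]
      constructor
      · rintro ⟨n, c, hr, ha⟩
        exact ⟨n, (hM1 n c hr).trans_lt hbound, c, hr, ha⟩
      · rintro ⟨n, -, c, hr, ha⟩
        exact ⟨n, c, hr, ha⟩
    rw [hacc]
    change _ ↔ encTEC (traceTE (specOf M) (W x) x) ∈ trSAT C
    rw [← encode_te hc]
    constructor
    · intro h
      exact ⟨_, hC ⟨hwf, rfl⟩, rfl, h⟩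
    · rintro ⟨T, hT, he, h⟩
      rwa [← TE.encode_injective he]

end TransformerSat

theorem theorem5 :
    (Complexity.Decidable (Transformer.trSAT Transformer.TFix) ∧
      Complexity.NEXPTIMEHard (Transformer.trSAT Transformer.TFix)) ∧
    (Complexity.Decidable (Transformer.trSAT Transformer.TFixSat) ∧
      Complexity.NEXPTIMEHard (Transformer.trSAT Transformer.TFixSat)) :=
  ⟨⟨TransformerSat.decidable_trSAT_fix, TransformerSat.nexptimeHard_trSAT fun _ h => h.1⟩,
    ⟨TransformerSat.decidable_trSAT_fixSat, TransformerSat.nexptimeHard_trSAT subset_rfl⟩⟩
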